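/- **Theorem 3.3.** There are absolute constants $c,C,K>0$ such that the following holds. Let $n,d\ge 1$ and $m\ge d$ be integers, let $\boldsymbol{A}\in\mathbb{R}^{d\times m}$ have smallest singular value $\sigma_{\min}(\boldsymbol{A})>0$, operator norm $\|\boldsymbol{A}\|=\sigma_{\max}(\boldsymbol{A})$ and condition number $\kappa=\sigma_{\max}(\boldsymbol{A})/\sigma_{\min}(\boldsymbol{A})$, let $\boldsymbol{O}_1,\dots,\boldsymbol{O}_n$ be orthogonal $d\times d$ matrices, and let $\sigma\ge 0$ and $\gamma\ge 2$ be real numbers. We observe $$\boldsymbol{A}_i=\boldsymbol{O}_i\boldsymbol{A}+\sigma\boldsymbol{W}_i,\qquad 1\le i\le n,$$ where the entries of all the $\boldsymbol{W}_i\in\mathbb{R}^{d\times m}$ are independent standard Gaussian random variables. Assume that $$\sigma\le c\,\frac{\sigma_{\min}(\boldsymbol{A})}{\kappa^4}\cdot\frac{\sqrt n}{\sqrt d\,(\sqrt{nd}+\sqrt m+\sqrt{2\gamma n\log n})}.$$ Let $\boldsymbol{D}\in\mathbb{R}^{nd\times m}$ be the matrix with blocks $\boldsymbol{A}_1,\dots,\boldsymbol{A}_n$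 stacked on top of each other and $\boldsymbol{C}=\boldsymbol{D}\boldsymbol{D}^\top$. For $\boldsymbol{X}\in\mathbb{R}^{d\times d}$ with singular value decomposition $\boldsymbol{X}=\boldsymbol{U}\boldsymbol{\Sigma}\boldsymbol{V}^\top$ put $\mathcal{P}(\boldsymbol{X})=\boldsymbol{U}\boldsymbol{V}^\top$, and let $\mathcal{P}_n$ apply $\mathcal{P}$ to each of the $n$ blocks of size $d\times d$ of an $nd\times d$ matrix. The generalized power method with spectral initialization is $$\boldsymbol{S}^0=\mathcal{P}_n(\boldsymbol{U}),\qquad \boldsymbol{S}^{t+1}=\mathcal{P}_n(\boldsymbol{C}\boldsymbol{S}^t)\quad(t\ge 0),$$ where the columns of $\boldsymbol{U}\in\mathbb{R}^{nd\times d}$ are orthonormal top $d$ left singular vectors of $\boldsymbol{D}$; wherever singular vectors are not unique, any choice is allowed. Write $d_F(\boldsymbol{X},\boldsymbol{Y})=\min_{\boldsymbol{Q}}\|\boldsymbol{X}-\boldsymbol{Y}\boldsymbol{Q}\|_F$, where here and below $\boldsymbol{Q}$ ranges over the orthogonal $d\times d$ matrices. Then there is an event of probability at least $1-Kn^{-\gamma+2}$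 on which, for every such sequence $(\boldsymbol{S}^t)_{t\ge0}$, there is a limiting point, i.e. an $\boldsymbol{S}^\infty$ consisting of $n$ orthogonal $d\times d$ blocks $\boldsymbol{S}^\infty_1,\dots,\boldsymbol{S}^\infty_n$ with $d_F(\boldsymbol{S}^t,\boldsymbol{S}^\infty)\to 0$, and every limiting point satisfies $$\min_{\boldsymbol{Q}}\max_{1\le i\le n}\|\boldsymbol{S}_i^\infty-\boldsymbol{O}_i\boldsymbol{Q}\|_F\le C\,\frac{\kappa^2}{\|\boldsymbol{A}\|}\cdot\frac{\sigma\sqrt d\,(\sqrt{nd}+\sqrt m+\sqrt{2\gamma n\log n})}{\sqrt n},$$ $$\min_{\boldsymbol{Q}}\Big\|\frac1n\sum_{i=1}^n(\boldsymbol{S}_i^\infty)^\top\boldsymbol{A}_i-\boldsymbol{Q}\boldsymbol{A}\Big\|_F\le C\,\frac{\kappa^2\sigma\sqrt d\,(\sqrt{nd}+\sqrt m+\sqrt{2\gamma n\log n})}{\sqrt n}.$$ If $\boldsymbol{O}_i=\boldsymbol{I}_d$ for all $i$, the last bound also holds with $\boldsymbol{S}_i^\infty$ in place of $(\boldsymbol{S}_i^\infty)^\top$.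 -/

import Mathlib

open Matrix MeasureTheory ProbabilityTheory Filter Topology

noncomputable section

namespace Procrustes

/-- The Frobenius norm of a real matrix. -/
def frobNorm {ι κ : Type*} [Fintype ι] [Fintype κ] (X : Matrix ι κ ℝ) : ℝ :=
  Real.sqrt (∑ i, ∑ j, X i j ^ 2)

/-- The operator norm of a real matrix with respect to the Euclidean norms,
i.e. its largest singular value. -/
def opNorm {ι κ : Type*} [Fintype ι] [Fintype κ] [DecidableEq κ] (X : Matrix ι κ ℝ) : ℝ :=
  ‖LinearMap.toContinuousLinearMap (Matrix.toEuclideanLin X)‖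

/-- The smallest (that is, the `d`-th largest) singular value of a `d × m` matrix with
`1 ≤ d ≤ m`. It is read off from the transpose, which has the same `d` singular values;
Mathlib lists singular values in decreasing order starting from index `0`. -/
def sigmaMin {d m : ℕ} (A : Matrix (Fin d) (Fin m) ℝ) : ℝ :=
  (Matrix.toEuclideanLin Aᵀ).singularValues (d - 1)

/-- The condition number of `A`. -/
def condNumber {d m : ℕ} (A : Matrix (Fin d) (Fin m) ℝ) : ℝ :=
  opNorm A / sigmaMin A

/-- The `nd × k` matrix with the `d × k` blocks `B 0, …, B (n - 1)` on top of each other. -/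
def stack {n d k : ℕ} (B : Fin n → Matrix (Fin d) (Fin k) ℝ) :
    Matrix (Fin n × Fin d) (Fin k) ℝ :=
  Matrix.of fun p b => B p.1 p.2 b

/-- The `i`-th `d × k` block of an `nd × k` matrix. -/
def block {n d k : ℕ} (X : Matrix (Fin n × Fin d) (Fin k) ℝ) (i : Fin n) :
    Matrix (Fin d) (Fin k) ℝ :=
  Matrix.of fun a b => X (i, a) b

/-- `R` is a value of `𝒫(X) = U Vᵀ`, where `X = U diag(s) Vᵀ` is a singular value decomposition.
The value is unique if `X` is invertible; otherwise every choice of the SVD is admitted. -/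
def IsMatrixSign {d : ℕ} (X R : Matrix (Fin d) (Fin d) ℝ) : Prop :=
  ∃ U ∈ orthogonalGroup (Fin d) ℝ, ∃ V ∈ orthogonalGroup (Fin d) ℝ, ∃ s : Fin d → ℝ,
    (∀ k, 0 ≤ s k) ∧ X = U * diagonal s * Vᵀ ∧ R = U * Vᵀ

/-- The columns of `U` are top `d` left singular vectors of `D`: together with
orthonormal right singular vectors (the columns of `V`) and singular values `s` they satisfy the
singular vector equations, and no singular value of `D` on the orthogonal complement of the columns
of `U` exceeds any of the `s k`. Every choice of the singular vectors is admitted. -/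
def IsTopLeftSingular {ι : Type*} [Fintype ι] {d m : ℕ}
    (D : Matrix ι (Fin m) ℝ) (U : Matrix ι (Fin d) ℝ) : Prop :=
  ∃ (V : Matrix (Fin m) (Fin d) ℝ) (s : Fin d → ℝ),
    Uᵀ * U = 1 ∧ Vᵀ * V = 1 ∧ (∀ k, 0 ≤ s k) ∧
    D * V = U * diagonal s ∧ Dᵀ * U = V * diagonal s ∧
    ∀ x : ι → ℝ, Uᵀ *ᵥ x = 0 → ∀ k, (Dᵀ *ᵥ x) ⬝ᵥ (Dᵀ *ᵥ x) ≤ s k ^ 2 * (x ⬝ᵥ x)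

/-- `S 0, S 1, …` is a run, on the observed point clouds `obs i` (the `A_i`), of the generalized
power method `S^{t+1} = 𝒫ₙ(C S^t)`, `C = D Dᵀ`, with spectral initialization `S⁰ = 𝒫ₙ(U)`;
here `D` stacks the observations and `U` holds top `d` left singular vectors of `D`. -/
def IsSpectralGPM {n d m : ℕ} (obs : Fin n → Matrix (Fin d) (Fin m) ℝ)
    (S : ℕ → Fin n → Matrix (Fin d) (Fin d) ℝ) : Prop :=
  (∃ U : Matrix (Fin n × Fin d) (Fin d) ℝ,
    IsTopLeftSingular (stack obs) U ∧ ∀ i, IsMatrixSign (block U i) (S 0 i)) ∧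
  ∀ t i, IsMatrixSign (block (stack obs * (stack obs)ᵀ * stack (S t)) i) (S (t + 1) i)

/-- `d_F(X, Y) = min_Q ‖X - Y Q‖_F`, the minimum being over orthogonal `Q`. -/
def dF {n d : ℕ} (X Y : Matrix (Fin n × Fin d) (Fin d) ℝ) : ℝ :=
  ⨅ Q : orthogonalGroup (Fin d) ℝ, frobNorm (X - Y * (Q : Matrix (Fin d) (Fin d) ℝ))

/-- The `n`-tuple of orthogonal matrices `L` is a limiting point of the sequence `S`: the distance
`d_F(S^t, L)` tends to zero. -/
def IsLimitPoint {n d : ℕ} (S : ℕ → Fin n → Matrix (Fin d) (Fin d) ℝ)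
    (L : Fin n → Matrix (Fin d) (Fin d) ℝ) : Prop :=
  (∀ i, L i ∈ orthogonalGroup (Fin d) ℝ) ∧
  Tendsto (fun t => dF (stack (S t)) (stack L)) atTop (𝓝 0)

/-- The entries of all the random `d × m` matrices `W i` are independent standard Gaussians. -/
def IsGaussianNoise {n d m : ℕ} {Ω : Type*} [MeasurableSpace Ω] (P : Measure Ω)
    (W : Fin n → Ω → Matrix (Fin d) (Fin m) ℝ) : Prop :=
  (∀ i a b, HasLaw (fun ω => W i ω a b) (gaussianReal 0 1) P) ∧
  iIndepFun (fun (q : Fin n × Fin d × Fin m) (ω : Ω) => W q.1 ω q.2.1 q.2.2) P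

/-- `√d (√(nd) + √m + √(2 γ n log n))`. -/
def noiseFactor (n d m : ℕ) (γ : ℝ) : ℝ :=
  Real.sqrt d * (Real.sqrt (n * d) + Real.sqrt m + Real.sqrt (2 * γ * n * Real.log n))

end Procrustes

end

/-! Undoing the rotations turns the data into `A + Z i` with `Z i = (O i)ᵀ * (σ • W i)`, and the
power method is equivariant under this change. It remains to find one fixed point whose blocks are
all near the identity, and to show that the spectral initialization lies in its basin of attraction.

The power map sends `S` to the polar factors of `(A + Z i) * ∑ j, (A + Z j)ᵀ * S j`. It commutes
with right multiplication by a global rotation, so it cannot contract along the orbit. The auxiliary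
map `symStep` removes these neutral directions by symmetrizing `∑ S j` in the signal term.
Differences of orthogonal matrices near the identity are antisymmetric to first order
(`frobNorm_symPart_sub_le`), so the symmetrized signal contributes little to the Lipschitz constant
and the map contracts. Truncating the polar factor (`exists_truncated_polar`) makes the map globally
defined and Lipschitz, so a fixed point exists before any blockwise control is known. If the
truncation is inactive there, symmetry of the polar parts forces `∑ S j` to be symmetric
(`symPart_sum_eq_of_polar`), and the fixed point is one of the original map.

The crux is to bound `Z i * symAggregate A Z S` for each single `i`, although the fixed point
depends on `Z i`. The leave-one-out argument compares `S` with the `n`-th iterate of the map in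
which `Z i` is replaced by zero. That iterate is independent of `Z i` and within distance `1` of `S`
(`frobNorm_sub_leaveOneOut_le`), so a Gaussian tail bound for a block times an independent matrix
applies, and the remainder is handled by the operator norm of the whole noise
(`frobNorm_noise_error_le`, `exists_good_fixedPoint`).

Convergence is local: after optimal alignment one step halves the distance to the orbit of the fixed
point (`gpm_step`), and centering the top singular vectors over the blocks shows that the start is
close enough (`spectral_init`). All limiting points lie on one orbit, so they inherit the blockwise
bound. The probabilistic input is exponential moments of squared norms (`gaussianPi_opNorm_tail`,
`gaussianPi_mul_tail_of_indep`). -/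

noncomputable section

namespace Procrustes

/-! ### Frobenius and operator norms. -/

section Frobenius

variable {ι κ l : Type*} [Fintype ι] [Fintype κ] [Fintype l]

/-- The Frobenius inner product of real matrices. -/
def frobInner (X Y : Matrix ι κ ℝ) : ℝ := trace (Xᵀ * Y)

lemma frobInner_eq_sum (X Y : Matrix ι κ ℝ) : frobInner X Y = ∑ i, ∑ j, X i j * Y i j := by
  simp only [frobInner, trace, diag_apply, mul_apply, transpose_apply]
  exact Finset.sum_comm

lemma frobInner_sub_left (X Y Z : Matrix ι κ ℝ) :
    frobInner (X - Y) Z = frobInner X Z - frobInner Y Z := by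
  simp [frobInner, Matrix.sub_mul]

lemma frobInner_sub_right (X Y Z : Matrix ι κ ℝ) :
    frobInner X (Y - Z) = frobInner X Y - frobInner X Z := by
  simp [frobInner, Matrix.mul_sub]

lemma frobInner_smul_right (c : ℝ) (X Y : Matrix ι κ ℝ) :
    frobInner X (c • Y) = c * frobInner X Y := by
  simp [frobInner]

lemma frobInner_comm (X Y : Matrix ι κ ℝ) : frobInner X Y = frobInner Y X := by
  simp only [frobInner_eq_sum, mul_comm]

lemma frobInner_mul_left (M : Matrix ι κ ℝ) (X : Matrix κ l ℝ) (Y : Matrix ι l ℝ) :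
    frobInner (M * X) Y = frobInner X (Mᵀ * Y) := by
  simp [frobInner, Matrix.mul_assoc]

lemma frobInner_mul_right (M : Matrix κ l ℝ) (X : Matrix ι κ ℝ) (Y : Matrix ι l ℝ) :
    frobInner (X * M) Y = frobInner X (Y * Mᵀ) := by
  rw [frobInner, frobInner, transpose_mul, Matrix.mul_assoc, trace_mul_comm, Matrix.mul_assoc]

lemma frobNorm_nonneg (X : Matrix ι κ ℝ) : 0 ≤ frobNorm X := Real.sqrt_nonneg _

lemma frobNorm_sq (X : Matrix ι κ ℝ) : frobNorm X ^ 2 = ∑ i, ∑ j, X i j ^ 2 :=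
  Real.sq_sqrt (by positivity)

lemma frobNorm_sq_eq_frobInner (X : Matrix ι κ ℝ) : frobNorm X ^ 2 = frobInner X X := by
  rw [frobNorm_sq, frobInner_eq_sum]; simp only [sq]

open scoped Matrix.Norms.Frobenius in
lemma frobNorm_eq_norm (X : Matrix ι κ ℝ) : frobNorm X = ‖X‖ := by
  rw [frobenius_norm_def, ← Real.sqrt_eq_rpow, frobNorm]
  simp

lemma frobNorm_add_le (X Y : Matrix ι κ ℝ) : frobNorm (X + Y) ≤ frobNorm X + frobNorm Y := by
  open scoped Matrix.Norms.Frobenius in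
  simpa only [frobNorm_eq_norm] using norm_add_le X Y

lemma frobNorm_neg (X : Matrix ι κ ℝ) : frobNorm (-X) = frobNorm X := by
  simp [frobNorm]

lemma frobNorm_sub_comm (X Y : Matrix ι κ ℝ) : frobNorm (X - Y) = frobNorm (Y - X) := by
  rw [← frobNorm_neg, neg_sub]

lemma frobNorm_sub_le (X Y : Matrix ι κ ℝ) : frobNorm (X - Y) ≤ frobNorm X + frobNorm Y := by
  rw [sub_eq_add_neg, ← frobNorm_neg Y]; exact frobNorm_add_le _ _

lemma frobNorm_sub_le_add (X Y Z : Matrix ι κ ℝ) :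
    frobNorm (X - Z) ≤ frobNorm (X - Y) + frobNorm (Y - Z) := by
  simpa using frobNorm_add_le (X - Y) (Y - Z)

lemma frobNorm_smul (c : ℝ) (X : Matrix ι κ ℝ) : frobNorm (c • X) = |c| * frobNorm X := by
  open scoped Matrix.Norms.Frobenius in
  simpa only [frobNorm_eq_norm, Real.norm_eq_abs] using norm_smul c X

@[simp] lemma frobNorm_zero : frobNorm (0 : Matrix ι κ ℝ) = 0 := by simp [frobNorm]

lemma frobNorm_transpose (X : Matrix ι κ ℝ) : frobNorm Xᵀ = frobNorm X := by
  simp only [frobNorm, transpose_apply]; rw [Finset.sum_comm]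

lemma frobNorm_eq_zero {X : Matrix ι κ ℝ} (h : frobNorm X = 0) : X = 0 := by
  open scoped Matrix.Norms.Frobenius in
  rw [frobNorm_eq_norm] at h
  simpa using h

lemma abs_apply_le_frobNorm (X : Matrix ι κ ℝ) (i : ι) (j : κ) : |X i j| ≤ frobNorm X := by
  refine Real.abs_le_sqrt ?_
  refine (Finset.single_le_sum (f := fun j => X i j ^ 2) (fun _ _ => sq_nonneg _)
    (Finset.mem_univ j)).trans ?_
  exact Finset.single_le_sum (f := fun i => ∑ j, X i j ^ 2)
    (fun _ _ => Finset.sum_nonneg fun _ _ => sq_nonneg _) (Finset.mem_univ i)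

lemma frobNorm_sum_le {α : Type*} (s : Finset α) (f : α → Matrix ι κ ℝ) :
    frobNorm (∑ i ∈ s, f i) ≤ ∑ i ∈ s, frobNorm (f i) := by
  open scoped Matrix.Norms.Frobenius in
  simpa only [frobNorm_eq_norm] using norm_sum_le s f

lemma frobInner_le (X Y : Matrix ι κ ℝ) : frobInner X Y ≤ frobNorm X * frobNorm Y := by
  rw [frobInner_eq_sum, frobNorm, frobNorm]
  simp only [← Fintype.sum_prod_type' (f := fun i j => X i j * Y i j),
    ← Fintype.sum_prod_type' (f := fun i j => X i j ^ 2),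
    ← Fintype.sum_prod_type' (f := fun i j => Y i j ^ 2)]
  exact Real.sum_mul_le_sqrt_mul_sqrt _ _ _

lemma frobNorm_mul_le_frobNorm (X : Matrix ι κ ℝ) (Y : Matrix κ l ℝ) :
    frobNorm (X * Y) ≤ frobNorm X * frobNorm Y := by
  open scoped Matrix.Norms.Frobenius in
  simpa only [frobNorm_eq_norm] using frobenius_norm_mul X Y

lemma frobNorm_sub_sq (X Y : Matrix ι κ ℝ) :
    frobNorm (X - Y) ^ 2 = frobNorm X ^ 2 - 2 * frobInner X Y + frobNorm Y ^ 2 := by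
  simp only [frobNorm_sq_eq_frobInner, frobInner_sub_left, frobInner_sub_right,
    frobInner_comm Y X]; ring

lemma frobNorm_isometry_mul [DecidableEq κ] {Q : Matrix ι κ ℝ} (hQ : Qᵀ * Q = 1)
    (X : Matrix κ l ℝ) : frobNorm (Q * X) = frobNorm X := by
  rw [← sq_eq_sq₀ (frobNorm_nonneg _) (frobNorm_nonneg _), frobNorm_sq_eq_frobInner,
    frobNorm_sq_eq_frobInner, frobInner_mul_left, ← Matrix.mul_assoc, hQ, Matrix.one_mul]

lemma frobNorm_mul_isometry [DecidableEq κ] {Q : Matrix κ l ℝ} (hQ : Q * Qᵀ = 1)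
    (X : Matrix ι κ ℝ) : frobNorm (X * Q) = frobNorm X := by
  rw [← frobNorm_transpose, transpose_mul, frobNorm_isometry_mul (by simpa using hQ),
    frobNorm_transpose]

lemma frobNorm_sq_of_isometry [DecidableEq κ] {Q : Matrix ι κ ℝ} (hQ : Qᵀ * Q = 1) :
    frobNorm Q ^ 2 = Fintype.card κ := by
  rw [frobNorm_sq_eq_frobInner, frobInner, hQ, trace_one]

lemma dotProduct_self_eq_norm (v : ι → ℝ) : v ⬝ᵥ v = ‖WithLp.toLp 2 v‖ ^ 2 := by
  rw [EuclideanSpace.real_norm_sq_eq]; simp [dotProduct, sq]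

lemma dotProduct_self_nonneg' (v : ι → ℝ) : 0 ≤ v ⬝ᵥ v := by
  rw [dotProduct_self_eq_norm]; positivity

lemma frobNorm_sq_eq_sum_col (X : Matrix ι κ ℝ) :
    frobNorm X ^ 2 = ∑ j, (fun i => X i j) ⬝ᵥ (fun i => X i j) := by
  rw [frobNorm_sq, Finset.sum_comm]; simp [dotProduct, sq]

lemma mulVec_sq_le_frobNorm (X : Matrix ι κ ℝ) (v : κ → ℝ) :
    (X *ᵥ v) ⬝ᵥ (X *ᵥ v) ≤ frobNorm X ^ 2 * (v ⬝ᵥ v) := by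
  have h := frobNorm_mul_le_frobNorm X (replicateCol Unit v)
  have h1 : frobNorm (replicateCol Unit v) ^ 2 = v ⬝ᵥ v := by
    rw [frobNorm_sq_eq_sum_col]; simp
  have h2 : frobNorm (X * replicateCol Unit v) ^ 2 = (X *ᵥ v) ⬝ᵥ (X *ᵥ v) := by
    rw [← replicateCol_mulVec, frobNorm_sq_eq_sum_col]; simp
  rw [← h1, ← h2, ← mul_pow]
  exact pow_le_pow_left₀ (frobNorm_nonneg _) h 2

open scoped Matrix.Norms.L2Operator in
lemma opNorm_eq_norm [DecidableEq κ] (X : Matrix ι κ ℝ) : opNorm X = ‖X‖ := by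
  rw [l2_opNorm_def]; rfl

lemma opNorm_nonneg [DecidableEq κ] (X : Matrix ι κ ℝ) : 0 ≤ opNorm X := norm_nonneg _

lemma opNorm_transpose [DecidableEq ι] [DecidableEq κ] (X : Matrix ι κ ℝ) :
    opNorm Xᵀ = opNorm X := by
  rw [opNorm_eq_norm, opNorm_eq_norm, ← l2_opNorm_conjTranspose X, conjTranspose_eq_transpose_of_trivial]

lemma mulVec_sq_le [DecidableEq κ] (X : Matrix ι κ ℝ) (v : κ → ℝ) :
    (X *ᵥ v) ⬝ᵥ (X *ᵥ v) ≤ opNorm X ^ 2 * (v ⬝ᵥ v) := by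
  have h := l2_opNorm_mulVec X (WithLp.toLp 2 v)
  rw [← opNorm_eq_norm] at h
  rw [dotProduct_self_eq_norm, dotProduct_self_eq_norm, ← mul_pow]
  exact pow_le_pow_left₀ (norm_nonneg _) h 2

lemma frobNorm_mul_le_of_mulVec {w : ℝ} (hw : 0 ≤ w) {X : Matrix ι κ ℝ}
    (h : ∀ v : κ → ℝ, (X *ᵥ v) ⬝ᵥ (X *ᵥ v) ≤ w ^ 2 * (v ⬝ᵥ v)) (Y : Matrix κ l ℝ) :
    frobNorm (X * Y) ≤ w * frobNorm Y := by
  refine le_of_sq_le_sq ?_ (mul_nonneg hw (frobNorm_nonneg _))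
  rw [mul_pow, frobNorm_sq_eq_sum_col, frobNorm_sq_eq_sum_col, Finset.mul_sum]
  exact Finset.sum_le_sum fun j _ => h fun i => Y i j

lemma frobNorm_mul_le [DecidableEq κ] (X : Matrix ι κ ℝ) (Y : Matrix κ l ℝ) :
    frobNorm (X * Y) ≤ opNorm X * frobNorm Y :=
  frobNorm_mul_le_of_mulVec (opNorm_nonneg _) (mulVec_sq_le X) Y

lemma frobNorm_mul_le' [DecidableEq κ] [DecidableEq l] (X : Matrix ι κ ℝ) (Y : Matrix κ l ℝ) :
    frobNorm (X * Y) ≤ opNorm Y * frobNorm X := by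
  rw [← frobNorm_transpose, transpose_mul, ← opNorm_transpose, ← frobNorm_transpose X]
  exact frobNorm_mul_le _ _

lemma frobNorm_le_opNorm [DecidableEq κ] (X : Matrix ι κ ℝ) :
    frobNorm X ≤ Real.sqrt (Fintype.card κ) * opNorm X := by
  have h := frobNorm_mul_le X (1 : Matrix κ κ ℝ)
  have h1 : frobNorm (1 : Matrix κ κ ℝ) = Real.sqrt (Fintype.card κ) := by
    rw [← frobNorm_sq_of_isometry (Q := (1 : Matrix κ κ ℝ)) (by simp),
      Real.sqrt_sq (frobNorm_nonneg _)]
  rwa [Matrix.mul_one, h1, mul_comm] at h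

lemma mul_frobNorm_le_of_le_mulVec {w : ℝ} {X : Matrix ι κ ℝ}
    (h : ∀ v : κ → ℝ, w ^ 2 * (v ⬝ᵥ v) ≤ (X *ᵥ v) ⬝ᵥ (X *ᵥ v)) (Y : Matrix κ l ℝ) :
    w * frobNorm Y ≤ frobNorm (X * Y) := by
  refine le_of_sq_le_sq ?_ (frobNorm_nonneg _)
  rw [mul_pow, frobNorm_sq_eq_sum_col, frobNorm_sq_eq_sum_col, Finset.mul_sum]
  exact Finset.sum_le_sum fun j _ => h fun i => Y i j

end Frobenius

/-! ### Stacked block matrices. -/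

section Stack

variable {n d k m : ℕ}

lemma stack_mul (B : Fin n → Matrix (Fin d) (Fin k) ℝ) (M : Matrix (Fin k) (Fin m) ℝ) :
    stack B * M = stack fun i => B i * M := by
  ext p b; simp [stack, mul_apply]

lemma stack_sub (B B' : Fin n → Matrix (Fin d) (Fin k) ℝ) :
    stack B - stack B' = stack fun i => B i - B' i := by
  ext p b; simp [stack]

lemma stack_add (B B' : Fin n → Matrix (Fin d) (Fin k) ℝ) :
    stack B + stack B' = stack fun i => B i + B' i := by
  ext p b; simp [stack]

lemma block_stack (B : Fin n → Matrix (Fin d) (Fin k) ℝ) (i : Fin n) : block (stack B) i = B i := by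
  ext a b; simp [stack, block]

lemma stack_block (X : Matrix (Fin n × Fin d) (Fin k) ℝ) : stack (block X) = X := by
  ext a b; simp [stack, block]

lemma stack_transpose_mul (B : Fin n → Matrix (Fin d) (Fin k) ℝ)
    (C : Fin n → Matrix (Fin d) (Fin m) ℝ) : (stack B)ᵀ * stack C = ∑ i, (B i)ᵀ * C i := by
  ext a b
  simp [stack, mul_apply, Matrix.sum_apply, Fintype.sum_prod_type]

lemma frobNorm_stack_sq (B : Fin n → Matrix (Fin d) (Fin k) ℝ) :
    frobNorm (stack B) ^ 2 = ∑ i, frobNorm (B i) ^ 2 := by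
  simp [frobNorm_sq, stack, Fintype.sum_prod_type]

lemma frobNorm_le_stack (B : Fin n → Matrix (Fin d) (Fin k) ℝ) (i : Fin n) :
    frobNorm (B i) ≤ frobNorm (stack B) := by
  refine le_of_sq_le_sq ?_ (frobNorm_nonneg _)
  rw [frobNorm_stack_sq]
  exact Finset.single_le_sum (f := fun i => frobNorm (B i) ^ 2) (fun _ _ => sq_nonneg _)
    (Finset.mem_univ i)

lemma frobNorm_stack_le {c : ℝ} (hc : 0 ≤ c) {B : Fin n → Matrix (Fin d) (Fin k) ℝ}
    {l : ℕ} {C : Fin n → Matrix (Fin d) (Fin l) ℝ}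
    (h : ∀ i, frobNorm (B i) ≤ c * frobNorm (C i)) :
    frobNorm (stack B) ≤ c * frobNorm (stack C) := by
  refine le_of_sq_le_sq ?_ (mul_nonneg hc (frobNorm_nonneg _))
  rw [mul_pow, frobNorm_stack_sq, frobNorm_stack_sq, Finset.mul_sum]
  refine Finset.sum_le_sum fun i _ => ?_
  rw [← mul_pow]
  exact pow_le_pow_left₀ (frobNorm_nonneg _) (h i) 2

lemma frobNorm_stack_le_const {c : ℝ} (hc : 0 ≤ c) {B : Fin n → Matrix (Fin d) (Fin k) ℝ}
    (h : ∀ i, frobNorm (B i) ≤ c) : frobNorm (stack B) ≤ Real.sqrt n * c := by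
  refine le_of_sq_le_sq ?_ (by positivity)
  rw [mul_pow, frobNorm_stack_sq, Real.sq_sqrt (by positivity)]
  calc ∑ i, frobNorm (B i) ^ 2 ≤ ∑ _i : Fin n, c ^ 2 :=
        Finset.sum_le_sum fun i _ => pow_le_pow_left₀ (frobNorm_nonneg _) (h i) 2
    _ = n * c ^ 2 := by simp

lemma sum_frobNorm_le (B : Fin n → Matrix (Fin d) (Fin k) ℝ) :
    ∑ i, frobNorm (B i) ≤ Real.sqrt n * frobNorm (stack B) := by
  refine le_of_sq_le_sq ?_ (mul_nonneg (Real.sqrt_nonneg _) (frobNorm_nonneg _))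
  rw [mul_pow, frobNorm_stack_sq, Real.sq_sqrt (by positivity)]
  simpa using sq_sum_le_card_mul_sum_sq (s := Finset.univ) (f := fun i => frobNorm (B i))

lemma frobNorm_stack_const (M : Matrix (Fin d) (Fin k) ℝ) :
    frobNorm (stack fun _ : Fin n => M) = Real.sqrt n * frobNorm M := by
  rw [← sq_eq_sq₀ (frobNorm_nonneg _) (mul_nonneg (Real.sqrt_nonneg _) (frobNorm_nonneg _)),
    frobNorm_stack_sq, mul_pow, Real.sq_sqrt (by positivity)]
  simp

end Stack

/-! ### Polar factors as maximizers over the orthogonal group. -/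

section Polar

variable {d : ℕ}

lemma orthogonal_transpose_mul {Q : Matrix (Fin d) (Fin d) ℝ}
    (hQ : Q ∈ orthogonalGroup (Fin d) ℝ) : Qᵀ * Q = 1 :=
  (mem_orthogonalGroup_iff' (Fin d) ℝ).1 hQ

lemma orthogonal_mul_transpose {Q : Matrix (Fin d) (Fin d) ℝ}
    (hQ : Q ∈ orthogonalGroup (Fin d) ℝ) : Q * Qᵀ = 1 :=
  (mem_orthogonalGroup_iff (Fin d) ℝ).1 hQ

lemma orthogonal_transpose {Q : Matrix (Fin d) (Fin d) ℝ}
    (hQ : Q ∈ orthogonalGroup (Fin d) ℝ) : Qᵀ ∈ orthogonalGroup (Fin d) ℝ :=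
  (mem_orthogonalGroup_iff (Fin d) ℝ).2 (by simpa using orthogonal_transpose_mul hQ)

lemma frobNorm_orthogonal_mul {Q : Matrix (Fin d) (Fin d) ℝ} (hQ : Q ∈ orthogonalGroup (Fin d) ℝ)
    {k : ℕ} (X : Matrix (Fin d) (Fin k) ℝ) : frobNorm (Q * X) = frobNorm X :=
  frobNorm_isometry_mul (orthogonal_transpose_mul hQ) X

lemma frobNorm_mul_orthogonal {Q : Matrix (Fin d) (Fin d) ℝ} (hQ : Q ∈ orthogonalGroup (Fin d) ℝ)
    {ι : Type*} [Fintype ι] (X : Matrix ι (Fin d) ℝ) : frobNorm (X * Q) = frobNorm X :=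
  frobNorm_mul_isometry (orthogonal_mul_transpose hQ) X

lemma frobNorm_orthogonal_sq {Q : Matrix (Fin d) (Fin d) ℝ}
    (hQ : Q ∈ orthogonalGroup (Fin d) ℝ) : frobNorm Q ^ 2 = d := by
  simpa using frobNorm_sq_of_isometry (orthogonal_transpose_mul hQ)

/-- The orthogonal matrix `R` maximizes `⟨·, X⟩` over the orthogonal group, with quadratic growth
of rate `τ / 2`. For `τ = 0` it is just a maximizer. -/
def IsSharpMax (τ : ℝ) (X R : Matrix (Fin d) (Fin d) ℝ) : Prop :=
  R ∈ orthogonalGroup (Fin d) ℝ ∧ ∀ R' ∈ orthogonalGroup (Fin d) ℝ,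
    τ / 2 * frobNorm (R - R') ^ 2 ≤ frobInner (R - R') X

/-- Adding the two optimality inequalities leaves `⟨R - R', X - Y⟩` on the larger side, and
Cauchy–Schwarz finishes. Only one of the maximizers needs quadratic growth, so `R'` may be any
choice of matrix sign of a possibly singular `Y`. -/
lemma IsSharpMax.frobNorm_sub_le {τ : ℝ} (hτ : 0 < τ) {X R Y R' : Matrix (Fin d) (Fin d) ℝ}
    (h : IsSharpMax τ X R) (h' : IsSharpMax 0 Y R') :
    frobNorm (R - R') ≤ 2 / τ * frobNorm (X - Y) := by
  have h1 := h.2 R' h'.1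
  have h2 := h'.2 R h.1
  have h3 : frobInner (R' - R) Y = - frobInner (R - R') Y := by
    simp only [frobInner_sub_left]; ring
  have h4 := frobInner_le (R - R') (X - Y)
  rw [frobInner_sub_right] at h4
  have h5 : τ / 2 * frobNorm (R - R') ^ 2 ≤ frobNorm (R - R') * frobNorm (X - Y) := by
    rw [h3] at h2; linarith
  have h6 : τ / 2 * frobNorm (R - R') ≤ frobNorm (X - Y) := by
    rcases (frobNorm_nonneg (R - R')).eq_or_lt with h0 | h0
    · rw [← h0]; simpa using frobNorm_nonneg _
    · refine le_of_mul_le_mul_left ?_ h0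
      linarith
  rw [div_mul_eq_mul_div, le_div_iff₀ hτ]
  linarith

lemma IsSharpMax.mono {τ τ' : ℝ} (h : τ' ≤ τ) {X R : Matrix (Fin d) (Fin d) ℝ}
    (hX : IsSharpMax τ X R) : IsSharpMax τ' X R :=
  ⟨hX.1, fun R' hR' => le_trans (by gcongr) (hX.2 R' hR')⟩

lemma IsSharpMax.smul {c : ℝ} (hc : 0 ≤ c) {X R : Matrix (Fin d) (Fin d) ℝ}
    (hX : IsSharpMax 0 X R) : IsSharpMax 0 (c • X) R :=
  ⟨hX.1, fun R' hR' => by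
    rw [frobInner_smul_right]
    simpa using mul_nonneg hc (by simpa using hX.2 R' hR')⟩

lemma IsSharpMax.orthogonal_mul {X R Q : Matrix (Fin d) (Fin d) ℝ}
    (hX : IsSharpMax 0 X R) (hQ : Q ∈ orthogonalGroup (Fin d) ℝ) :
    IsSharpMax 0 (Q * X) (Q * R) :=
  ⟨mul_mem hQ hX.1, fun R' hR' => by
    have h := hX.2 (Qᵀ * R') (mul_mem (orthogonal_transpose hQ) hR')
    have h2 : frobInner (Q * R - R') (Q * X) = frobInner (R - Qᵀ * R') X := by
      rw [← frobInner_comm, frobInner_mul_left, frobInner_comm, Matrix.mul_sub,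
        ← Matrix.mul_assoc, orthogonal_transpose_mul hQ, Matrix.one_mul]
    rw [h2]; simpa using h⟩

lemma IsSharpMax.mul_orthogonal {X R Q : Matrix (Fin d) (Fin d) ℝ}
    (hX : IsSharpMax 0 X R) (hQ : Q ∈ orthogonalGroup (Fin d) ℝ) :
    IsSharpMax 0 (X * Q) (R * Q) :=
  ⟨mul_mem hX.1 hQ, fun R' hR' => by
    have h := hX.2 (R' * Qᵀ) (mul_mem hR' (orthogonal_transpose hQ))
    have h2 : frobInner (R * Q - R') (X * Q) = frobInner (R - R' * Qᵀ) X := by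
      rw [← frobInner_comm, frobInner_mul_right, frobInner_comm, Matrix.sub_mul,
        Matrix.mul_assoc, orthogonal_mul_transpose hQ, Matrix.mul_one]
    rw [h2]; simpa using h⟩

lemma orthogonal_apply_le_one {Q : Matrix (Fin d) (Fin d) ℝ}
    (hQ : Q ∈ orthogonalGroup (Fin d) ℝ) (i j : Fin d) : Q i j ≤ 1 := by
  have h : ∑ k, Q i k * Q i k = 1 := by
    have := congrFun (congrFun (orthogonal_mul_transpose hQ) i) i
    simpa [mul_apply] using this
  have h2 : Q i j * Q i j ≤ 1 := by
    rw [← h]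
    exact Finset.single_le_sum (f := fun k => Q i k * Q i k) (fun _ _ => mul_self_nonneg _)
      (Finset.mem_univ j)
  nlinarith

/-- In the singular bases the objective is a nonnegative combination of diagonal entries of an
orthogonal matrix, each at most `1`, with equality at `R`. From here on only maximality is used,
which treats all choices of the SVD at once. -/
lemma IsMatrixSign.isSharpMax {X R : Matrix (Fin d) (Fin d) ℝ} (h : IsMatrixSign X R) :
    IsSharpMax 0 X R := by
  obtain ⟨U, hU, V, hV, s, hs, rfl, rfl⟩ := h
  have key : ∀ R' ∈ orthogonalGroup (Fin d) ℝ,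
      frobInner R' (U * diagonal s * Vᵀ) = ∑ k, (Vᵀ * R'ᵀ * U) k k * s k := by
    intro R' _
    have : frobInner R' (U * diagonal s * Vᵀ) = trace (Vᵀ * R'ᵀ * U * diagonal s) := by
      rw [frobInner, ← Matrix.mul_assoc, trace_mul_comm]
      simp only [Matrix.mul_assoc]
    rw [this]
    simp [trace, mul_diagonal]
  have hR : U * Vᵀ ∈ orthogonalGroup (Fin d) ℝ := mul_mem hU (orthogonal_transpose hV)
  refine ⟨hR, fun R' hR' => ?_⟩
  rw [frobInner_sub_left, key _ hR, key _ hR']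
  have h1 : Vᵀ * (U * Vᵀ)ᵀ * U = 1 := by
    rw [transpose_mul, transpose_transpose, ← Matrix.mul_assoc, orthogonal_transpose_mul hV,
      Matrix.one_mul, orthogonal_transpose_mul hU]
  rw [h1]
  simp only [zero_div, zero_mul, one_apply_eq, sub_nonneg]
  refine Finset.sum_le_sum fun k _ => mul_le_mul_of_nonneg_right ?_ (hs k)
  exact orthogonal_apply_le_one
    (mul_mem (mul_mem (orthogonal_transpose hV) (orthogonal_transpose hR')) hU) k k

/-- `X = R H` with `R` orthogonal and `H` symmetric, `τ ≤ H`. -/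
def IsPolar (τ : ℝ) (X R : Matrix (Fin d) (Fin d) ℝ) : Prop :=
  R ∈ orthogonalGroup (Fin d) ℝ ∧ (Rᵀ * X)ᵀ = Rᵀ * X ∧
    ∀ v : Fin d → ℝ, τ * (v ⬝ᵥ v) ≤ v ⬝ᵥ ((Rᵀ * X) *ᵥ v)

lemma mul_frobNorm_sq_le_trace {ι : Type*} [Fintype ι] {τ : ℝ} {H : Matrix (Fin d) (Fin d) ℝ}
    (hH : ∀ v : Fin d → ℝ, τ * (v ⬝ᵥ v) ≤ v ⬝ᵥ (H *ᵥ v)) (G : Matrix (Fin d) ι ℝ) :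
    τ * frobNorm G ^ 2 ≤ frobInner G (H * G) := by
  have : frobInner G (H * G) = ∑ j, (fun i => G i j) ⬝ᵥ (H *ᵥ fun i => G i j) := by
    rw [frobInner_eq_sum, Finset.sum_comm]; rfl
  rw [this, frobNorm_sq_eq_sum_col, Finset.mul_sum]
  exact Finset.sum_le_sum fun j _ => hH _

lemma IsPolar.isSharpMax {τ : ℝ} {X R : Matrix (Fin d) (Fin d) ℝ} (h : IsPolar τ X R) :
    IsSharpMax τ X R := by
  obtain ⟨hR, hsym, hpos⟩ := h
  refine ⟨hR, fun R' hR' => ?_⟩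
  set H := Rᵀ * X with hH
  have hX : X = R * H := by
    rw [hH, ← Matrix.mul_assoc, orthogonal_mul_transpose hR, Matrix.one_mul]
  set G := Rᵀ * R' with hG
  have hGo : G ∈ orthogonalGroup (Fin d) ℝ := mul_mem (orthogonal_transpose hR) hR'
  have hR'G : R' = R * G := by
    rw [hG, ← Matrix.mul_assoc, orthogonal_mul_transpose hR, Matrix.one_mul]
  have h1 : frobNorm (R - R') = frobNorm ((1 - G)ᵀ) := by
    rw [frobNorm_transpose, ← frobNorm_orthogonal_mul hR (1 - G), Matrix.mul_sub, Matrix.mul_one,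
      ← hR'G]
  have h2 : frobInner (R - R') X = frobInner (1 - G) H := by
    rw [hR'G, hX]
    nth_rw 1 [← Matrix.mul_one R]
    rw [← Matrix.mul_sub, frobInner_mul_left, ← Matrix.mul_assoc, orthogonal_transpose_mul hR,
      Matrix.one_mul]
  have h3 := mul_frobNorm_sq_le_trace hpos (1 - G)ᵀ
  -- Orthogonality of `G` and symmetry of `H` turn the linear gap `⟨1 - G, H⟩` into half a quadratic
  -- form in `1 - G`; this is the source of the growth rate `τ / 2`.
  have h4 : frobInner (1 - G)ᵀ (H * (1 - G)ᵀ) = 2 * frobInner (1 - G) H := by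
    have e1 : trace (G * (H * Gᵀ)) = trace H := by
      rw [trace_mul_comm, Matrix.mul_assoc, orthogonal_transpose_mul hGo, Matrix.mul_one]
    have e2 : trace (H * Gᵀ) = trace (Gᵀ * H) := trace_mul_comm _ _
    have e3 : trace (G * H) = trace (Gᵀ * H) := by
      rw [← trace_transpose, transpose_mul, hsym, e2]
    simp only [frobInner, transpose_transpose, transpose_sub, transpose_one, Matrix.sub_mul,
      Matrix.mul_sub, Matrix.one_mul, Matrix.mul_one, trace_sub]
    rw [e1, e2, e3]; ring
  rw [h1, h2]
  linarith

/-- The factor is `X (XᵀX)^(-1/2)`, built by diagonalizing `Xᵀ * X`; the hypothesis bounds the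
eigenvalues below by `τ ^ 2`. -/
lemma exists_isPolar {τ : ℝ} (hτ : 0 < τ) {X : Matrix (Fin d) (Fin d) ℝ}
    (hX : ∀ v : Fin d → ℝ, τ ^ 2 * (v ⬝ᵥ v) ≤ (X *ᵥ v) ⬝ᵥ (X *ᵥ v)) :
    ∃ R, IsPolar τ X R := by
  have hH : (Xᵀ * X).IsHermitian := by
    simp [IsHermitian, conjTranspose_eq_transpose_of_trivial]
  set V : Matrix (Fin d) (Fin d) ℝ := Subtype.val hH.eigenvectorUnitary with hV
  have hVo : V ∈ orthogonalGroup (Fin d) ℝ := hH.eigenvectorUnitary.2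
  set l := hH.eigenvalues with hl
  have hspec : Xᵀ * X = V * diagonal l * Vᵀ := by
    have h := hH.spectral_theorem
    rw [Unitary.conjStarAlgAut_apply] at h
    simpa [star_eq_conjTranspose, conjTranspose_eq_transpose_of_trivial, hV, hl,
      Function.comp_def] using h
  have hdiag : Vᵀ * (Xᵀ * X) * V = diagonal l := by
    rw [hspec, show Vᵀ * (V * diagonal l * Vᵀ) * V = (Vᵀ * V) * diagonal l * (Vᵀ * V) by
      simp only [Matrix.mul_assoc], orthogonal_transpose_mul hVo, Matrix.one_mul, Matrix.mul_one]
  have hlτ : ∀ k, τ ^ 2 ≤ l k := by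
    intro k
    have h := hX (V *ᵥ Pi.single k 1)
    have e1 : (V *ᵥ Pi.single k 1) ⬝ᵥ (V *ᵥ Pi.single k 1) = 1 := by
      rw [dotProduct_mulVec, vecMul_mulVec, orthogonal_transpose_mul hVo]
      simp
    have e2 : (X *ᵥ (V *ᵥ Pi.single k 1)) ⬝ᵥ (X *ᵥ (V *ᵥ Pi.single k 1)) = l k := by
      have : (X * V)ᵀ * (X * V) = diagonal l := by
        rw [transpose_mul, ← hdiag]; simp only [Matrix.mul_assoc]
      rw [mulVec_mulVec, dotProduct_mulVec, vecMul_mulVec, this]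
      simp
    rw [e1, e2] at h; linarith
  have hl0 : ∀ k, 0 < l k := fun k => lt_of_lt_of_le (by positivity) (hlτ k)
  set u : Fin d → ℝ := fun k => Real.sqrt (l k) with hu
  have hu0 : ∀ k, 0 < u k := fun k => Real.sqrt_pos.2 (hl0 k)
  have huτ : ∀ k, τ ≤ u k := fun k => Real.le_sqrt_of_sq_le (hlτ k)
  have huu : ∀ k, l k = u k * u k := fun k => (Real.mul_self_sqrt (hl0 k).le).symm
  set R := X * (V * diagonal (fun k => (u k)⁻¹) * Vᵀ) with hR
  have hRT : Rᵀ = V * diagonal (fun k => (u k)⁻¹) * Vᵀ * Xᵀ := by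
    rw [hR]; simp [transpose_mul, Matrix.mul_assoc]
  have hRX : Rᵀ * X = V * diagonal u * Vᵀ := by
    rw [hRT, Matrix.mul_assoc, hspec,
      show V * diagonal (fun k => (u k)⁻¹) * Vᵀ * (V * diagonal l * Vᵀ)
        = V * diagonal (fun k => (u k)⁻¹) * (Vᵀ * V) * diagonal l * Vᵀ by
        simp only [Matrix.mul_assoc], orthogonal_transpose_mul hVo, Matrix.mul_one,
      Matrix.mul_assoc V, diagonal_mul_diagonal]
    congr 3; ext k
    rw [huu k]; field_simp [(hu0 k).ne']
  refine ⟨R, ?_, ?_, ?_⟩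
  · refine (mem_orthogonalGroup_iff' (Fin d) ℝ).2 ?_
    change Rᵀ * R = 1
    nth_rw 2 [hR]
    rw [← Matrix.mul_assoc, hRX,
      show V * diagonal u * Vᵀ * (V * diagonal (fun k => (u k)⁻¹) * Vᵀ)
        = V * diagonal u * (Vᵀ * V) * diagonal (fun k => (u k)⁻¹) * Vᵀ by
        simp only [Matrix.mul_assoc], orthogonal_transpose_mul hVo, Matrix.mul_one,
      Matrix.mul_assoc V, diagonal_mul_diagonal]
    have : (fun k => u k * (u k)⁻¹) = 1 := by
      ext k; simp [(hu0 k).ne']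
    rw [this]; simp [orthogonal_mul_transpose hVo]
  · rw [hRX]; simp [Matrix.mul_assoc]
  · intro v
    rw [hRX]
    have e1 : v ⬝ᵥ ((V * diagonal u * Vᵀ) *ᵥ v) = ∑ k, u k * (Vᵀ *ᵥ v) k ^ 2 := by
      rw [← mulVec_mulVec, ← mulVec_mulVec, dotProduct_mulVec, ← mulVec_transpose]
      simp only [dotProduct, mulVec_diagonal]
      exact Finset.sum_congr rfl fun k _ => by ring
    have e2 : v ⬝ᵥ v = ∑ k, (Vᵀ *ᵥ v) k ^ 2 := by
      have : (Vᵀ *ᵥ v) ⬝ᵥ (Vᵀ *ᵥ v) = v ⬝ᵥ v := by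
        rw [dotProduct_mulVec, vecMul_mulVec, transpose_transpose, orthogonal_mul_transpose hVo]
        simp
      rw [← this]; simp [dotProduct, sq]
    rw [e1, e2, Finset.mul_sum]
    exact Finset.sum_le_sum fun k _ => mul_le_mul_of_nonneg_right (huτ k) (sq_nonneg _)

end Polar

/-- Expand in an eigenbasis of `A Aᵀ`. The eigenvalues decrease, and `d - 1` is the last index, so
its eigenvalue bounds all the others from below. -/
lemma sigmaMin_sq_mul_le {d m : ℕ} (hd : 1 ≤ d) (A : Matrix (Fin d) (Fin m) ℝ) (v : Fin d → ℝ) :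
    sigmaMin A ^ 2 * (v ⬝ᵥ v) ≤ (Aᵀ *ᵥ v) ⬝ᵥ (Aᵀ *ᵥ v) := by
  set T := Matrix.toEuclideanLin Aᵀ with hT
  have hn : Module.finrank ℝ (EuclideanSpace ℝ (Fin d)) = d := by simp
  have hsym := T.isPositive_adjoint_comp_self.isSymmetric
  set x : EuclideanSpace ℝ (Fin d) := WithLp.toLp 2 v with hx
  have h0 : sigmaMin A ^ 2 = hsym.eigenvalues hn ⟨d - 1, by omega⟩ :=
    LinearMap.sq_singularValues_fin T hn ⟨d - 1, by omega⟩
  have hle : ∀ k : Fin d, sigmaMin A ^ 2 ≤ hsym.eigenvalues hn k := by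
    intro k
    rw [h0]
    refine hsym.eigenvalues_antitone hn ?_
    rw [Fin.le_def]; dsimp only; omega
  have h1 : (Aᵀ *ᵥ v) ⬝ᵥ (Aᵀ *ᵥ v) = inner ℝ (T x) (T x) := by
    rw [dotProduct_self_eq_norm, real_inner_self_eq_norm_sq]; rfl
  have h2 : inner ℝ (T x) (T x) = inner ℝ x ((LinearMap.adjoint T ∘ₗ T) x) := by
    rw [LinearMap.comp_apply, LinearMap.adjoint_inner_right]
  set b := hsym.eigenvectorBasis hn with hb
  have h3 : inner ℝ x ((LinearMap.adjoint T ∘ₗ T) x)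
      = ∑ k, hsym.eigenvalues hn k * (inner ℝ (b k) x) ^ 2 := by
    rw [← b.sum_inner_mul_inner]
    refine Finset.sum_congr rfl fun k _ => ?_
    rw [← hsym (b k) x, hsym.apply_eigenvectorBasis hn k, inner_smul_left,
      real_inner_comm x (b k)]
    simp [hb]; ring
  have h4 : v ⬝ᵥ v = ∑ k, (inner ℝ (b k) x) ^ 2 := by
    rw [dotProduct_self_eq_norm, ← b.sum_sq_norm_inner_right x]
    simp
  rw [h1, h2, h3, h4, Finset.mul_sum]
  exact Finset.sum_le_sum fun k _ => mul_le_mul_of_nonneg_right (hle k) (sq_nonneg _)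

/-! ### A globally Lipschitz truncation of the polar factor. -/

section Retraction

variable {d : ℕ}

lemma coercive_of_frobNorm_sub_le {c r : ℝ} (hr : 0 < r) {G X : Matrix (Fin d) (Fin d) ℝ}
    (hG : ∀ v : Fin d → ℝ, c * (v ⬝ᵥ v) ≤ v ⬝ᵥ (G *ᵥ v)) (hX : frobNorm (X - G) ≤ r)
    (v : Fin d → ℝ) : (c - r) * (v ⬝ᵥ v) ≤ v ⬝ᵥ (X *ᵥ v) := by
  set E := X - G with hE
  have h1 := mulVec_sq_le_frobNorm E v
  have h2 : frobNorm E ^ 2 * (v ⬝ᵥ v) ≤ r ^ 2 * (v ⬝ᵥ v) :=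
    mul_le_mul_of_nonneg_right (pow_le_pow_left₀ (frobNorm_nonneg _) hX 2)
      (dotProduct_self_nonneg' v)
  -- Expanding `‖E v + r v‖² ≥ 0` together with `‖E v‖ ≤ r ‖v‖` gives `⟨v, E v⟩ ≥ -r ‖v‖²`.
  have h3 := dotProduct_self_nonneg' (E *ᵥ v + r • v)
  have h4 : (E *ᵥ v + r • v) ⬝ᵥ (E *ᵥ v + r • v)
      = (E *ᵥ v) ⬝ᵥ (E *ᵥ v) + 2 * r * (v ⬝ᵥ (E *ᵥ v)) + r ^ 2 * (v ⬝ᵥ v) := by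
    simp only [add_dotProduct, dotProduct_add, smul_dotProduct, dotProduct_smul, smul_eq_mul,
      dotProduct_comm (E *ᵥ v) v]
    ring
  have h5 : X *ᵥ v = G *ᵥ v + E *ᵥ v := by rw [← add_mulVec, hE]; simp
  have h6 : - r * (v ⬝ᵥ v) ≤ v ⬝ᵥ (E *ᵥ v) := by
    rw [h4] at h3
    have : 0 ≤ 2 * r * (v ⬝ᵥ (E *ᵥ v) + r * (v ⬝ᵥ v)) := by nlinarith
    have := nonneg_of_mul_nonneg_right this (by positivity)
    linarith
  rw [h5, dotProduct_add]
  have := hG v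
  linarith

lemma mulVec_sq_ge_of_coercive {τ : ℝ} (hτ : 0 ≤ τ) {X : Matrix (Fin d) (Fin d) ℝ}
    (hX : ∀ v : Fin d → ℝ, τ * (v ⬝ᵥ v) ≤ v ⬝ᵥ (X *ᵥ v)) (v : Fin d → ℝ) :
    τ ^ 2 * (v ⬝ᵥ v) ≤ (X *ᵥ v) ⬝ᵥ (X *ᵥ v) := by
  have h3 := dotProduct_self_nonneg' (X *ᵥ v - τ • v)
  have h4 : (X *ᵥ v - τ • v) ⬝ᵥ (X *ᵥ v - τ • v)
      = (X *ᵥ v) ⬝ᵥ (X *ᵥ v) - 2 * (τ * (v ⬝ᵥ (X *ᵥ v))) + τ ^ 2 * (v ⬝ᵥ v) := by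
    simp only [sub_dotProduct, dotProduct_sub, smul_dotProduct, dotProduct_smul, smul_eq_mul,
      dotProduct_comm (X *ᵥ v) v]
    ring
  have h5 := mul_le_mul_of_nonneg_left (hX v) hτ
  rw [h4] at h3
  nlinarith

lemma isPolar_one {τ : ℝ} {X : Matrix (Fin d) (Fin d) ℝ} (hs : Xᵀ = X)
    (hX : ∀ v : Fin d → ℝ, τ * (v ⬝ᵥ v) ≤ v ⬝ᵥ (X *ᵥ v)) : IsPolar τ X 1 :=
  ⟨one_mem _, by simpa using hs, by simpa using hX⟩

/-- The radial retraction onto the closed Frobenius ball with centre `G` and radius `r > 0`. -/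
def retract (G : Matrix (Fin d) (Fin d) ℝ) (r : ℝ) (X : Matrix (Fin d) (Fin d) ℝ) :
    Matrix (Fin d) (Fin d) ℝ :=
  G + (r / max r (frobNorm (X - G))) • (X - G)

lemma frobNorm_retract_sub_le {r : ℝ} (hr : 0 < r) (G X : Matrix (Fin d) (Fin d) ℝ) :
    frobNorm (retract G r X - G) ≤ r := by
  have hm : 0 < max r (frobNorm (X - G)) := lt_max_of_lt_left hr
  rw [retract, add_sub_cancel_left, frobNorm_smul, abs_of_nonneg (by positivity),
    div_mul_eq_mul_div, div_le_iff₀ hm]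
  exact mul_le_mul_of_nonneg_left (le_max_right _ _) hr.le

lemma retract_of_le {r : ℝ} (hr : 0 < r) {G X : Matrix (Fin d) (Fin d) ℝ}
    (h : frobNorm (X - G) ≤ r) : retract G r X = X := by
  rw [retract, max_eq_left h, div_self hr.ne', one_smul, add_sub_cancel]

lemma frobNorm_retract_sub_retract_le {r : ℝ} (hr : 0 < r) (G X Y : Matrix (Fin d) (Fin d) ℝ) :
    frobNorm (retract G r X - retract G r Y) ≤ 2 * frobNorm (X - Y) := by
  wlog h : frobNorm (Y - G) ≤ frobNorm (X - G) generalizing X Y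
  · rw [frobNorm_sub_comm, frobNorm_sub_comm X]
    exact this Y X (le_of_not_ge h)
  set x := X - G with hx
  set y := Y - G with hy
  have hxy : X - Y = x - y := by rw [hx, hy]; abel
  set a := max r (frobNorm x) with ha
  set b := max r (frobNorm y) with hb
  have ha0 : 0 < a := lt_max_of_lt_left hr
  have hb0 : 0 < b := lt_max_of_lt_left hr
  have hab : b ≤ a := max_le_max le_rfl h
  have hra : r ≤ a := le_max_left _ _
  have hyb : frobNorm y ≤ b := le_max_right _ _
  have hdiff : a - b ≤ frobNorm (x - y) := by
    have h1 : frobNorm x ≤ frobNorm (x - y) + frobNorm y := by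
      simpa using frobNorm_add_le (x - y) y
    have h2 : a ≤ frobNorm (x - y) + b := by
      refine max_le ?_ (by linarith)
      have := le_max_left r (frobNorm y)
      have := frobNorm_nonneg (x - y)
      linarith
    linarith
  -- Split with the smaller of the two vectors in the second term. The first coefficient is at most
  -- `1`, and the second is controlled by `a - b ≤ ‖x - y‖`; each term costs one factor of the
  -- Lipschitz constant `2`.
  have e : retract G r X - retract G r Y = (r / a) • (x - y) + (r / a - r / b) • y := by
    simp only [retract, ← hx, ← hy, ← ha, ← hb, smul_sub, sub_smul]; abel
  rw [e, hxy]
  refine (frobNorm_add_le _ _).trans ?_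
  rw [frobNorm_smul, frobNorm_smul, abs_of_nonneg (by positivity : 0 ≤ r / a)]
  have h1 : r / a * frobNorm (x - y) ≤ 1 * frobNorm (x - y) :=
    mul_le_mul_of_nonneg_right ((div_le_one ha0).2 hra) (frobNorm_nonneg _)
  have h2 : |r / a - r / b| * frobNorm y ≤ frobNorm (x - y) := by
    have : |r / a - r / b| = r * (a - b) / (a * b) := by
      rw [abs_sub_comm, abs_of_nonneg (by
        rw [sub_nonneg]; exact div_le_div_of_nonneg_left hr.le hb0 hab)]
      field_simp
    rw [this, div_mul_eq_mul_div, div_le_iff₀ (by positivity)]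
    have h3 : r * (a - b) * frobNorm y ≤ a * (a - b) * b := by
      have : 0 ≤ a - b := by linarith
      have := frobNorm_nonneg y
      gcongr
    have h4 : a * (a - b) * b ≤ a * frobNorm (x - y) * b := by gcongr
    linarith
  linarith

/-- A globally Lipschitz replacement of the polar factor which agrees with it near the
positive definite matrix `G`. -/
lemma exists_truncated_polar {c ε : ℝ} (hc : 0 < c) (hε : 0 < ε) (hε1 : ε ≤ 1)
    {G : Matrix (Fin d) (Fin d) ℝ} (hGs : Gᵀ = G)
    (hG : ∀ v : Fin d → ℝ, c * (v ⬝ᵥ v) ≤ v ⬝ᵥ (G *ᵥ v)) :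
    ∃ f : Matrix (Fin d) (Fin d) ℝ → Matrix (Fin d) (Fin d) ℝ,
      (∀ X, f X ∈ orthogonalGroup (Fin d) ℝ) ∧ (∀ X, frobNorm (f X - 1) ≤ ε) ∧
      (∀ X Y, frobNorm (f X - f Y) ≤ 8 / c * frobNorm (X - Y)) ∧
      (∀ X, frobNorm (X - G) ≤ ε * c / 2 →
        IsPolar (c / 2) X (f X) ∧ frobNorm (f X - 1) ≤ 2 / c * frobNorm (X - G)) := by
  -- The polar factor is composed with the retraction onto the ball of this radius. There `X`
  -- remains coercive with constant `c / 2`, and the factor is within `2 / c` times the radius, that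
  -- is `ε`, of the identity.
  have hr : 0 < ε * c / 2 := by positivity
  have hbd : ε * c / 2 ≤ c / 2 := by nlinarith
  have hpol : ∀ X, frobNorm (X - G) ≤ ε * c / 2 → ∃ R, IsPolar (c / 2) X R := by
    intro X hX
    refine exists_isPolar (by positivity) (mulVec_sq_ge_of_coercive (by positivity) fun v => ?_)
    have := coercive_of_frobNorm_sub_le (by positivity : 0 < c / 2) hG (hX.trans hbd) v
    linarith
  choose! g hg using hpol
  have hball := frobNorm_retract_sub_le hr G
  have hP := fun X => hg _ (hball X)
  have hone : ∀ X R, IsPolar (c / 2) X R → frobNorm (R - 1) ≤ 2 / c * frobNorm (X - G) := by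
    intro X R h
    have h1 := (isPolar_one hGs hG).isSharpMax.frobNorm_sub_le hc
      (h.isSharpMax.mono (τ' := 0) (by positivity))
    rwa [frobNorm_sub_comm, frobNorm_sub_comm X]
  refine ⟨fun X => g (retract G (ε * c / 2) X), fun X => (hP X).1, fun X => ?_, fun X Y => ?_,
    fun X hX => ?_⟩
  · refine (hone _ _ (hP X)).trans ?_
    calc 2 / c * frobNorm (retract G (ε * c / 2) X - G) ≤ 2 / c * (ε * c / 2) := by
          have := hball X; gcongr
      _ = ε := by field_simp
  -- The constant `8 / c` is `2 / (c / 2)` from the polar factor times `2` from the retraction.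
  · have h1 := (hP X).isSharpMax.frobNorm_sub_le (by positivity)
      ((hP Y).isSharpMax.mono (τ' := 0) (by positivity))
    refine h1.trans ?_
    have h2 := frobNorm_retract_sub_retract_le hr G X Y
    calc 2 / (c / 2) * frobNorm (retract G (ε * c / 2) X - retract G (ε * c / 2) Y)
        ≤ 2 / (c / 2) * (2 * frobNorm (X - Y)) := by gcongr
      _ = 8 / c * frobNorm (X - Y) := by field_simp; ring
  · have h : IsPolar (c / 2) X (g X) := hg X hX
    dsimp only
    rw [retract_of_le hr hX]
    exact ⟨h, hone _ _ h⟩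

end Retraction

/-! ### Symmetric parts of orthogonal matrices near the identity. -/

section SymPart

variable {d : ℕ}

/-- The symmetric part of a square matrix. -/
def symPart (X : Matrix (Fin d) (Fin d) ℝ) : Matrix (Fin d) (Fin d) ℝ := (1 / 2 : ℝ) • (X + Xᵀ)

lemma symPart_sub (X Y : Matrix (Fin d) (Fin d) ℝ) :
    symPart (X - Y) = symPart X - symPart Y := by
  simp only [symPart, transpose_sub, ← smul_sub]; congr 1; abel

lemma symPart_sum {α : Type*} (s : Finset α) (X : α → Matrix (Fin d) (Fin d) ℝ) :
    symPart (∑ j ∈ s, X j) = ∑ j ∈ s, symPart (X j) := by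
  simp only [symPart, transpose_sum, ← Finset.sum_add_distrib, ← Finset.smul_sum]

/-- Orthogonality gives the exact identity `1 - symPart S = ½ (S - 1)ᵀ (S - 1)`, so the symmetric
part deviates from `1` only to second order. -/
lemma frobNorm_symPart_sub_one_le {S : Matrix (Fin d) (Fin d) ℝ}
    (hS : S ∈ orthogonalGroup (Fin d) ℝ) :
    frobNorm (symPart S - 1) ≤ 1 / 2 * frobNorm (S - 1) ^ 2 := by
  have h : symPart S - 1 = -((1 / 2 : ℝ) • ((S - 1)ᵀ * (S - 1))) := by
    have : (S - 1)ᵀ * (S - 1) = (2 : ℝ) • (1 : Matrix (Fin d) (Fin d) ℝ) - (S + Sᵀ) := by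
      rw [transpose_sub, transpose_one, Matrix.sub_mul, Matrix.mul_sub, Matrix.mul_sub,
        orthogonal_transpose_mul hS, two_smul]
      simp only [Matrix.mul_one, Matrix.one_mul]; abel
    rw [this, smul_sub, smul_smul, symPart]; norm_num
  rw [h, frobNorm_neg, frobNorm_smul, abs_of_nonneg (by norm_num : (0 : ℝ) ≤ 1 / 2)]
  have := frobNorm_mul_le_frobNorm (S - 1)ᵀ (S - 1)
  rw [frobNorm_transpose, ← sq] at this
  gcongr

/-- The matrix `(S - T)ᵀ (S + T) = SᵀT - TᵀS` is antisymmetric. Hence `symPart (S - T)` equals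
`-symPart ((S - T)ᵀ E)`, where `E` is the midpoint of `S` and `T` minus the identity. The gained
factor `ε` is what makes the symmetrized map contract. -/
lemma frobNorm_symPart_sub_le {ε : ℝ} {S T : Matrix (Fin d) (Fin d) ℝ}
    (hS : S ∈ orthogonalGroup (Fin d) ℝ) (hT : T ∈ orthogonalGroup (Fin d) ℝ)
    (hSε : frobNorm (S - 1) ≤ ε) (hTε : frobNorm (T - 1) ≤ ε) :
    frobNorm (symPart (S - T)) ≤ ε * frobNorm (S - T) := by
  set E := (1 / 2 : ℝ) • ((S - 1) + (T - 1)) with hE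
  have hEn : frobNorm E ≤ ε := by
    rw [hE, frobNorm_smul, abs_of_nonneg (by norm_num : (0 : ℝ) ≤ 1 / 2)]
    have := frobNorm_add_le (S - 1) (T - 1)
    linarith
  have h : symPart (S - T) = -symPart ((S - T)ᵀ * E) := by
    have h2 : (S - T)ᵀ * E + ((S - T)ᵀ * E)ᵀ = -((S - T) + (S - T)ᵀ) := by
      have e1 : (S - T)ᵀ * E = (1 / 2 : ℝ) • (Sᵀ * T - Tᵀ * S) - (S - T)ᵀ := by
        have e0 : E = (1 / 2 : ℝ) • (S + T) - 1 := by
          rw [hE, show S - 1 + (T - 1) = S + T - (2 : ℝ) • 1 by rw [two_smul]; abel,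
            smul_sub, smul_smul]; norm_num
        rw [e0, Matrix.mul_sub, Matrix.mul_one, Matrix.mul_smul, transpose_sub, Matrix.sub_mul,
          Matrix.mul_add, Matrix.mul_add, orthogonal_transpose_mul hS,
          orthogonal_transpose_mul hT]
        congr 2; abel
      rw [e1]
      simp only [transpose_sub, transpose_smul, transpose_mul, transpose_transpose]
      rw [show Tᵀ * S - Sᵀ * T = -(Sᵀ * T - Tᵀ * S) by abel, smul_neg]
      abel
    rw [symPart, symPart, h2, smul_neg, neg_neg]
  have h3 : ∀ X : Matrix (Fin d) (Fin d) ℝ, frobNorm (symPart X) ≤ frobNorm X := by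
    intro X
    rw [symPart, frobNorm_smul, abs_of_nonneg (by norm_num : (0 : ℝ) ≤ 1 / 2)]
    have := frobNorm_add_le X Xᵀ
    rw [frobNorm_transpose] at this
    linarith
  rw [h, frobNorm_neg]
  refine (h3 _).trans ((frobNorm_mul_le_frobNorm _ _).trans ?_)
  rw [frobNorm_transpose, mul_comm]
  exact mul_le_mul_of_nonneg_right hEn (frobNorm_nonneg _)

end SymPart

/-! ### The symmetrized power map and its contraction property. -/

section Map

variable {n d m : ℕ}

/-- The stacked noise matrix has Euclidean operator norm at most `w` on matrices with `d`
columns, from both sides. -/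
structure NoiseBound (Z : Fin n → Matrix (Fin d) (Fin m) ℝ) (w : ℝ) : Prop where
  mul_le : ∀ M : Matrix (Fin m) (Fin d) ℝ, frobNorm (stack Z * M) ≤ w * frobNorm M
  transpose_mul_le : ∀ S : Fin n → Matrix (Fin d) (Fin d) ℝ,
    frobNorm (∑ i, (Z i)ᵀ * S i) ≤ w * frobNorm (stack S)

lemma NoiseBound.update_zero {Z : Fin n → Matrix (Fin d) (Fin m) ℝ} {w : ℝ} (h : NoiseBound Z w)
    (hw : 0 ≤ w) (i : Fin n) : NoiseBound (Function.update Z i 0) w where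
  mul_le M := by
    refine le_trans ?_ (h.mul_le M)
    rw [stack_mul, stack_mul, ← one_mul (frobNorm (stack fun i => Z i * M))]
    refine frobNorm_stack_le zero_le_one fun j => ?_
    by_cases hj : j = i
    · subst hj; simpa using frobNorm_nonneg _
    · simp [Function.update_of_ne hj]
  transpose_mul_le S := by
    have h1 : ∑ j, (Function.update Z i 0 j)ᵀ * S j = ∑ j, (Z j)ᵀ * Function.update S i 0 j := by
      refine Finset.sum_congr rfl fun j _ => ?_
      by_cases hj : j = i
      · subst hj; simp
      · simp [Function.update_of_ne hj]
    rw [h1]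
    refine (h.transpose_mul_le _).trans (mul_le_mul_of_nonneg_left ?_ hw)
    rw [← one_mul (frobNorm (stack S))]
    refine frobNorm_stack_le zero_le_one fun j => ?_
    by_cases hj : j = i
    · subst hj; simpa using frobNorm_nonneg _
    · simp [Function.update_of_ne hj]

lemma NoiseBound.frobNorm_mul_le {Z : Fin n → Matrix (Fin d) (Fin m) ℝ} {w : ℝ}
    (h : NoiseBound Z w) (i : Fin n) (M : Matrix (Fin m) (Fin d) ℝ) :
    frobNorm (Z i * M) ≤ w * frobNorm M := by
  refine le_trans ?_ (h.mul_le M)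
  rw [stack_mul]
  exact frobNorm_le_stack (fun i => Z i * M) i

lemma frobNorm_stack_single (i : Fin n) (S : Matrix (Fin d) (Fin d) ℝ) :
    frobNorm (stack (Pi.single i S : Fin n → Matrix (Fin d) (Fin d) ℝ)) = frobNorm S := by
  rw [← sq_eq_sq₀ (frobNorm_nonneg _) (frobNorm_nonneg _), frobNorm_stack_sq,
    Finset.sum_eq_single i]
  · simp
  · intro j _ hj; simp [Pi.single_eq_of_ne hj]
  · simp

lemma NoiseBound.frobNorm_transpose_mul_le {Z : Fin n → Matrix (Fin d) (Fin m) ℝ} {w : ℝ}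
    (h : NoiseBound Z w) (i : Fin n) (S : Matrix (Fin d) (Fin d) ℝ) :
    frobNorm ((Z i)ᵀ * S) ≤ w * frobNorm S := by
  have h1 := h.transpose_mul_le (Pi.single i S)
  have h2 : ∑ j, (Z j)ᵀ * (Pi.single i S : Fin n → Matrix (Fin d) (Fin d) ℝ) j = (Z i)ᵀ * S := by
    rw [Finset.sum_eq_single i]
    · simp
    · intro j _ hj; simp [Pi.single_eq_of_ne hj]
    · simp
  rwa [h2, frobNorm_stack_single] at h1

/-- The symmetrized aggregate `Aᵀ sym(∑ S_j) + ∑ Z_jᵀ S_j`. -/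
def symAggregate (A : Matrix (Fin d) (Fin m) ℝ) (Z : Fin n → Matrix (Fin d) (Fin m) ℝ)
    (S : Fin n → Matrix (Fin d) (Fin d) ℝ) : Matrix (Fin m) (Fin d) ℝ :=
  Aᵀ * symPart (∑ j, S j) + ∑ j, (Z j)ᵀ * S j

/-- One step of the symmetrized power method, with the polar factor replaced by `f`. -/
def symStep (f : Matrix (Fin d) (Fin d) ℝ → Matrix (Fin d) (Fin d) ℝ)
    (A : Matrix (Fin d) (Fin m) ℝ) (Z : Fin n → Matrix (Fin d) (Fin m) ℝ)
    (S : Fin n → Matrix (Fin d) (Fin d) ℝ) : Fin n → Matrix (Fin d) (Fin d) ℝ :=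
  fun i => f ((A + Z i) * symAggregate A Z S)

/-- All blocks are orthogonal and `ε`-close to the identity. -/
def NearOne (ε : ℝ) (S : Fin n → Matrix (Fin d) (Fin d) ℝ) : Prop :=
  ∀ i, S i ∈ orthogonalGroup (Fin d) ℝ ∧ frobNorm (S i - 1) ≤ ε

lemma frobNorm_stack_obs_mul_le {A : Matrix (Fin d) (Fin m) ℝ}
    {Z : Fin n → Matrix (Fin d) (Fin m) ℝ} {a w : ℝ} (hA : opNorm A ≤ a) (hZ : NoiseBound Z w)
    (M : Matrix (Fin m) (Fin d) ℝ) :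
    frobNorm (stack fun i => (A + Z i) * M) ≤ (Real.sqrt n * a + w) * frobNorm M := by
  have h : (stack fun i => (A + Z i) * M) = (stack fun _ => A * M) + stack Z * M := by
    rw [stack_mul, stack_add]; simp only [Matrix.add_mul]
  rw [h]
  refine (frobNorm_add_le _ _).trans ?_
  rw [frobNorm_stack_const, add_mul, mul_assoc]
  have h1 := (frobNorm_mul_le A M).trans (mul_le_mul_of_nonneg_right hA (frobNorm_nonneg M))
  have := hZ.mul_le M
  gcongr

lemma frobNorm_symAggregate_sub_le {A : Matrix (Fin d) (Fin m) ℝ}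
    {Z : Fin n → Matrix (Fin d) (Fin m) ℝ} {a w ε : ℝ} (hA : opNorm A ≤ a)
    (hZ : NoiseBound Z w) {S T : Fin n → Matrix (Fin d) (Fin d) ℝ} (hε : 0 ≤ ε)
    (hS : NearOne ε S) (hT : NearOne ε T) :
    frobNorm (symAggregate A Z S - symAggregate A Z T) ≤
      (a * ε * Real.sqrt n + w) * frobNorm (stack S - stack T) := by
  have h : symAggregate A Z S - symAggregate A Z T
      = Aᵀ * (∑ j, symPart (S j - T j)) + ∑ j, (Z j)ᵀ * (S j - T j) := by
    simp only [symAggregate, symPart_sum, symPart_sub, Matrix.mul_sub, Finset.sum_sub_distrib]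
    abel
  have ha : 0 ≤ a := (opNorm_nonneg A).trans hA
  rw [h]
  refine (frobNorm_add_le _ _).trans ?_
  have h1 := hZ.transpose_mul_le fun j => S j - T j
  rw [← stack_sub] at h1
  have h2 : frobNorm (∑ j, symPart (S j - T j))
      ≤ ε * (Real.sqrt n * frobNorm (stack S - stack T)) := by
    refine (frobNorm_sum_le _ _).trans ?_
    refine (Finset.sum_le_sum fun j _ =>
      frobNorm_symPart_sub_le (hS j).1 (hT j).1 (hS j).2 (hT j).2).trans ?_
    rw [← Finset.mul_sum, stack_sub]
    exact mul_le_mul_of_nonneg_left (sum_frobNorm_le _) hε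
  have h3 := frobNorm_mul_le Aᵀ (∑ j, symPart (S j - T j))
  rw [opNorm_transpose] at h3
  have h4 : opNorm A * frobNorm (∑ j, symPart (S j - T j))
      ≤ a * (ε * (Real.sqrt n * frobNorm (stack S - stack T))) := by
    have := frobNorm_nonneg (∑ j, symPart (S j - T j))
    gcongr
  calc _ ≤ a * (ε * (Real.sqrt n * frobNorm (stack S - stack T)))
        + w * frobNorm (stack S - stack T) := by linarith
    _ = _ := by ring

/-- The factors are the Lipschitz constant `8 / (n s²)` of `f`, the norm `√n a + w` of the stacked
observations and the constant `a ε √n + w` of the aggregate. The choices of `ε` and of the bound on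
`w` make both terms of the last factor at most `s² √n / (64 a)`, so the product is at most `65 /
256`. -/
lemma frobNorm_symStep_sub_le {f : Matrix (Fin d) (Fin d) ℝ → Matrix (Fin d) (Fin d) ℝ}
    {A : Matrix (Fin d) (Fin m) ℝ} {Z : Fin n → Matrix (Fin d) (Fin m) ℝ} {a w ε s : ℝ}
    (hn : 1 ≤ n) (hs : 0 < s) (hsa : s ≤ a) (hA : opNorm A ≤ a) (hZ : NoiseBound Z w)
    (hw : 0 ≤ w) (hwn : w ≤ s ^ 2 / (64 * a) * Real.sqrt n) (hε : ε = s ^ 2 / (64 * a ^ 2))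
    (hf : ∀ X Y, frobNorm (f X - f Y) ≤ 8 / (n * s ^ 2) * frobNorm (X - Y))
    {S T : Fin n → Matrix (Fin d) (Fin d) ℝ} (hS : NearOne ε S) (hT : NearOne ε T) :
    frobNorm (stack (symStep f A Z S) - stack (symStep f A Z T)) ≤
      1 / 2 * frobNorm (stack S - stack T) := by
  have ha : 0 < a := hs.trans_le hsa
  have hε0 : 0 ≤ ε := by rw [hε]; positivity
  have hn0 : (0 : ℝ) < n := by exact_mod_cast hn
  have h1 := frobNorm_symAggregate_sub_le hA hZ hε0 hS hT
  have h2 := frobNorm_stack_obs_mul_le hA hZ (symAggregate A Z S - symAggregate A Z T)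
  have h3 : frobNorm (stack (symStep f A Z S) - stack (symStep f A Z T)) ≤
      8 / (n * s ^ 2) *
        frobNorm (stack fun i => (A + Z i) * (symAggregate A Z S - symAggregate A Z T)) := by
    rw [stack_sub]
    refine frobNorm_stack_le (by positivity) fun i => ?_
    rw [Matrix.mul_sub]
    exact hf _ _
  set D := frobNorm (stack S - stack T)
  have hD : 0 ≤ D := frobNorm_nonneg _
  set r := Real.sqrt n with hr
  have hr0 : 0 < r := Real.sqrt_pos.2 hn0
  have hrr : r * r = n := Real.mul_self_sqrt hn0.le
  have hw2 : w ≤ a * r / 64 := by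
    refine hwn.trans ?_
    rw [div_mul_eq_mul_div, div_le_div_iff₀ (by positivity) (by norm_num)]
    have : s ^ 2 ≤ a ^ 2 := pow_le_pow_left₀ hs.le hsa 2
    nlinarith [mul_le_mul_of_nonneg_right this hr0.le]
  have h4 : a * ε * r = s ^ 2 / (64 * a) * r := by rw [hε]; field_simp
  have h5 : (r * a + w) * ((a * ε * r + w) * D)
      ≤ (65 / 64 * (r * a)) * ((2 * (s ^ 2 / (64 * a) * r)) * D) := by
    have : r * a + w ≤ 65 / 64 * (r * a) := by linarith
    have : a * ε * r + w ≤ 2 * (s ^ 2 / (64 * a) * r) := by linarith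
    have : 0 ≤ a * ε * r + w := by positivity
    gcongr
  calc _ ≤ 8 / (n * s ^ 2) * ((r * a + w) * ((a * ε * r + w) * D)) := by
        refine h3.trans ?_
        gcongr
        exact h2.trans (by gcongr)
    _ ≤ 8 / (n * s ^ 2) * ((65 / 64 * (r * a)) * ((2 * (s ^ 2 / (64 * a) * r)) * D)) := by
        gcongr
    _ = 65 / 256 * D := by
        rw [← hrr]; field_simp; ring
    _ ≤ 1 / 2 * D := by nlinarith

lemma continuous_frobNorm_stack :
    Continuous fun S : Fin n → Matrix (Fin d) (Fin d) ℝ => frobNorm (stack S) := by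
  unfold frobNorm stack
  simp only [of_apply]
  fun_prop

/-- A map preserving the set of tuples close to the identity and contracting the Frobenius distance
there has a fixed point in this set. -/
lemma exists_fixedPoint_of_contraction {ε : ℝ} (hε : 0 ≤ ε)
    {F : (Fin n → Matrix (Fin d) (Fin d) ℝ) → Fin n → Matrix (Fin d) (Fin d) ℝ}
    (hF : ∀ S, NearOne ε (F S))
    (hc : ∀ S T, NearOne ε S → NearOne ε T →
      frobNorm (stack (F S) - stack (F T)) ≤ 1 / 2 * frobNorm (stack S - stack T)) :
    ∃ S, NearOne ε S ∧ F S = S := by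
  -- Picard iteration from the identity tuple. The increments decay geometrically in the Frobenius
  -- distance, and the limit keeps orthogonality and closeness because both are closed conditions.
  set u : ℕ → Fin n → Matrix (Fin d) (Fin d) ℝ := fun t => F^[t] 1 with hu
  have hus : ∀ t, u (t + 1) = F (u t) := fun t => Function.iterate_succ_apply' F t 1
  have hnear : ∀ t, NearOne ε (u t) := by
    intro t
    cases t with
    | zero => exact fun i => ⟨one_mem _, by simpa [hu] using hε⟩
    | succ t => rw [hus]; exact hF _
  set C := frobNorm (stack (u 1) - stack (u 0))
  have hstep : ∀ t, frobNorm (stack (u (t + 1)) - stack (u t)) ≤ C * (1 / 2) ^ t := by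
    intro t
    induction t with
    | zero => simp [C]
    | succ t ih =>
      have h := hc _ _ (hnear (t + 1)) (hnear t)
      rw [← hus, ← hus] at h
      rw [pow_succ]; linarith
  have hlim : ∀ i a b, ∃ l, Tendsto (fun t => u t i a b) atTop (𝓝 l) := by
    intro i a b
    refine cauchySeq_tendsto_of_complete (cauchySeq_of_le_geometric (1 / 2) C (by norm_num) ?_)
    intro t
    rw [Real.dist_eq, abs_sub_comm]
    refine le_trans ?_ (hstep t)
    exact abs_apply_le_frobNorm (stack (u (t + 1)) - stack (u t)) (i, a) b
  obtain ⟨L, hL⟩ : ∃ L : Fin n → Matrix (Fin d) (Fin d) ℝ,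
      ∀ i a b, Tendsto (fun t => u t i a b) atTop (𝓝 (L i a b)) := by
    choose L hL using hlim
    exact ⟨L, hL⟩
  have hten : Tendsto u atTop (𝓝 L) := by
    refine tendsto_pi_nhds.2 fun i => tendsto_pi_nhds.2 fun a => tendsto_pi_nhds.2 fun b => hL i a b
  have hL1 : NearOne ε L := by
    have hi : ∀ i, Tendsto (fun t => u t i) atTop (𝓝 (L i)) := fun i => tendsto_pi_nhds.1 hten i
    intro i
    constructor
    · refine (mem_orthogonalGroup_iff (Fin d) ℝ).2 ?_
      have hcont : Continuous fun X : Matrix (Fin d) (Fin d) ℝ => X * star X := by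
        change Continuous fun X : Matrix (Fin d) (Fin d) ℝ => X * Xᴴ
        fun_prop
      refine tendsto_nhds_unique (hcont.continuousAt.tendsto.comp (hi i)) ?_
      refine tendsto_const_nhds.congr fun t => ?_
      exact ((mem_orthogonalGroup_iff (Fin d) ℝ).1 (hnear t i).1).symm
    · have hcont : Continuous fun X : Matrix (Fin d) (Fin d) ℝ => frobNorm (X - 1) := by
        unfold frobNorm; fun_prop
      exact le_of_tendsto (hcont.continuousAt.tendsto.comp (hi i))
        (Eventually.of_forall fun t => (hnear t i).2)
  refine ⟨L, hL1, ?_⟩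
  have hd0 : Tendsto (fun t => frobNorm (stack (u t) - stack L)) atTop (𝓝 0) := by
    have h := (continuous_frobNorm_stack (n := n) (d := d)).tendsto 0
    have h2 : Tendsto (fun t => u t - L) atTop (𝓝 0) := by
      simpa using hten.sub_const L
    have h3 := h.comp h2
    have e : frobNorm (stack (0 : Fin n → Matrix (Fin d) (Fin d) ℝ)) = 0 := by
      simp [frobNorm, stack]
    rw [e] at h3
    refine h3.congr fun t => ?_
    rw [stack_sub]; rfl
  have hle : ∀ t, frobNorm (stack (F L) - stack L)
      ≤ 1 / 2 * frobNorm (stack (u t) - stack L) + frobNorm (stack (u (t + 1)) - stack L) := by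
    intro t
    have h1 := frobNorm_sub_le_add (stack (F L)) (stack (u (t + 1))) (stack L)
    have h2 := hc _ _ hL1 (hnear t)
    rw [← hus, frobNorm_sub_comm (stack L)] at h2
    linarith
  have h0 : frobNorm (stack (F L) - stack L) ≤ 0 := by
    refine ge_of_tendsto' (x := atTop) (f := fun t => 1 / 2 * frobNorm (stack (u t) - stack L)
      + frobNorm (stack (u (t + 1)) - stack L)) ?_ hle
    have h := (hd0.const_mul (1 / 2)).add (hd0.comp (tendsto_add_atTop_nat 1))
    rwa [mul_zero, add_zero] at h
  have h1 := frobNorm_eq_zero (le_antisymm h0 (frobNorm_nonneg _))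
  ext i a b
  have := congrFun (congrFun h1 (i, a)) b
  simpa [stack, sub_eq_zero] using this

end Map

/-! ### Leave-one-out analysis and the fixed point near the identity. -/

section FixedPoint

variable {n d m : ℕ}

lemma frobNorm_stack_orthogonal {S : Fin n → Matrix (Fin d) (Fin d) ℝ}
    (hS : ∀ i, S i ∈ orthogonalGroup (Fin d) ℝ) :
    frobNorm (stack S) = Real.sqrt n * Real.sqrt d := by
  rw [← sq_eq_sq₀ (frobNorm_nonneg _) (by positivity), frobNorm_stack_sq, mul_pow,
    Real.sq_sqrt (by positivity), Real.sq_sqrt (by positivity)]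
  simp [fun i => frobNorm_orthogonal_sq (hS i)]

lemma frobNorm_mul_symPart_le {k : ℕ} (X : Matrix (Fin k) (Fin d) ℝ)
    {S : Matrix (Fin d) (Fin d) ℝ} (hS : S ∈ orthogonalGroup (Fin d) ℝ) :
    frobNorm (X * symPart S) ≤ frobNorm X := by
  rw [symPart, Matrix.mul_smul, frobNorm_smul, abs_of_nonneg (by norm_num : (0 : ℝ) ≤ 1 / 2),
    Matrix.mul_add]
  have := frobNorm_add_le (X * S) (X * Sᵀ)
  rw [frobNorm_mul_orthogonal hS, frobNorm_mul_orthogonal (orthogonal_transpose hS)] at this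
  linarith

lemma frobNorm_mul_transpose_mul_le {A : Matrix (Fin d) (Fin m) ℝ} {a : ℝ} (hA : opNorm A ≤ a)
    (X : Matrix (Fin d) (Fin d) ℝ) : frobNorm (A * (Aᵀ * X)) ≤ a ^ 2 * frobNorm X := by
  have ha : 0 ≤ a := (opNorm_nonneg A).trans hA
  have h1 := frobNorm_mul_le A (Aᵀ * X)
  have h2 := frobNorm_mul_le Aᵀ X
  rw [opNorm_transpose] at h2
  have h3 := frobNorm_nonneg X
  have h4 := frobNorm_nonneg (Aᵀ * X)
  have h5 : opNorm A * frobNorm X ≤ a * frobNorm X := by gcongr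
  calc _ ≤ opNorm A * frobNorm (Aᵀ * X) := h1
    _ ≤ a * (a * frobNorm X) := by gcongr; linarith
    _ = _ := by ring

/-- Standing assumptions on the size of the signal and of the noise. -/
structure Regime (A : Matrix (Fin d) (Fin m) ℝ) (Z : Fin n → Matrix (Fin d) (Fin m) ℝ)
    (a s w q : ℝ) : Prop where
  one_le_n : 1 ≤ n
  one_le_d : 1 ≤ d
  s_pos : 0 < s
  s_le : s ≤ a
  op_le : opNorm A ≤ a
  le_op : ∀ v : Fin d → ℝ, s ^ 2 * (v ⬝ᵥ v) ≤ (Aᵀ *ᵥ v) ⬝ᵥ (Aᵀ *ᵥ v)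
  -- Here `w` bounds the operator norm of the whole noise, while `q` is its normalized size, at
  -- least `w √d / √n`; every error below is measured in `q`.
  noise : NoiseBound Z w
  w_nonneg : 0 ≤ w
  w_le : w * Real.sqrt d ≤ q * Real.sqrt n
  q_le : q ≤ s ^ 4 / (2000 * a ^ 3)

namespace Regime

variable {A : Matrix (Fin d) (Fin m) ℝ} {Z : Fin n → Matrix (Fin d) (Fin m) ℝ} {a s w q : ℝ}

lemma a_pos (h : Regime A Z a s w q) : 0 < a := h.s_pos.trans_le h.s_le

lemma n_pos (h : Regime A Z a s w q) : (0 : ℝ) < n := by exact_mod_cast h.one_le_n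

lemma sqrt_n_pos (h : Regime A Z a s w q) : 0 < Real.sqrt n := Real.sqrt_pos.2 h.n_pos

lemma one_le_sqrt_d (h : Regime A Z a s w q) : 1 ≤ Real.sqrt d :=
  Real.one_le_sqrt.2 (by exact_mod_cast h.one_le_d)

lemma w_le' (h : Regime A Z a s w q) : w ≤ q * Real.sqrt n :=
  le_trans (le_mul_of_one_le_right h.w_nonneg h.one_le_sqrt_d) h.w_le

lemma q_nonneg (h : Regime A Z a s w q) : 0 ≤ q :=
  nonneg_of_mul_nonneg_left (h.w_nonneg.trans h.w_le') h.sqrt_n_pos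

lemma q_le' (h : Regime A Z a s w q) : q ≤ s ^ 2 / (2000 * a) := by
  refine h.q_le.trans ?_
  have := h.a_pos
  rw [div_le_div_iff₀ (by positivity) (by positivity)]
  have h1 : s ^ 2 ≤ a ^ 2 := pow_le_pow_left₀ h.s_pos.le h.s_le 2
  calc s ^ 4 * (2000 * a) = s ^ 2 * s ^ 2 * (2000 * a) := by ring
    _ ≤ s ^ 2 * a ^ 2 * (2000 * a) := by gcongr
    _ = _ := by ring

lemma q_le_s (h : Regime A Z a s w q) : q ≤ s / 2000 := by
  refine h.q_le'.trans ?_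
  have := h.a_pos
  rw [div_le_div_iff₀ (by positivity) (by positivity)]
  nlinarith [mul_le_mul_of_nonneg_left h.s_le h.s_pos.le]

lemma w_le_contr (h : Regime A Z a s w q) : w ≤ s ^ 2 / (64 * a) * Real.sqrt n := by
  refine h.w_le'.trans (mul_le_mul_of_nonneg_right (h.q_le'.trans ?_) h.sqrt_n_pos.le)
  have := h.a_pos
  exact div_le_div_of_nonneg_left (by positivity) (by positivity) (by nlinarith)

lemma update_zero (h : Regime A Z a s w q) (i : Fin n) :
    Regime A (Function.update Z i 0) a s w q :=
  { h with noise := h.noise.update_zero h.w_nonneg i }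

/-- `f` agrees with the polar factor near `n A Aᵀ` and is globally Lipschitz. -/
structure IsTruncatedPolar (n : ℕ) (A : Matrix (Fin d) (Fin m) ℝ) (a s : ℝ)
    (f : Matrix (Fin d) (Fin d) ℝ → Matrix (Fin d) (Fin d) ℝ) : Prop where
  orth : ∀ X, f X ∈ orthogonalGroup (Fin d) ℝ
  near : ∀ X, frobNorm (f X - 1) ≤ s ^ 2 / (64 * a ^ 2)
  lipschitz : ∀ X Y, frobNorm (f X - f Y) ≤ 8 / (n * s ^ 2) * frobNorm (X - Y)
  polar : ∀ X, frobNorm (X - (n : ℝ) • (A * Aᵀ)) ≤ s ^ 2 / (64 * a ^ 2) * (n * s ^ 2) / 2 →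
    IsPolar (n * s ^ 2 / 2) X (f X) ∧
      frobNorm (f X - 1) ≤ 2 / (n * s ^ 2) * frobNorm (X - (n : ℝ) • (A * Aᵀ))

lemma coercive_gram (hAs : ∀ v : Fin d → ℝ, s ^ 2 * (v ⬝ᵥ v) ≤ (Aᵀ *ᵥ v) ⬝ᵥ (Aᵀ *ᵥ v))
    (n : ℕ) (v : Fin d → ℝ) : n * s ^ 2 * (v ⬝ᵥ v) ≤ v ⬝ᵥ (((n : ℝ) • (A * Aᵀ)) *ᵥ v) := by
  have h : v ⬝ᵥ ((A * Aᵀ) *ᵥ v) = (Aᵀ *ᵥ v) ⬝ᵥ (Aᵀ *ᵥ v) := by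
    rw [← mulVec_mulVec, dotProduct_mulVec, ← mulVec_transpose]
  rw [smul_mulVec, dotProduct_smul, h, smul_eq_mul, mul_assoc]
  exact mul_le_mul_of_nonneg_left (hAs v) (by positivity)

lemma exists_isTruncatedPolar (hn : 1 ≤ n) (hs : 0 < s) (hsa : s ≤ a)
    (hAs : ∀ v : Fin d → ℝ, s ^ 2 * (v ⬝ᵥ v) ≤ (Aᵀ *ᵥ v) ⬝ᵥ (Aᵀ *ᵥ v)) :
    ∃ f, IsTruncatedPolar n A a s f := by
  have hn0 : (0 : ℝ) < n := by exact_mod_cast hn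
  have ha : 0 < a := hs.trans_le hsa
  have h1 : s ^ 2 ≤ a ^ 2 := pow_le_pow_left₀ hs.le hsa 2
  obtain ⟨f, h1, h2, h3, h4⟩ := exists_truncated_polar (c := n * s ^ 2) (ε := s ^ 2 / (64 * a ^ 2))
    (G := (n : ℝ) • (A * Aᵀ)) (by positivity) (by positivity)
    (by rw [div_le_one (by positivity)]; nlinarith) (by simp) (coercive_gram hAs n)
  exact ⟨f, h1, h2, h3, h4⟩

variable {f : Matrix (Fin d) (Fin d) ℝ → Matrix (Fin d) (Fin d) ℝ}

lemma nearOne_symStep (hf : IsTruncatedPolar n A a s f) (S : Fin n → Matrix (Fin d) (Fin d) ℝ) :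
    NearOne (s ^ 2 / (64 * a ^ 2)) (symStep f A Z S) := fun _ => ⟨hf.orth _, hf.near _⟩

lemma contraction (h : Regime A Z a s w q) (hf : IsTruncatedPolar n A a s f)
    {S T : Fin n → Matrix (Fin d) (Fin d) ℝ} (hS : NearOne (s ^ 2 / (64 * a ^ 2)) S)
    (hT : NearOne (s ^ 2 / (64 * a ^ 2)) T) :
    frobNorm (stack (symStep f A Z S) - stack (symStep f A Z T)) ≤
      1 / 2 * frobNorm (stack S - stack T) :=
  frobNorm_symStep_sub_le h.one_le_n h.s_pos h.s_le h.op_le h.noise h.w_nonneg h.w_le_contr rfl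
    hf.lipschitz hS hT

lemma nearOne_one (ε : ℝ) (hε : 0 ≤ ε) : NearOne ε (1 : Fin n → Matrix (Fin d) (Fin d) ℝ) :=
  fun _ => ⟨one_mem _, by simpa using hε⟩

lemma nearOne_iterate (hf : IsTruncatedPolar n A a s f) (t : ℕ) :
    NearOne (s ^ 2 / (64 * a ^ 2)) ((symStep f A Z)^[t] 1) := by
  cases t with
  | zero => exact nearOne_one _ (by positivity)
  | succ t => rw [Function.iterate_succ_apply']; exact nearOne_symStep hf _

/-- The first step moves by at most `√n ε` and later steps are halved each time, so `n` iterations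
suffice because `√n ≤ 2 ^ n`. A finite iterate depends continuously on the noise, which gives the
measurability needed for independence. -/
lemma frobNorm_symStep_iterate_sub_le (h : Regime A Z a s w q) (hf : IsTruncatedPolar n A a s f) :
    frobNorm (stack (symStep f A Z ((symStep f A Z)^[n] 1)) - stack ((symStep f A Z)^[n] 1)) ≤
      s ^ 2 / (64 * a ^ 2) := by
  set ε := s ^ 2 / (64 * a ^ 2)
  have hε : 0 ≤ ε := by positivity
  have hstep : ∀ t : ℕ, frobNorm (stack (symStep f A Z ((symStep f A Z)^[t] 1))
      - stack ((symStep f A Z)^[t] 1)) ≤ Real.sqrt n * ε * (1 / 2) ^ t := by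
    intro t
    induction t with
    | zero =>
      simp only [Function.iterate_zero, id_eq, pow_zero, mul_one]
      rw [stack_sub]
      exact frobNorm_stack_le_const hε fun i => hf.near _
    | succ t ih =>
      have h1 := h.contraction hf (nearOne_symStep (Z := Z) hf ((symStep f A Z)^[t] 1))
        (nearOne_iterate (Z := Z) hf t)
      rw [Function.iterate_succ_apply', pow_succ]; linarith
  refine (hstep n).trans ?_
  have h1 : Real.sqrt n ≤ 2 ^ n := by
    have h2 : (n : ℝ) ≤ 2 ^ n := by exact_mod_cast (Nat.lt_two_pow_self (n := n)).le
    refine le_trans ?_ h2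
    rw [Real.sqrt_le_left (by positivity)]
    have : (1 : ℝ) ≤ n := by exact_mod_cast h.one_le_n
    nlinarith
  calc Real.sqrt n * ε * (1 / 2) ^ n ≤ 2 ^ n * ε * (1 / 2) ^ n := by gcongr
    _ = ε := by rw [mul_right_comm, ← mul_pow]; norm_num

/-- Write `F`, `F'` for the maps with and without `Z i`. Then `S - R` splits into `F S - F R`, at
most half of `S - R` by contraction, the perturbation `F R - F' R`, and the residual `F' R - R`.
Absorbing the half leaves `2 (3 ε + 16 / 2000)`, which is below `1`. -/
lemma frobNorm_sub_leaveOneOut_le (h : Regime A Z a s w q) (hf : IsTruncatedPolar n A a s f)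
    {S : Fin n → Matrix (Fin d) (Fin d) ℝ} (hS : NearOne (s ^ 2 / (64 * a ^ 2)) S)
    (hfix : symStep f A Z S = S) (i : Fin n) :
    frobNorm (stack S - stack ((symStep f A (Function.update Z i 0))^[n] 1)) ≤ 1 := by
  set Z' := Function.update Z i 0 with hZ'
  set R := (symStep f A Z')^[n] 1 with hR
  set ε := s ^ 2 / (64 * a ^ 2) with hε
  have ha := h.a_pos
  have hs := h.s_pos
  have hn := h.n_pos
  have hε0 : 0 ≤ ε := by positivity
  have hε1 : ε ≤ 1 / 64 := by
    have h1 : s ^ 2 ≤ a ^ 2 := pow_le_pow_left₀ h.s_pos.le h.s_le 2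
    rw [hε, div_le_div_iff₀ (by positivity) (by norm_num)]; linarith
  have hRn : NearOne ε R := nearOne_iterate hf n
  have h1 := h.contraction hf hS hRn
  rw [hfix] at h1
  have h2 := (h.update_zero i).frobNorm_symStep_iterate_sub_le hf
  rw [← hZ', ← hR] at h2
  set B : Fin n → Matrix (Fin d) (Fin d) ℝ := fun j => symStep f A Z R j - symStep f A Z' R j
  have hagg : symAggregate A Z R - symAggregate A Z' R = (Z i)ᵀ * R i := by
    have : ∑ j, (Z j)ᵀ * R j - ∑ j, (Z' j)ᵀ * R j = (Z i)ᵀ * R i := by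
      rw [← Finset.sum_sub_distrib, Finset.sum_eq_single i]
      · simp [hZ']
      · intro j _ hj; simp [hZ', Function.update_of_ne hj]
      · simp
    rw [symAggregate, symAggregate, add_sub_add_left_eq_sub, this]
  -- In block `i` the observation itself has changed, so only the a priori bound of the truncated
  -- factor is used.
  have hBi : frobNorm (B i) ≤ 2 * ε := by
    have := frobNorm_sub_le_add (symStep f A Z R i) 1 (symStep f A Z' R i)
    have e1 := hf.near ((A + Z i) * symAggregate A Z R)
    have e2 := hf.near ((A + Z' i) * symAggregate A Z' R)
    rw [frobNorm_sub_comm 1] at this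
    change frobNorm (symStep f A Z R i - 1) ≤ ε at e1
    change frobNorm (symStep f A Z' R i - 1) ≤ ε at e2
    change frobNorm (symStep f A Z R i - symStep f A Z' R i) ≤ _
    linarith
  -- In all other blocks the observation is unchanged and only the aggregate moves, by `(Z i)ᵀ * R
  -- i`.
  have hBrest : frobNorm (stack (Function.update B i 0)) ≤ 16 / 2000 := by
    have e1 : frobNorm (stack (Function.update B i 0)) ≤ 8 / (n * s ^ 2) *
        frobNorm (stack fun j => (A + Z j) * ((Z i)ᵀ * R i)) := by
      refine frobNorm_stack_le (by positivity) fun j => ?_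
      by_cases hj : j = i
      · subst hj
        rw [Function.update_self, frobNorm_zero]
        have := frobNorm_nonneg ((A + Z j) * ((Z j)ᵀ * R j))
        positivity
      · rw [Function.update_of_ne hj, ← hagg, Matrix.mul_sub]
        have : symStep f A Z' R j = f ((A + Z j) * symAggregate A Z' R) := by
          simp [symStep, hZ', Function.update_of_ne hj]
        change frobNorm (symStep f A Z R j - symStep f A Z' R j) ≤ _
        rw [this]
        exact hf.lipschitz _ _
    have e2 := frobNorm_stack_obs_mul_le h.op_le h.noise ((Z i)ᵀ * R i)
    have e3 := h.noise.frobNorm_transpose_mul_le i (R i)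
    have e4 : frobNorm (R i) = Real.sqrt d := by
      rw [← Real.sqrt_sq (frobNorm_nonneg (R i)), frobNorm_orthogonal_sq (hRn i).1]
    rw [e4] at e3
    have e5 : w ≤ Real.sqrt n * a := by
      refine h.w_le'.trans ?_
      rw [mul_comm]
      have := h.q_le_s
      have := h.s_le
      exact mul_le_mul_of_nonneg_left (by linarith) h.sqrt_n_pos.le
    have e6 : Real.sqrt n * Real.sqrt n = n := Real.mul_self_sqrt hn.le
    have e7 := h.q_le'
    calc _ ≤ 8 / (n * s ^ 2) * ((Real.sqrt n * a + w) * (q * Real.sqrt n)) := by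
          refine e1.trans ?_
          gcongr
          refine e2.trans ?_
          have := h.w_nonneg
          gcongr
          exact e3.trans h.w_le
      _ ≤ 8 / (n * s ^ 2) * ((Real.sqrt n * a + Real.sqrt n * a) *
            (s ^ 2 / (2000 * a) * Real.sqrt n)) := by
          have := h.q_nonneg
          gcongr
      _ = 8 / (n * s ^ 2) * (2 * a * (Real.sqrt n * Real.sqrt n) * (s ^ 2 / (2000 * a))) := by
          ring
      _ = 16 / 2000 := by rw [e6]; field_simp; norm_num
  have h3 : frobNorm (stack (symStep f A Z R) - stack (symStep f A Z' R))
      ≤ 2 * ε + 16 / 2000 := by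
    have e : stack (symStep f A Z R) - stack (symStep f A Z' R)
        = stack (Pi.single i (B i)) + stack (Function.update B i 0) := by
      rw [stack_sub, stack_add]
      congr 1; ext1 j
      by_cases hj : j = i
      · subst hj; simp [B]
      · simp [Function.update_of_ne hj, Pi.single_eq_of_ne hj, B]
    rw [e]
    refine (frobNorm_add_le _ _).trans ?_
    rw [frobNorm_stack_single]
    linarith
  have h4 := frobNorm_sub_le_add (stack S) (stack (symStep f A Z R)) (stack R)
  have h5 := frobNorm_sub_le_add (stack (symStep f A Z R)) (stack (symStep f A Z' R)) (stack R)
  linarith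

/-- The signal error is quadratic in `μ`, because only symmetric parts enter; the noise error is
linear in `q` by the global operator bound. -/
lemma frobNorm_gram_error_le (h : Regime A Z a s w q) {μ : ℝ}
    {S : Fin n → Matrix (Fin d) (Fin d) ℝ} (hS : NearOne μ S) :
    frobNorm (A * symAggregate A Z S - (n : ℝ) • (A * Aᵀ)) ≤ n * (a ^ 2 * μ ^ 2 / 2 + a * q) := by
  have ha := h.a_pos
  have e : A * symAggregate A Z S - (n : ℝ) • (A * Aᵀ)
      = A * (Aᵀ * ∑ j, (symPart (S j) - 1)) + A * ∑ j, (Z j)ᵀ * S j := by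
    have e1 : ∑ _j : Fin n, (1 : Matrix (Fin d) (Fin d) ℝ) = (n : ℝ) • 1 := by
      rw [Finset.sum_const, Finset.card_univ, Fintype.card_fin, Nat.cast_smul_eq_nsmul]
    rw [symAggregate, symPart_sum, Finset.sum_sub_distrib, e1, Matrix.mul_add, Matrix.mul_sub,
      Matrix.mul_sub, Matrix.mul_smul, Matrix.mul_smul, Matrix.mul_one]
    abel
  rw [e]
  refine (frobNorm_add_le _ _).trans ?_
  have h1 := frobNorm_mul_transpose_mul_le h.op_le (∑ j, (symPart (S j) - 1))
  have h2 : frobNorm (∑ j, (symPart (S j) - 1)) ≤ n * (1 / 2 * μ ^ 2) := by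
    refine (frobNorm_sum_le _ _).trans ?_
    refine (Finset.sum_le_sum fun j _ => (frobNorm_symPart_sub_one_le (hS j).1).trans
      (mul_le_mul_of_nonneg_left (pow_le_pow_left₀ (frobNorm_nonneg _) (hS j).2 2)
        (by norm_num))).trans ?_
    simp
  have h3 : frobNorm (A * ∑ j, (Z j)ᵀ * S j) ≤ n * (a * q) := by
    have e1 := h.noise.transpose_mul_le S
    rw [frobNorm_stack_orthogonal fun i => (hS i).1] at e1
    have e2 : w * (Real.sqrt n * Real.sqrt d) ≤ q * n := by
      calc _ = w * Real.sqrt d * Real.sqrt n := by ring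
        _ ≤ q * Real.sqrt n * Real.sqrt n := mul_le_mul_of_nonneg_right h.w_le h.sqrt_n_pos.le
        _ = q * n := by rw [mul_assoc, Real.mul_self_sqrt h.n_pos.le]
    refine (frobNorm_mul_le _ _).trans ?_
    calc _ ≤ a * (q * n) := by
          have := frobNorm_nonneg (∑ j, (Z j)ᵀ * S j)
          have := h.op_le
          gcongr
          linarith
      _ = _ := by ring
  calc _ ≤ a ^ 2 * (n * (1 / 2 * μ ^ 2)) + n * (a * q) := by
        have : 0 ≤ a ^ 2 := by positivity
        nlinarith [mul_le_mul_of_nonneg_left h2 this]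
    _ = _ := by ring

/-- The quantitative form of independence: each noise block acts on the signal and on the
aggregate of the leave-one-out iterate as a generic Gaussian matrix. -/
structure Decoupled (A : Matrix (Fin d) (Fin m) ℝ) (Z : Fin n → Matrix (Fin d) (Fin m) ℝ)
    (f : Matrix (Fin d) (Fin d) ℝ → Matrix (Fin d) (Fin d) ℝ) (a w q : ℝ) : Prop where
  signal : ∀ i, frobNorm (Z i * Aᵀ) ≤ a * q
  leaveOneOut : ∀ i, frobNorm (Z i * ∑ j, (Function.update Z i 0 j)ᵀ *
    (symStep f A (Function.update Z i 0))^[n] 1 j) ≤ q * w * Real.sqrt n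

lemma frobNorm_noise_error_le (h : Regime A Z a s w q) (hf : IsTruncatedPolar n A a s f)
    (hd : Decoupled A Z f a w q) {S : Fin n → Matrix (Fin d) (Fin d) ℝ}
    (hS : NearOne (s ^ 2 / (64 * a ^ 2)) S) (hfix : symStep f A Z S = S) (i : Fin n) :
    frobNorm (Z i * symAggregate A Z S) ≤ n * (2 * (a * q)) := by
  have ha := h.a_pos
  have hq := h.q_nonneg
  have hw := h.w_nonneg
  have hn := h.n_pos
  set Z' := Function.update Z i 0 with hZ'
  set R := (symStep f A Z')^[n] 1 with hR
  -- The four terms are: noise against signal; the self-interaction of block `i`; the distance to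
  -- the leave-one-out iterate; and noise against the independent leave-one-out aggregate. The first
  -- and last use `Decoupled`, the middle two the operator norm.
  have e : Z i * symAggregate A Z S = ∑ j, Z i * Aᵀ * symPart (S j) + (Z i * ((Z i)ᵀ * S i)
      + Z i * (∑ j, (Z' j)ᵀ * (S j - R j)) + Z i * ∑ j, (Z' j)ᵀ * R j) := by
    have e1 : ∑ j, (Z j)ᵀ * S j = (Z i)ᵀ * S i + ∑ j, (Z' j)ᵀ * S j := by
      rw [← sub_eq_iff_eq_add, ← Finset.sum_sub_distrib, Finset.sum_eq_single i]
      · simp [hZ']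
      · intro j _ hj; simp [hZ', Function.update_of_ne hj]
      · simp
    rw [symAggregate, e1, symPart_sum, ← Finset.mul_sum]
    simp only [Matrix.mul_sub, Finset.sum_sub_distrib, Matrix.mul_add, ← Matrix.mul_assoc]
    abel
  have hS1 : frobNorm (S i) = Real.sqrt d := by
    rw [← Real.sqrt_sq (frobNorm_nonneg (S i)), frobNorm_orthogonal_sq (hS i).1]
  have t1 : frobNorm (∑ j, Z i * Aᵀ * symPart (S j)) ≤ n * (a * q) := by
    refine (frobNorm_sum_le _ _).trans ((Finset.sum_le_sum fun j _ =>
      (frobNorm_mul_symPart_le _ (hS j).1).trans (hd.signal i)).trans ?_)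
    simp
  have hww : w * w ≤ q ^ 2 * n := by
    have := mul_le_mul h.w_le' h.w_le' hw (by positivity)
    calc _ ≤ _ := this
      _ = q ^ 2 * (Real.sqrt n * Real.sqrt n) := by ring
      _ = _ := by rw [Real.mul_self_sqrt hn.le]
  have hwq : w * (q * Real.sqrt n) ≤ q ^ 2 * n := by
    have := mul_le_mul_of_nonneg_right h.w_le' (by positivity : 0 ≤ q * Real.sqrt n)
    calc _ ≤ _ := this
      _ = q ^ 2 * (Real.sqrt n * Real.sqrt n) := by ring
      _ = _ := by rw [Real.mul_self_sqrt hn.le]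
  have t2 : frobNorm (Z i * ((Z i)ᵀ * S i)) ≤ q ^ 2 * n := by
    refine (h.noise.frobNorm_mul_le i _).trans ?_
    have := h.noise.frobNorm_transpose_mul_le i (S i)
    rw [hS1] at this
    exact (mul_le_mul_of_nonneg_left (this.trans h.w_le) hw).trans hwq
  have t3 : frobNorm (Z i * (∑ j, (Z' j)ᵀ * (S j - R j))) ≤ q ^ 2 * n := by
    refine (h.noise.frobNorm_mul_le i _).trans ?_
    have e1 := (h.update_zero i).noise.transpose_mul_le fun j => S j - R j
    have e2 := h.frobNorm_sub_leaveOneOut_le hf hS hfix i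
    rw [stack_sub] at e2
    have e3 := mul_le_mul_of_nonneg_left e2 hw
    exact (mul_le_mul_of_nonneg_left (e1.trans e3) hw).trans (by linarith)
  have t4 : frobNorm (Z i * ∑ j, (Z' j)ᵀ * R j) ≤ q ^ 2 * n := by
    refine (hd.leaveOneOut i).trans ?_
    linarith
  rw [e]
  have u1 := frobNorm_add_le (∑ j, Z i * Aᵀ * symPart (S j)) (Z i * ((Z i)ᵀ * S i)
      + Z i * (∑ j, (Z' j)ᵀ * (S j - R j)) + Z i * ∑ j, (Z' j)ᵀ * R j)
  have u2 := frobNorm_add_le (Z i * ((Z i)ᵀ * S i) + Z i * (∑ j, (Z' j)ᵀ * (S j - R j)))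
    (Z i * ∑ j, (Z' j)ᵀ * R j)
  have u3 := frobNorm_add_le (Z i * ((Z i)ᵀ * S i)) (Z i * (∑ j, (Z' j)ᵀ * (S j - R j)))
  -- The last three terms are of second order in `q` and together cost no more than the first, since
  -- `3 q ≤ a`.
  have u4 : 3 * (q ^ 2 * n) ≤ n * (a * q) := by
    have : 3 * q ≤ a := by have := h.q_le_s; have := h.s_le; linarith
    nlinarith [mul_le_mul_of_nonneg_right this (by positivity : 0 ≤ q * n)]
  linarith

/-- The antisymmetric part of the sum of the blocks of a symmetrized fixed point vanishes. -/
lemma symPart_sum_eq_of_polar {c : ℝ} (hc : 0 < c) {S : Fin n → Matrix (Fin d) (Fin d) ℝ}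
    (hsym : ∀ i, ((S i)ᵀ * ((A + Z i) * symAggregate A Z S))ᵀ
      = (S i)ᵀ * ((A + Z i) * symAggregate A Z S))
    (hB : ∀ v : Fin d → ℝ, c * (v ⬝ᵥ v) ≤ v ⬝ᵥ ((A * symAggregate A Z S) *ᵥ v)) :
    symPart (∑ j, S j) = ∑ j, S j := by
  set M := symAggregate A Z S with hM
  set K := ∑ j, S j - symPart (∑ j, S j) with hK
  set B := A * M with hBdef
  have hKt : Kᵀ = -K := by
    have : K = (1 / 2 : ℝ) • (∑ j, S j - (∑ j, S j)ᵀ) := by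
      rw [hK, symPart, smul_add, smul_sub]
      nth_rw 1 [show ∑ j, S j = (1 / 2 : ℝ) • (∑ j, S j) + (1 / 2 : ℝ) • ∑ j, S j by
        rw [← add_smul]; norm_num]
      abel
    rw [this, transpose_smul, transpose_sub, transpose_transpose, ← smul_neg, neg_sub]
  -- The unsymmetrized aggregate is `M + Aᵀ K`. Summing the polar parts therefore gives `Mᵀ M + Kᵀ
  -- B`, which must be symmetric.
  have hsum : ∑ i, (S i)ᵀ * ((A + Z i) * M) = Mᵀ * M + Kᵀ * B := by
    have e1 : ∑ i, (S i)ᵀ * ((A + Z i) * M) = (∑ i, (A + Z i)ᵀ * S i)ᵀ * M := by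
      rw [transpose_sum, Matrix.sum_mul]
      refine Finset.sum_congr rfl fun i _ => ?_
      rw [transpose_mul, transpose_transpose, Matrix.mul_assoc]
    have e2 : ∑ i, (A + Z i)ᵀ * S i = M + Aᵀ * K := by
      rw [hM, symAggregate, hK]
      simp only [transpose_add, Matrix.add_mul, Finset.sum_add_distrib, Matrix.mul_sub,
        ← Matrix.mul_sum]
      abel
    rw [e1, e2, transpose_add, Matrix.add_mul, transpose_mul, transpose_transpose,
      Matrix.mul_assoc]
  have hKB : Bᵀ * K = -(K * B) := by
    have e1 : (Mᵀ * M + Kᵀ * B)ᵀ = Mᵀ * M + Kᵀ * B := by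
      rw [← hsum, transpose_sum]
      exact Finset.sum_congr rfl fun i _ => hsym i
    rw [transpose_add, transpose_mul, transpose_mul, transpose_transpose,
      transpose_transpose, add_right_inj, hKt, Matrix.neg_mul] at e1
    exact e1
  -- Symmetry of `Kᵀ B` and antisymmetry of `K` make `trace (K B K)` equal to its own negative.
  -- Coercivity of `B` then forces `K = 0`.
  have htr : frobInner K (B * K) = 0 := by
    have e1 : frobInner K (B * K) = -trace (K * (B * K)) := by
      rw [frobInner, hKt, Matrix.neg_mul, trace_neg]
    have e2 : trace (K * (B * K)) = -trace (Bᵀ * K * K) := by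
      rw [hKB, ← Matrix.mul_assoc, Matrix.neg_mul, trace_neg, neg_neg]
    have e3 : trace (Bᵀ * K * K) = trace (K * (B * K)) := by
      rw [← trace_transpose, transpose_mul, transpose_mul, transpose_transpose, hKt,
        Matrix.neg_mul, Matrix.neg_mul, Matrix.mul_neg, neg_neg, trace_mul_comm K (K * B),
        Matrix.mul_assoc]
    rw [e3] at e2
    rw [e1]; linarith
  have h0 := mul_frobNorm_sq_le_trace hB K
  rw [htr] at h0
  have h1 : frobNorm K ^ 2 ≤ 0 := by nlinarith
  have h2 : frobNorm K = 0 := by nlinarith [frobNorm_nonneg K]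
  exact (sub_eq_zero.1 (frobNorm_eq_zero h2)).symm

/-- Crude closeness `ε` from truncation places every argument of `f` where it is the true polar
factor. The quantitative bound follows by applying the error estimate again, with the actual maximal
deviation in place of `ε`. -/
theorem exists_good_fixedPoint (h : Regime A Z a s w q) (hf : IsTruncatedPolar n A a s f)
    (hd : Decoupled A Z f a w q) :
    ∃ S : Fin n → Matrix (Fin d) (Fin d) ℝ, ∀ i,
      IsPolar (n * s ^ 2 / 2) ((A + Z i) * ∑ j, (A + Z j)ᵀ * S j) (S i) ∧
        frobNorm (S i - 1) ≤ 7 * (a * q / s ^ 2) := by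
  have ha := h.a_pos
  have hs := h.s_pos
  have hn := h.n_pos
  have hq := h.q_nonneg
  set ε := s ^ 2 / (64 * a ^ 2) with hε
  have hε0 : 0 < ε := by positivity
  obtain ⟨S, hS, hfix⟩ := exists_fixedPoint_of_contraction hε0.le
    (fun S => nearOne_symStep (Z := Z) hf S) (fun _ _ hS hT => h.contraction hf hS hT)
  have herr : ∀ μ, NearOne μ S → ∀ i,
      frobNorm ((A + Z i) * symAggregate A Z S - (n : ℝ) • (A * Aᵀ))
        ≤ n * (a ^ 2 * μ ^ 2 / 2 + 3 * (a * q)) := by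
    intro μ hμ i
    have e1 := h.frobNorm_gram_error_le hμ
    have e2 := h.frobNorm_noise_error_le hf hd hS hfix i
    rw [Matrix.add_mul, add_sub_right_comm]
    refine (frobNorm_add_le _ _).trans ?_
    calc _ ≤ _ := add_le_add e1 e2
      _ = _ := by ring
  have haε : a ^ 2 * ε = s ^ 2 / 64 := by rw [hε]; field_simp
  have haq : a * q ≤ s ^ 2 * ε / 31 := by
    calc a * q ≤ a * (s ^ 4 / (2000 * a ^ 3)) := by have := h.q_le; gcongr
      _ = s ^ 2 * ε * (64 / 2000) := by rw [hε]; field_simp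
      _ ≤ _ := by nlinarith [(by positivity : 0 ≤ s ^ 2 * ε)]
  have hsmall : n * (a ^ 2 * ε ^ 2 / 2 + 3 * (a * q)) ≤ ε * (n * s ^ 2) / 2 := by
    have : a ^ 2 * ε ^ 2 / 2 + 3 * (a * q) ≤ ε * s ^ 2 / 2 := by
      have e1 : a ^ 2 * ε ^ 2 = s ^ 2 * ε / 64 := by rw [sq ε, ← mul_assoc, haε]; ring
      rw [e1]
      nlinarith [(by positivity : 0 ≤ s ^ 2 * ε)]
    calc _ ≤ n * (ε * s ^ 2 / 2) := by gcongr
      _ = _ := by ring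
  have hpol := fun i => hf.polar _ ((herr ε hS i).trans hsmall)
  have hval : ∀ i, f ((A + Z i) * symAggregate A Z S) = S i := fun i => congrFun hfix i
  simp only [hval] at hpol
  have hcoer : ∀ v : Fin d → ℝ, n * s ^ 2 / 2 * (v ⬝ᵥ v)
      ≤ v ⬝ᵥ ((A * symAggregate A Z S) *ᵥ v) := by
    intro v
    have e1 := h.frobNorm_gram_error_le hS
    have e2 : n * (a ^ 2 * ε ^ 2 / 2 + a * q) ≤ n * s ^ 2 / 2 := by
      have : ε ≤ 1 := by
        have h1 : s ^ 2 ≤ a ^ 2 := pow_le_pow_left₀ hs.le h.s_le 2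
        rw [hε, div_le_one (by positivity)]; nlinarith
      have e3 : ε * (n * s ^ 2) / 2 ≤ n * s ^ 2 / 2 := by
        have := mul_le_mul_of_nonneg_right this (by positivity : 0 ≤ n * s ^ 2)
        linarith
      have e4 : (0 : ℝ) ≤ n * (2 * (a * q)) := by positivity
      linarith
    have := coercive_of_frobNorm_sub_le (by positivity) (coercive_gram h.le_op n)
      (e1.trans e2) v
    calc _ = (n * s ^ 2 - n * s ^ 2 / 2) * (v ⬝ᵥ v) := by ring
      _ ≤ _ := this
  have hsymm := symPart_sum_eq_of_polar (by positivity) (fun i => (hpol i).1.2.1) hcoer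
  have hagg : symAggregate A Z S = ∑ j, (A + Z j)ᵀ * S j := by
    rw [symAggregate, hsymm]
    simp only [transpose_add, Matrix.add_mul, Finset.sum_add_distrib, ← Matrix.mul_sum]
  refine ⟨S, fun i => ⟨hagg ▸ (hpol i).1, ?_⟩⟩
  have : Nonempty (Fin n) := ⟨i⟩
  -- Bootstrap at the worst block: its deviation satisfies `μ ≤ a² μ² / s² + 6 a q / s²`. Since `μ ≤
  -- ε`, the quadratic term is at most `μ / 64`, and absorbing it raises `6` to at most `7`.
  obtain ⟨i₀, hi₀⟩ := Finite.exists_max fun i => frobNorm (S i - 1)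
  set μ := frobNorm (S i₀ - 1) with hμ
  have hμ0 : 0 ≤ μ := frobNorm_nonneg _
  have hμε : μ ≤ ε := (hS i₀).2
  have e1 := (hpol i₀).2.trans (mul_le_mul_of_nonneg_left
    (herr μ (fun i => ⟨(hS i).1, hi₀ i⟩) i₀) (by positivity))
  have e2 : 2 / (n * s ^ 2) * (n * (a ^ 2 * μ ^ 2 / 2 + 3 * (a * q)))
      = a ^ 2 * μ ^ 2 / s ^ 2 + 6 * (a * q / s ^ 2) := by field_simp; ring
  have e3 : a ^ 2 * μ ^ 2 / s ^ 2 ≤ μ / 64 := by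
    rw [div_le_iff₀ (by positivity)]
    calc a ^ 2 * μ ^ 2 = a ^ 2 * μ * μ := by ring
      _ ≤ a ^ 2 * ε * μ := by gcongr
      _ = _ := by rw [haε]; ring
  refine (hi₀ i).trans ?_
  rw [e2] at e1
  change μ ≤ _
  change μ ≤ _ at e1
  have e4 : 0 ≤ a * q / s ^ 2 := by positivity
  linarith

end Regime
end FixedPoint

/-! ### Optimal alignment and uniqueness of limiting points up to rotation. -/

section Alignment

variable {n d m : ℕ}

lemma stack_sub_mul_apply (S B : Fin n → Matrix (Fin d) (Fin d) ℝ) (Q : Matrix (Fin d) (Fin d) ℝ) :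
    stack S - stack B * Q = stack fun i => S i - B i * Q := by
  rw [stack_mul, stack_sub]

lemma frobNorm_stack_sub_mul (S B : Fin n → Matrix (Fin d) (Fin d) ℝ)
    {Q : Matrix (Fin d) (Fin d) ℝ} (hQ : Q ∈ orthogonalGroup (Fin d) ℝ) :
    frobNorm (stack S - stack B * Q) = frobNorm (stack fun i => S i * Qᵀ - B i) := by
  rw [← frobNorm_mul_orthogonal (orthogonal_transpose hQ) (stack S - stack B * Q), stack_sub_mul_apply, stack_mul]
  simp only [Matrix.sub_mul, Matrix.mul_assoc, orthogonal_mul_transpose hQ, Matrix.mul_one]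

lemma frobNorm_stack_orthogonal_mul {O : Fin n → Matrix (Fin d) (Fin d) ℝ}
    (hO : ∀ i, O i ∈ orthogonalGroup (Fin d) ℝ) {k : ℕ} (X : Fin n → Matrix (Fin d) (Fin k) ℝ) :
    frobNorm (stack fun i => O i * X i) = frobNorm (stack X) := by
  rw [← sq_eq_sq₀ (frobNorm_nonneg _) (frobNorm_nonneg _), frobNorm_stack_sq, frobNorm_stack_sq]
  simp only [fun i => frobNorm_orthogonal_mul (hO i) (X i)]

/-- A tuple close to the orbit of `B` has a best aligned rotation, for which the cross Gram matrix
is symmetric. -/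
lemma exists_alignment (hn : 1 ≤ n) {S B : Fin n → Matrix (Fin d) (Fin d) ℝ}
    (hB : ∀ i, B i ∈ orthogonalGroup (Fin d) ℝ)
    {Q₀ : Matrix (Fin d) (Fin d) ℝ} (hQ₀ : Q₀ ∈ orthogonalGroup (Fin d) ℝ)
    (h : frobNorm (stack S - stack B * Q₀) ≤ Real.sqrt n / 2) :
    ∃ Q ∈ orthogonalGroup (Fin d) ℝ, (∑ j, (B j)ᵀ * (S j * Qᵀ))ᵀ = ∑ j, (B j)ᵀ * (S j * Qᵀ) ∧
      ∀ Q' ∈ orthogonalGroup (Fin d) ℝ,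
        frobNorm (stack S - stack B * Q) ≤ frobNorm (stack S - stack B * Q') := by
  have hn0 : (0 : ℝ) < n := by exact_mod_cast hn
  set G := ∑ j, (B j)ᵀ * S j with hG
  have hX : frobNorm (G * Q₀ᵀ - (n : ℝ) • 1) ≤ n / 2 := by
    have e : G * Q₀ᵀ - (n : ℝ) • 1 = ∑ j, (B j)ᵀ * (S j * Q₀ᵀ - B j) := by
      have e1 : ∀ i, (B i)ᵀ * B i = 1 := fun i => orthogonal_transpose_mul (hB i)
      simp only [Matrix.mul_sub, Finset.sum_sub_distrib, e1]
      rw [Finset.sum_const, Finset.card_univ, Fintype.card_fin, Nat.cast_smul_eq_nsmul, hG,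
        Matrix.sum_mul]
      simp only [Matrix.mul_assoc]
    rw [e]
    refine (frobNorm_sum_le _ _).trans ?_
    rw [Finset.sum_congr rfl fun j _ =>
      frobNorm_orthogonal_mul (orthogonal_transpose (hB j)) (S j * Q₀ᵀ - B j)]
    refine (sum_frobNorm_le fun j => S j * Q₀ᵀ - B j).trans ?_
    rw [← frobNorm_stack_sub_mul S B hQ₀]
    calc _ ≤ Real.sqrt n * (Real.sqrt n / 2) := by gcongr
      _ = n / 2 := by rw [← mul_div_assoc, Real.mul_self_sqrt hn0.le]
  have hcoer : ∀ v : Fin d → ℝ, n / 2 * (v ⬝ᵥ v) ≤ v ⬝ᵥ ((G * Q₀ᵀ) *ᵥ v) := by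
    intro v
    have := coercive_of_frobNorm_sub_le (c := n) (G := (n : ℝ) • 1) (by positivity)
      (fun v => by simp [smul_mulVec]) hX v
    linarith
  -- Closeness to the orbit puts `G * Q₀ᵀ` within `n / 2` of `n • 1`, so it has a polar factor.
  -- Minimizing the distance over `Q` is maximizing `⟨Q, G⟩`, so `R * Q₀` is optimal, and symmetry
  -- of the polar part becomes that of the cross Gram matrix.
  obtain ⟨R, hR⟩ := exists_isPolar (by positivity) (mulVec_sq_ge_of_coercive (by positivity) hcoer)
  have hmax := (hR.isSharpMax.mono (τ' := 0) (by positivity)).mul_orthogonal hQ₀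
  have hGQ : G * Q₀ᵀ * Q₀ = G := by
    rw [Matrix.mul_assoc, orthogonal_transpose_mul hQ₀, Matrix.mul_one]
  rw [hGQ] at hmax
  refine ⟨R * Q₀, hmax.1, ?_, fun Q' hQ' => ?_⟩
  · have e : ∑ j, (B j)ᵀ * (S j * (R * Q₀)ᵀ) = R * (Rᵀ * (G * Q₀ᵀ)) * Rᵀ := by
      rw [← Matrix.mul_assoc R, orthogonal_mul_transpose hR.1, Matrix.one_mul, hG, transpose_mul]
      simp only [Matrix.sum_mul, Matrix.mul_assoc]
    rw [e, transpose_mul, transpose_mul, hR.2.1, transpose_transpose]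
    simp only [Matrix.mul_assoc]
  · refine le_of_sq_le_sq ?_ (frobNorm_nonneg _)
    have key : ∀ Q ∈ orthogonalGroup (Fin d) ℝ, frobNorm (stack S - stack B * Q) ^ 2
        = frobNorm (stack S) ^ 2 - 2 * frobInner Q G + frobNorm (stack B) ^ 2 := by
      intro Q hQ
      rw [frobNorm_sub_sq, frobNorm_mul_orthogonal hQ, frobInner_comm, frobInner_mul_left,
        stack_transpose_mul]
    rw [key _ hmax.1, key _ hQ']
    have := hmax.2 Q' hQ'
    rw [frobInner_sub_left] at this
    linarith

lemma dF_le {X Y : Matrix (Fin n × Fin d) (Fin d) ℝ} {Q : Matrix (Fin d) (Fin d) ℝ}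
    (hQ : Q ∈ orthogonalGroup (Fin d) ℝ) : dF X Y ≤ frobNorm (X - Y * Q) :=
  ciInf_le (f := fun Q : orthogonalGroup (Fin d) ℝ =>
    frobNorm (X - Y * (Q : Matrix (Fin d) (Fin d) ℝ)))
    ⟨0, by rintro _ ⟨Q, rfl⟩; exact frobNorm_nonneg _⟩ ⟨Q, hQ⟩

lemma dF_nonneg (X Y : Matrix (Fin n × Fin d) (Fin d) ℝ) : 0 ≤ dF X Y :=
  Real.iInf_nonneg fun _ => frobNorm_nonneg _

lemma exists_lt_of_dF_lt {X Y : Matrix (Fin n × Fin d) (Fin d) ℝ} {η : ℝ} (h : dF X Y < η) :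
    ∃ Q ∈ orthogonalGroup (Fin d) ℝ, frobNorm (X - Y * Q) < η := by
  obtain ⟨Q, hQ⟩ := exists_lt_of_ciInf_lt h
  exact ⟨Q, Q.2, hQ⟩

/-- Two limiting points differ by a global rotation. -/
lemma IsLimitPoint.exists_eq_mul (hn : 1 ≤ n) {S : ℕ → Fin n → Matrix (Fin d) (Fin d) ℝ}
    {B L : Fin n → Matrix (Fin d) (Fin d) ℝ} (hB : IsLimitPoint S B) (hL : IsLimitPoint S L) :
    ∃ Q ∈ orthogonalGroup (Fin d) ℝ, ∀ i, L i = B i * Q := by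
  have hn0 : (0 : ℝ) < n := by exact_mod_cast hn
  have hclose : ∀ η > 0, ∃ Q ∈ orthogonalGroup (Fin d) ℝ,
      frobNorm (stack L - stack B * Q) ≤ η := by
    intro η hη
    have e1 := hB.2.eventually (gt_mem_nhds (half_pos hη))
    have e2 := hL.2.eventually (gt_mem_nhds (half_pos hη))
    obtain ⟨t, ht1, ht2⟩ := (e1.and e2).exists
    obtain ⟨Q1, hQ1, h1⟩ := exists_lt_of_dF_lt ht1
    obtain ⟨Q2, hQ2, h2⟩ := exists_lt_of_dF_lt ht2
    refine ⟨Q1 * Q2ᵀ, mul_mem hQ1 (orthogonal_transpose hQ2), ?_⟩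
    have e : stack L - stack B * (Q1 * Q2ᵀ) = (stack L * Q2 - stack B * Q1) * Q2ᵀ := by
      rw [Matrix.sub_mul, Matrix.mul_assoc, Matrix.mul_assoc, orthogonal_mul_transpose hQ2,
        Matrix.mul_one]
    rw [e, frobNorm_mul_orthogonal (orthogonal_transpose hQ2)]
    have := frobNorm_sub_le_add (stack L * Q2) (stack (S t)) (stack B * Q1)
    rw [frobNorm_sub_comm (stack L * Q2) (stack (S t))] at this
    linarith
  -- The two orbits are at distance zero as an infimum. The alignment lemma supplies a minimizing
  -- `Q`, which turns this into equality.
  obtain ⟨Q₀, hQ₀, h0⟩ := hclose (Real.sqrt n / 2) (by positivity)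
  obtain ⟨Q, hQ, -, hmin⟩ := exists_alignment hn hB.1 hQ₀ h0
  refine ⟨Q, hQ, fun i => ?_⟩
  have hz : frobNorm (stack L - stack B * Q) = 0 := by
    refine le_antisymm (le_of_forall_pos_le_add fun η hη => ?_) (frobNorm_nonneg _)
    obtain ⟨Q', hQ', h'⟩ := hclose η hη
    rw [zero_add]
    exact (hmin Q' hQ').trans h'
  have := frobNorm_eq_zero hz
  rw [stack_sub_mul_apply] at this
  have h2 := congrArg (fun X => block X i) this
  simp only [block_stack] at h2
  rw [← sub_eq_zero, h2]
  ext a b; simp [block]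

end Alignment

/-! ### Linear convergence of the power method to the good fixed point. -/

section Convergence

namespace Regime

variable {n d m : ℕ} {A : Matrix (Fin d) (Fin m) ℝ} {Z : Fin n → Matrix (Fin d) (Fin m) ℝ}
  {a s w q : ℝ}

/-- One step of the generalized power method halves the distance to a good fixed point. -/
lemma gpm_step (h : Regime A Z a s w q) {B S S' : Fin n → Matrix (Fin d) (Fin d) ℝ}
    (hB : ∀ i, IsPolar (n * s ^ 2 / 2) ((A + Z i) * ∑ j, (A + Z j)ᵀ * B j) (B i))
    (hB1 : ∀ i, frobNorm (B i - 1) ≤ s ^ 2 / (64 * a ^ 2))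
    (hS : ∀ i, S i ∈ orthogonalGroup (Fin d) ℝ)
    (hS' : ∀ i, IsSharpMax 0 ((A + Z i) * ∑ j, (A + Z j)ᵀ * S j) (S' i))
    {Q : Matrix (Fin d) (Fin d) ℝ} (hQ : Q ∈ orthogonalGroup (Fin d) ℝ)
    (hsym : (∑ j, (B j)ᵀ * (S j * Qᵀ))ᵀ = ∑ j, (B j)ᵀ * (S j * Qᵀ))
    (hclose : frobNorm (stack S - stack B * Q) ≤ s ^ 2 / (64 * a ^ 2) * Real.sqrt n) :
    frobNorm (stack S' - stack B * Q) ≤ 1 / 2 * frobNorm (stack S - stack B * Q) := by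
  have ha := h.a_pos
  have hs := h.s_pos
  have hn := h.n_pos
  have hw := h.w_nonneg
  have hQt := orthogonal_transpose hQ
  rw [frobNorm_stack_sub_mul _ _ hQ] at hclose ⊢
  rw [frobNorm_stack_sub_mul _ _ hQ]
  set Δ : Fin n → Matrix (Fin d) (Fin d) ℝ := fun j => S j * Qᵀ - B j with hΔ
  set D := frobNorm (stack Δ) with hD
  have hD0 : 0 ≤ D := frobNorm_nonneg _
  set ε := s ^ 2 / (64 * a ^ 2) with hε
  have hε0 : 0 < ε := by positivity
  set r := Real.sqrt n with hr
  have hr0 : 0 < r := h.sqrt_n_pos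
  have hrr : r * r = n := Real.mul_self_sqrt hn.le
  have hSQ : ∀ j, S j * Qᵀ ∈ orthogonalGroup (Fin d) ℝ := fun j => mul_mem (hS j) hQt
  -- Alignment makes the sum of the `B_jᵀ S_j Qᵀ` equal to its symmetric part. Its deviation from `n
  -- • 1` is then quadratic in `D`, which removes the neutral rotation direction.
  have h1 : frobNorm (∑ j, (B j)ᵀ * Δ j) ≤ 1 / 2 * D ^ 2 := by
    have e0 : ∀ j, (B j)ᵀ * Δ j = (B j)ᵀ * (S j * Qᵀ) - 1 := fun j => by
      rw [hΔ, Matrix.mul_sub, orthogonal_transpose_mul (hB j).1]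
    have e1 : ∑ j, (B j)ᵀ * Δ j = ∑ j, (symPart ((B j)ᵀ * (S j * Qᵀ)) - 1) := by
      simp only [e0]
      rw [Finset.sum_sub_distrib, Finset.sum_sub_distrib, ← symPart_sum, symPart, hsym,
        ← two_smul ℝ, smul_smul]
      norm_num
    rw [e1, hD, frobNorm_stack_sq, Finset.mul_sum]
    refine (frobNorm_sum_le _ _).trans (Finset.sum_le_sum fun j _ => ?_)
    refine (frobNorm_symPart_sub_one_le
      (mul_mem (orthogonal_transpose (hB j).1) (hSQ j))).trans_eq ?_
    rw [← e0, frobNorm_orthogonal_mul (orthogonal_transpose (hB j).1)]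
  -- Passing from `B_jᵀ Δ_j` to `Δ_j` costs `ε √n D` because `B` is near the identity; the quadratic
  -- term adds half of that by `hclose`.
  have h2 : frobNorm (∑ j, Δ j) ≤ 3 / 2 * (ε * r) * D := by
    have e : ∑ j, Δ j = ∑ j, (B j)ᵀ * Δ j - ∑ j, (B j - 1)ᵀ * Δ j := by
      rw [← Finset.sum_sub_distrib]
      refine Finset.sum_congr rfl fun j _ => ?_
      rw [transpose_sub, transpose_one, Matrix.sub_mul, Matrix.one_mul]; abel
    have e2 : frobNorm (∑ j, (B j - 1)ᵀ * Δ j) ≤ ε * (r * D) := by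
      refine (frobNorm_sum_le _ _).trans ?_
      refine (Finset.sum_le_sum fun j _ => (frobNorm_mul_le_frobNorm _ _).trans
        (mul_le_mul_of_nonneg_right ((frobNorm_transpose _).trans_le (hB1 j))
          (frobNorm_nonneg _))).trans ?_
      rw [← Finset.mul_sum]
      exact mul_le_mul_of_nonneg_left (sum_frobNorm_le _) hε0.le
    rw [e]
    have e3 := frobNorm_sub_le (∑ j, (B j)ᵀ * Δ j) (∑ j, (B j - 1)ᵀ * Δ j)
    nlinarith [mul_le_mul_of_nonneg_right hclose hD0]
  set M := ∑ j, (A + Z j)ᵀ * Δ j with hM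
  have h3 : frobNorm M ≤ (3 / 2 * a * (ε * r) + w) * D := by
    have e : M = Aᵀ * ∑ j, Δ j + ∑ j, (Z j)ᵀ * Δ j := by
      rw [hM]
      simp only [transpose_add, Matrix.add_mul, Finset.sum_add_distrib, Matrix.mul_sum]
    rw [e]
    have e1 := frobNorm_mul_le Aᵀ (∑ j, Δ j)
    rw [opNorm_transpose] at e1
    have e2 : opNorm A * frobNorm (∑ j, Δ j) ≤ a * (3 / 2 * (ε * r) * D) :=
      mul_le_mul h.op_le h2 (frobNorm_nonneg _) ha.le
    have e3 := h.noise.transpose_mul_le Δ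
    have e4 := frobNorm_add_le (Aᵀ * ∑ j, Δ j) (∑ j, (Z j)ᵀ * Δ j)
    linarith
  have h4 : frobNorm (stack fun i => S' i * Qᵀ - B i)
      ≤ 4 / (n * s ^ 2) * frobNorm (stack fun i => (A + Z i) * M) := by
    refine frobNorm_stack_le (by positivity) fun i => ?_
    have e1 := (hB i).isSharpMax.frobNorm_sub_le (by positivity) ((hS' i).mul_orthogonal hQt)
    rw [frobNorm_sub_comm, frobNorm_sub_comm ((A + Z i) * _)] at e1
    have e2 : (A + Z i) * ∑ j, (A + Z j)ᵀ * S j * Qᵀ - (A + Z i) * ∑ j, (A + Z j)ᵀ * B j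
        = (A + Z i) * M := by
      rw [← Matrix.mul_sub, ← Finset.sum_sub_distrib, hM]
      simp only [hΔ, Matrix.mul_sub, Matrix.mul_assoc]
    rw [Matrix.mul_assoc, Matrix.sum_mul, e2] at e1
    calc _ ≤ _ := e1
      _ = _ := by congr 1; field_simp; norm_num
  have h5 := frobNorm_stack_obs_mul_le h.op_le h.noise M
  have hwc := h.w_le_contr
  have haε : a * (ε * r) = s ^ 2 / (64 * a) * r := by rw [hε]; field_simp
  have hw2 : w ≤ a * r / 64 := by
    refine hwc.trans ?_
    rw [div_mul_eq_mul_div, div_le_div_iff₀ (by positivity) (by norm_num)]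
    have : s ^ 2 ≤ a ^ 2 := pow_le_pow_left₀ hs.le h.s_le 2
    nlinarith [mul_le_mul_of_nonneg_right this hr0.le]
  calc _ ≤ 4 / (n * s ^ 2) * ((r * a + w) * ((3 / 2 * a * (ε * r) + w) * D)) := by
        refine h4.trans ?_
        gcongr
        exact h5.trans (by gcongr)
    _ ≤ 4 / (n * s ^ 2) * ((65 / 64 * (r * a)) * ((5 / 2 * (s ^ 2 / (64 * a) * r)) * D)) := by
        have e1 : r * a + w ≤ 65 / 64 * (r * a) := by linarith
        have e2 : 3 / 2 * a * (ε * r) + w ≤ 5 / 2 * (s ^ 2 / (64 * a) * r) := by linarith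
        gcongr
    _ = 650 / 4096 * D := by
        rw [← hrr]; field_simp; ring
    _ ≤ 1 / 2 * D := by nlinarith

/-- The contraction step assumes optimal alignment, and the rotation optimal for one iterate need
not be optimal for the next. The alignment is therefore renewed at each step, which cannot increase
the distance. -/
lemma gpm_geometric (h : Regime A Z a s w q) {B : Fin n → Matrix (Fin d) (Fin d) ℝ}
    {T : ℕ → Fin n → Matrix (Fin d) (Fin d) ℝ}
    (hB : ∀ i, IsPolar (n * s ^ 2 / 2) ((A + Z i) * ∑ j, (A + Z j)ᵀ * B j) (B i))
    (hB1 : ∀ i, frobNorm (B i - 1) ≤ s ^ 2 / (64 * a ^ 2))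
    (hT0 : ∀ i, T 0 i ∈ orthogonalGroup (Fin d) ℝ)
    (hT : ∀ t i, IsSharpMax 0 ((A + Z i) * ∑ j, (A + Z j)ᵀ * T t j) (T (t + 1) i))
    (hinit : ∃ Q ∈ orthogonalGroup (Fin d) ℝ,
      frobNorm (stack (T 0) - stack B * Q) ≤ s ^ 2 / (64 * a ^ 2) * Real.sqrt n) (t : ℕ) :
    ∃ Q ∈ orthogonalGroup (Fin d) ℝ,
      frobNorm (stack (T t) - stack B * Q) ≤ s ^ 2 / (64 * a ^ 2) * Real.sqrt n * (1 / 2) ^ t := by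
  have ha := h.a_pos
  have hTo : ∀ t i, T t i ∈ orthogonalGroup (Fin d) ℝ := by
    intro t i
    cases t with
    | zero => exact hT0 i
    | succ t => exact (hT t i).1
  have hε1 : s ^ 2 / (64 * a ^ 2) ≤ 1 / 64 := by
    have h1 : s ^ 2 ≤ a ^ 2 := pow_le_pow_left₀ h.s_pos.le h.s_le 2
    rw [div_le_div_iff₀ (by positivity) (by norm_num)]; linarith
  induction t with
  | zero => simpa using hinit
  | succ t ih =>
    obtain ⟨Q₀, hQ₀, h0⟩ := ih
    have hp : (1 / 2 : ℝ) ^ t ≤ 1 := pow_le_one₀ (by norm_num) (by norm_num)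
    have hle : s ^ 2 / (64 * a ^ 2) * Real.sqrt n * (1 / 2) ^ t
        ≤ s ^ 2 / (64 * a ^ 2) * Real.sqrt n := mul_le_of_le_one_right (by positivity) hp
    obtain ⟨Q, hQ, hsym, hmin⟩ := exists_alignment h.one_le_n (fun i => (hB i).1) hQ₀
      (h0.trans (hle.trans (by nlinarith [h.sqrt_n_pos])))
    have h1 := (hmin Q₀ hQ₀).trans h0
    have h2 := h.gpm_step hB hB1 (hTo t) (hT t) hQ hsym (h1.trans hle)
    refine ⟨Q, hQ, h2.trans ?_⟩
    rw [pow_succ (1 / 2 : ℝ)]; linarith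

lemma isLimitPoint_of_gpm (h : Regime A Z a s w q) {B : Fin n → Matrix (Fin d) (Fin d) ℝ}
    {T : ℕ → Fin n → Matrix (Fin d) (Fin d) ℝ}
    (hB : ∀ i, IsPolar (n * s ^ 2 / 2) ((A + Z i) * ∑ j, (A + Z j)ᵀ * B j) (B i))
    (hB1 : ∀ i, frobNorm (B i - 1) ≤ s ^ 2 / (64 * a ^ 2))
    (hT0 : ∀ i, T 0 i ∈ orthogonalGroup (Fin d) ℝ)
    (hT : ∀ t i, IsSharpMax 0 ((A + Z i) * ∑ j, (A + Z j)ᵀ * T t j) (T (t + 1) i))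
    (hinit : ∃ Q ∈ orthogonalGroup (Fin d) ℝ,
      frobNorm (stack (T 0) - stack B * Q) ≤ s ^ 2 / (64 * a ^ 2) * Real.sqrt n) :
    IsLimitPoint T B := by
  refine ⟨fun i => (hB i).1, ?_⟩
  refine squeeze_zero (fun t => dF_nonneg _ _) (fun t => ?_)
    (g := fun t : ℕ => s ^ 2 / (64 * a ^ 2) * Real.sqrt n * (1 / 2) ^ t) ?_
  · obtain ⟨Q, hQ, hle⟩ := h.gpm_geometric hB hB1 hT0 hT hinit t
    exact (dF_le hQ).trans hle
  · have := (tendsto_pow_atTop_nhds_zero_of_lt_one (r := (1 / 2 : ℝ)) (by norm_num)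
      (by norm_num)).const_mul (s ^ 2 / (64 * a ^ 2) * Real.sqrt n)
    rwa [mul_zero] at this

end Regime
end Convergence

/-! ### Spectral initialization. -/

section Spectral

variable {n d m : ℕ}

lemma frobNorm_vecMulVec_single_sq {ι : Type*} [Fintype ι] (u : ι → ℝ) (k : Fin d) :
    frobNorm (vecMulVec u (Pi.single k 1)) ^ 2 = u ⬝ᵥ u := by
  rw [frobNorm_sq]
  simp [vecMulVec_apply, dotProduct, sq, Pi.single_apply]

lemma mulVec_dotProduct_self {ι : Type*} [Fintype ι] (X : Matrix ι (Fin d) ℝ) (v : Fin d → ℝ) :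
    (X *ᵥ v) ⬝ᵥ (X *ᵥ v) = v ⬝ᵥ ((Xᵀ * X) *ᵥ v) := by
  rw [← mulVec_mulVec, dotProduct_mulVec v, vecMul_transpose]

/-- A top singular value of `D` is at least the lower bound of `‖Dᵀ x‖ / ‖x‖` over a subspace of
dimension `d`, parametrized by the `d`-dimensional vectors. -/
lemma exists_mulVec_sq_le_singular {ι : Type*} [Fintype ι] {D : Matrix ι (Fin m) ℝ}
    {U : Matrix ι (Fin d) ℝ} {V : Matrix (Fin m) (Fin d) ℝ} {s : Fin d → ℝ} (hU : Uᵀ * U = 1)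
    (hV : Vᵀ * V = 1) (hDV : D * V = U * diagonal s) (hDU : Dᵀ * U = V * diagonal s)
    (hmax : ∀ x : ι → ℝ, Uᵀ *ᵥ x = 0 → ∀ k, (Dᵀ *ᵥ x) ⬝ᵥ (Dᵀ *ᵥ x) ≤ s k ^ 2 * (x ⬝ᵥ x))
    (J : Matrix ι (Fin d) ℝ) (k : Fin d) :
    ∃ v : Fin d → ℝ, v ≠ 0 ∧
      (Dᵀ *ᵥ (J *ᵥ v)) ⬝ᵥ (Dᵀ *ᵥ (J *ᵥ v)) ≤ s k ^ 2 * ((J *ᵥ v) ⬝ᵥ (J *ᵥ v)) := by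
  -- Zeroing row `k` makes the matrix singular, so some nonzero `v` has `Uᵀ J v` supported on
  -- coordinate `k` alone.
  set G : Matrix (Fin d) (Fin d) ℝ := (Uᵀ * J).updateRow k 0 with hG
  have hdet : G.det = 0 := det_eq_zero_of_row_eq_zero k fun j => by simp [hG]
  obtain ⟨v, hv, hGv⟩ := exists_mulVec_eq_zero_iff.2 hdet
  refine ⟨v, hv, ?_⟩
  set x := J *ᵥ v with hx
  set y := Uᵀ *ᵥ x with hy
  have hy0 : ∀ l, l ≠ k → y l = 0 := by
    intro l hl
    have h1 : (G *ᵥ v) l = 0 := by rw [hGv]; rfl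
    rw [hy, hx, mulVec_mulVec, ← h1]
    simp [hG, mulVec, updateRow_ne hl]
  -- The singular vector equations keep `Dᵀ x'` orthogonal to the range of `V`. Both sides therefore
  -- split orthogonally, with the maximality of `U` bounding the `x'` part.
  set x' := x - U *ᵥ y with hx'
  have hUx' : Uᵀ *ᵥ x' = 0 := by
    rw [hx', mulVec_sub, ← hy, mulVec_mulVec, hU, one_mulVec, sub_self]
  have hxe : x = x' + U *ᵥ y := by rw [hx']; abel
  have hDx : Dᵀ *ᵥ x = Dᵀ *ᵥ x' + V *ᵥ (diagonal s *ᵥ y) := by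
    rw [mulVec_mulVec y V, ← hDU, ← mulVec_mulVec, ← mulVec_add, ← hxe]
  have hVV : ∀ z : Fin d → ℝ, (V *ᵥ z) ⬝ᵥ (V *ᵥ z) = z ⬝ᵥ z := by
    intro z
    rw [dotProduct_mulVec, vecMul_mulVec, hV]; simp
  have hUU : ∀ z : Fin d → ℝ, (U *ᵥ z) ⬝ᵥ (U *ᵥ z) = z ⬝ᵥ z := by
    intro z
    rw [dotProduct_mulVec, vecMul_mulVec, hU]; simp
  have hUc : ∀ z : Fin d → ℝ, x' ⬝ᵥ (U *ᵥ z) = 0 := by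
    intro z
    rw [dotProduct_mulVec, ← mulVec_transpose, hUx', zero_dotProduct]
  have hVc : ∀ z : Fin d → ℝ, (Dᵀ *ᵥ x') ⬝ᵥ (V *ᵥ z) = 0 := by
    intro z
    rw [dotProduct_comm, dotProduct_mulVec, vecMul_transpose, mulVec_mulVec, hDV, ← mulVec_mulVec,
      dotProduct_comm, hUc]
  have hdiag : (diagonal s *ᵥ y) ⬝ᵥ (diagonal s *ᵥ y) = s k ^ 2 * (y ⬝ᵥ y) := by
    simp only [dotProduct, mulVec_diagonal, Finset.mul_sum]
    refine Finset.sum_congr rfl fun l _ => ?_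
    by_cases hl : l = k
    · subst hl; ring
    · rw [hy0 l hl]; ring
  have e1 : (Dᵀ *ᵥ x) ⬝ᵥ (Dᵀ *ᵥ x) = (Dᵀ *ᵥ x') ⬝ᵥ (Dᵀ *ᵥ x') + s k ^ 2 * (y ⬝ᵥ y) := by
    rw [hDx, add_dotProduct, dotProduct_add, dotProduct_add, hVc,
      dotProduct_comm (V *ᵥ _) (Dᵀ *ᵥ x'), hVc, hVV, hdiag]
    ring
  have e2 : x ⬝ᵥ x = x' ⬝ᵥ x' + y ⬝ᵥ y := by
    rw [hxe, add_dotProduct, dotProduct_add, dotProduct_add, hUc,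
      dotProduct_comm (U *ᵥ _) x', hUc, hUU]
    ring
  rw [e1, e2, mul_add]
  linarith [hmax x' hUx' k]

lemma frobNorm_center_le {k : ℕ} (hn : 1 ≤ n) (X : Fin n → Matrix (Fin d) (Fin k) ℝ) :
    frobNorm (stack fun i => X i - (1 / (n : ℝ)) • ∑ j, X j) ≤ frobNorm (stack X) := by
  have hn0 : (0 : ℝ) < n := by exact_mod_cast hn
  refine le_of_sq_le_sq ?_ (frobNorm_nonneg _)
  rw [frobNorm_stack_sq, frobNorm_stack_sq]
  set m := (1 / (n : ℝ)) • ∑ j, X j with hm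
  have hs : ∑ j, X j = (n : ℝ) • m := by rw [hm, smul_smul]; field_simp; simp
  have hsum : ∑ i, frobInner (X i) m = n * frobNorm m ^ 2 := by
    have : ∑ i, frobInner (X i) m = frobInner (∑ i, X i) m := by
      simp only [frobInner, transpose_sum, Matrix.sum_mul, trace_sum]
    rw [this, hs, frobInner_comm, frobInner_smul_right, frobNorm_sq_eq_frobInner]
  simp only [frobNorm_sub_sq, Finset.sum_add_distrib, Finset.sum_sub_distrib, ← Finset.mul_sum,
    hsum]
  simp only [Finset.sum_const, Finset.card_univ, Fintype.card_fin, nsmul_eq_mul]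
  nlinarith [mul_nonneg hn0.le (sq_nonneg (frobNorm m))]

namespace Regime

variable {A : Matrix (Fin d) (Fin m) ℝ} {Z : Fin n → Matrix (Fin d) (Fin m) ℝ} {a s w q : ℝ}

/-- Test with constant stacks `J v`. The signal gives at least `n s ‖v‖`, the noise removes at most
`w √n ‖v‖`, and `‖J v‖ = √n ‖v‖`. -/
lemma singular_lower_bound (h : Regime A Z a s w q) {U : Matrix (Fin n × Fin d) (Fin d) ℝ}
    {V : Matrix (Fin m) (Fin d) ℝ} {t : Fin d → ℝ} (hU : Uᵀ * U = 1) (hV : Vᵀ * V = 1)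
    (ht : ∀ k, 0 ≤ t k) (hDV : stack (fun i => A + Z i) * V = U * diagonal t)
    (hDU : (stack fun i => A + Z i)ᵀ * U = V * diagonal t)
    (hmax : ∀ x : Fin n × Fin d → ℝ, Uᵀ *ᵥ x = 0 → ∀ k,
      ((stack fun i => A + Z i)ᵀ *ᵥ x) ⬝ᵥ ((stack fun i => A + Z i)ᵀ *ᵥ x) ≤ t k ^ 2 * (x ⬝ᵥ x))
    (k : Fin d) : Real.sqrt n * s / 2 ≤ t k := by
  set D := stack fun i => A + Z i with hD
  set J : Matrix (Fin n × Fin d) (Fin d) ℝ := stack fun _ => 1 with hJ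
  obtain ⟨v, hv, hle⟩ := exists_mulVec_sq_le_singular hU hV hDV hDU hmax J k
  -- A vector is turned into a rank one matrix with `d` columns, since that is the form of the noise
  -- bounds.
  set e : Fin d → ℝ := Pi.single k 1 with he
  set Mv := vecMulVec v e with hMv
  set ν := frobNorm Mv with hν
  have hν0 : 0 < ν := by
    have h1 : ν ^ 2 = v ⬝ᵥ v := frobNorm_vecMulVec_single_sq v k
    have h2 : 0 < v ⬝ᵥ v := by
      refine lt_of_le_of_ne (dotProduct_self_nonneg' v) fun h0 => hv ?_
      exact dotProduct_self_eq_zero.1 h0.symm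
    have := frobNorm_nonneg Mv
    rw [← hν] at this
    exact lt_of_le_of_ne this fun h0 => by rw [← h0] at h1; simp at h1; linarith
  have hJv : vecMulVec (J *ᵥ v) e = stack fun _ => Mv := by
    rw [hMv, ← mul_vecMulVec, hJ, stack_mul]; simp
  have hDJ : vecMulVec (Dᵀ *ᵥ (J *ᵥ v)) e = ∑ j, (A + Z j)ᵀ * Mv := by
    rw [← mul_vecMulVec, hJv, hD, stack_transpose_mul]
  have h1 : frobNorm (∑ j, (A + Z j)ᵀ * Mv) ≤ t k * (Real.sqrt n * ν) := by
    refine le_of_sq_le_sq ?_ (mul_nonneg (ht k) (mul_nonneg (Real.sqrt_nonneg _) hν0.le))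
    rw [mul_pow, ← frobNorm_stack_const, ← hJv, ← hDJ, he, frobNorm_vecMulVec_single_sq,
      frobNorm_vecMulVec_single_sq]
    exact hle
  have h2 : n * (s * ν) - w * (Real.sqrt n * ν) ≤ frobNorm (∑ j, (A + Z j)ᵀ * Mv) := by
    have e1 : ∑ j, (A + Z j)ᵀ * Mv = (n : ℝ) • (Aᵀ * Mv) + ∑ j, (Z j)ᵀ * Mv := by
      simp only [transpose_add, Matrix.add_mul, Finset.sum_add_distrib]
      rw [Finset.sum_const, Finset.card_univ, Fintype.card_fin, Nat.cast_smul_eq_nsmul]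
    have e2 := h.noise.transpose_mul_le fun _ => Mv
    rw [frobNorm_stack_const] at e2
    have e3 := mul_frobNorm_le_of_le_mulVec h.le_op Mv
    have e4 := frobNorm_sub_le (∑ j, (A + Z j)ᵀ * Mv) (∑ j, (Z j)ᵀ * Mv)
    rw [e1, add_sub_cancel_right, frobNorm_smul, abs_of_pos h.n_pos, ← e1] at e4
    have e5 := mul_le_mul_of_nonneg_left e3 h.n_pos.le
    linarith
  have hr := h.sqrt_n_pos
  have hrr : Real.sqrt n * Real.sqrt n = n := Real.mul_self_sqrt h.n_pos.le
  have h3 : (Real.sqrt n * s - w) * (Real.sqrt n * ν) ≤ t k * (Real.sqrt n * ν) := by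
    have : (Real.sqrt n * s - w) * (Real.sqrt n * ν)
        = Real.sqrt n * Real.sqrt n * (s * ν) - w * (Real.sqrt n * ν) := by ring
    rw [this, hrr]; linarith
  have h4 := le_of_mul_le_mul_right h3 (by positivity)
  have h5 : w ≤ Real.sqrt n * s / 2 := by
    refine h.w_le'.trans ?_
    have := mul_le_mul_of_nonneg_right h.q_le_s hr.le
    nlinarith [h.s_pos]
  linarith

/-- The spectral initialization is close to a global rotation. -/
lemma spectral_init (h : Regime A Z a s w q) {U : Matrix (Fin n × Fin d) (Fin d) ℝ}
    (hTop : IsTopLeftSingular (stack fun i => A + Z i) U)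
    {T : Fin n → Matrix (Fin d) (Fin d) ℝ} (hT : ∀ i, IsSharpMax 0 (block U i) (T i)) :
    ∃ Q ∈ orthogonalGroup (Fin d) ℝ,
      frobNorm (stack T - stack fun _ => Q) ≤ 8 * (q * Real.sqrt n / s) := by
  obtain ⟨V, t, hU, hV, ht, hDV, hDU, hmax⟩ := hTop
  have htk := h.singular_lower_bound hU hV ht hDV hDU hmax
  have hs := h.s_pos
  have hn := h.n_pos
  set r := Real.sqrt n with hr
  have hr0 : 0 < r := h.sqrt_n_pos
  have hrr : r * r = n := Real.mul_self_sqrt hn.le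
  -- With `r = √n`, `H` is the mean of the rescaled blocks `r U_j`, and `E` is their deviation from
  -- it.
  set H : Matrix (Fin d) (Fin d) ℝ := r⁻¹ • ∑ j, block U j with hH
  set E : Fin n → Matrix (Fin d) (Fin d) ℝ := fun j => r • block U j - H with hE
  have hUdiag : ∀ j, block U j * diagonal t = (A + Z j) * V := by
    intro j
    have e1 : stack (block U) * diagonal t = stack fun j => (A + Z j) * V := by
      rw [stack_block, ← hDV, stack_mul]
    rw [stack_mul] at e1
    have := congrArg (fun X => block X j) e1
    simpa only [block_stack] using this
  -- The signal contributes the same `A V` to every block, so centering cancels it and leaves only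
  -- noise.
  have hEd : ∀ j, E j * diagonal t = r • (Z j * V - (1 / (n : ℝ)) • ∑ i, Z i * V) := by
    intro j
    have e1 : ∑ i, block U i * diagonal t = (n : ℝ) • (A * V) + ∑ i, Z i * V := by
      simp only [hUdiag, Matrix.add_mul, Finset.sum_add_distrib]
      rw [Finset.sum_const, Finset.card_univ, Fintype.card_fin, Nat.cast_smul_eq_nsmul]
    have e2 : r⁻¹ = r * (1 / (n : ℝ)) := by rw [← hrr]; field_simp
    have e3 : r⁻¹ * n = r := by rw [← hrr]; field_simp
    rw [hE, hH, Matrix.sub_mul, Matrix.smul_mul, Matrix.smul_mul, hUdiag, Matrix.sum_mul, e1,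
      smul_add, smul_smul, e3, e2, Matrix.add_mul, smul_sub, smul_add, smul_smul]
    abel
  have hEn : frobNorm (stack E) ≤ 2 * (q * r / s) := by
    have e1 : frobNorm (stack fun j => E j * diagonal t) ≤ r * (q * r) := by
      have e2 : frobNorm (stack fun j => E j * diagonal t)
          ≤ r * frobNorm (stack fun j => Z j * V - (1 / (n : ℝ)) • ∑ i, Z i * V) := by
        refine frobNorm_stack_le hr0.le fun j => ?_
        rw [hEd, frobNorm_smul, abs_of_pos hr0]
      have e3 := frobNorm_center_le h.one_le_n fun j => Z j * V
      have e4 := h.noise.mul_le V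
      have e5 : frobNorm V = Real.sqrt d := by
        rw [← Real.sqrt_sq (frobNorm_nonneg V), frobNorm_sq_of_isometry hV]; simp
      rw [e5, stack_mul] at e4
      exact e2.trans (mul_le_mul_of_nonneg_left (e3.trans (e4.trans h.w_le)) hr0.le)
    have e2 : frobNorm (stack E) ≤ 2 / (r * s) * frobNorm (stack fun j => E j * diagonal t) := by
      refine frobNorm_stack_le (by positivity) fun j => ?_
      have : r * s / 2 * frobNorm (E j) ≤ frobNorm (E j * diagonal t) := by
        refine le_of_sq_le_sq ?_ (frobNorm_nonneg _)
        rw [mul_pow, frobNorm_sq, frobNorm_sq, Finset.mul_sum]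
        refine Finset.sum_le_sum fun x _ => ?_
        rw [Finset.mul_sum]
        refine Finset.sum_le_sum fun y _ => ?_
        rw [mul_diagonal, mul_pow, mul_comm]
        exact mul_le_mul_of_nonneg_left (pow_le_pow_left₀ (by positivity) (htk y) 2)
          (sq_nonneg _)
      calc frobNorm (E j) = 2 / (r * s) * (r * s / 2 * frobNorm (E j)) := by field_simp
        _ ≤ _ := by gcongr
    calc _ ≤ 2 / (r * s) * (r * (q * r)) := e2.trans (by gcongr)
      _ = _ := by field_simp
  -- Orthonormality of `U` turns smallness of `E` into `Hᵀ H ≈ 1`, so `H` has a polar factor close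
  -- to every block.
  have hgram : (stack E)ᵀ * stack E = (n : ℝ) • (1 - Hᵀ * H) := by
    have hUH : ∑ j, block U j = r • H := by
      rw [hH, smul_smul, mul_inv_cancel₀ hr0.ne', one_smul]
    clear_value H
    have hUU : ∑ j, (block U j)ᵀ * block U j = 1 := by
      rw [← stack_transpose_mul, stack_block, hU]
    have e1 : ∀ j, (E j)ᵀ * E j = (n : ℝ) • ((block U j)ᵀ * block U j)
        - r • ((block U j)ᵀ * H) - r • (Hᵀ * block U j) + Hᵀ * H := by
      intro j
      simp only [hE, transpose_sub, transpose_smul, Matrix.sub_mul, Matrix.mul_sub,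
        Matrix.smul_mul, Matrix.mul_smul, smul_sub, smul_smul, hrr]
      abel
    rw [stack_transpose_mul]
    simp only [e1, Finset.sum_add_distrib, Finset.sum_sub_distrib, ← Finset.smul_sum, hUU,
      ← Matrix.mul_sum, ← Matrix.sum_mul, ← transpose_sum, hUH]
    rw [Finset.sum_const, Finset.card_univ, Fintype.card_fin, ← Nat.cast_smul_eq_nsmul ℝ,
      transpose_smul, Matrix.smul_mul, Matrix.mul_smul, smul_smul, hrr, smul_sub, Matrix.mul_smul]
    abel
  have hHcoer : ∀ v : Fin d → ℝ, (1 / 2 : ℝ) ^ 2 * (v ⬝ᵥ v) ≤ (H *ᵥ v) ⬝ᵥ (H *ᵥ v) := by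
    intro v
    have e1 := mulVec_sq_le_frobNorm (stack E) v
    have e2 : (stack E *ᵥ v) ⬝ᵥ (stack E *ᵥ v) = n * (v ⬝ᵥ v - (H *ᵥ v) ⬝ᵥ (H *ᵥ v)) := by
      rw [mulVec_dotProduct_self, mulVec_dotProduct_self, hgram, smul_mulVec, dotProduct_smul,
        sub_mulVec, one_mulVec, dotProduct_sub, smul_eq_mul]
    have e3 : frobNorm (stack E) ^ 2 ≤ n / 2 := by
      have e4 : q * r / s ≤ r / 2000 := by
        rw [div_le_iff₀ hs]
        nlinarith [mul_le_mul_of_nonneg_right h.q_le_s hr0.le]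
      have e5 : frobNorm (stack E) ≤ r / 1000 := by linarith
      have := pow_le_pow_left₀ (frobNorm_nonneg _) e5 2
      nlinarith
    have e4 := mul_le_mul_of_nonneg_right e3 (dotProduct_self_nonneg' v)
    rw [e2] at e1
    have e5 : 0 ≤ n * ((H *ᵥ v) ⬝ᵥ (H *ᵥ v) - 1 / 2 * (v ⬝ᵥ v)) := by linarith
    have e6 := nonneg_of_mul_nonneg_right e5 hn
    have := dotProduct_self_nonneg' v
    linarith
  obtain ⟨Q, hQ⟩ := exists_isPolar (by norm_num) hHcoer
  refine ⟨Q, hQ.1, ?_⟩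
  rw [stack_sub]
  -- The factor `4` is `2 / τ` with `τ = 1 / 2`, the lower bound on the singular values of `H`.
  have h1 : frobNorm (stack fun i => T i - Q) ≤ 4 * frobNorm (stack E) := by
    refine frobNorm_stack_le (by norm_num) fun j => ?_
    have e1 := hQ.isSharpMax.frobNorm_sub_le (by norm_num) ((hT j).smul hr0.le)
    rw [frobNorm_sub_comm, frobNorm_sub_comm H] at e1
    norm_num at e1
    exact e1
  linarith

end Regime
end Spectral

/-! ### Equivariance: undoing the rotations. -/

section Rotation

variable {n d m : ℕ}

/-- The block diagonal matrix with blocks `O i`. -/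
def blockDiag (O : Fin n → Matrix (Fin d) (Fin d) ℝ) :
    Matrix (Fin n × Fin d) (Fin n × Fin d) ℝ :=
  of fun p q => if p.1 = q.1 then O p.1 p.2 q.2 else 0

lemma blockDiag_mul_apply {l : Type*} (O : Fin n → Matrix (Fin d) (Fin d) ℝ)
    (X : Matrix (Fin n × Fin d) l ℝ) (p : Fin n × Fin d) (c : l) :
    (blockDiag O * X) p c = ∑ b, O p.1 p.2 b * X (p.1, b) c := by
  simp [blockDiag, mul_apply, Fintype.sum_prod_type, ite_mul]

lemma blockDiag_mul_stack {k : ℕ} (O : Fin n → Matrix (Fin d) (Fin d) ℝ)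
    (X : Fin n → Matrix (Fin d) (Fin k) ℝ) :
    blockDiag O * stack X = stack fun i => O i * X i := by
  ext p c
  rw [blockDiag_mul_apply]
  simp [stack, mul_apply]

lemma blockDiag_transpose (O : Fin n → Matrix (Fin d) (Fin d) ℝ) :
    (blockDiag O)ᵀ = blockDiag fun i => (O i)ᵀ := by
  ext ⟨i, a⟩ ⟨j, b⟩
  by_cases h : i = j
  · subst h; simp [blockDiag]
  · simp [blockDiag, h, Ne.symm h]

lemma blockDiag_transpose_mul {O : Fin n → Matrix (Fin d) (Fin d) ℝ}
    (hO : ∀ i, O i ∈ orthogonalGroup (Fin d) ℝ) : (blockDiag O)ᵀ * blockDiag O = 1 := by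
  ext ⟨i, a⟩ ⟨j, b⟩
  rw [blockDiag_transpose, blockDiag_mul_apply]
  have h := congrFun (congrFun (orthogonal_transpose_mul (hO i)) a) b
  rw [mul_apply] at h
  by_cases hij : i = j
  · subst hij
    simp only [blockDiag, of_apply, if_true, one_apply, Prod.mk.injEq, true_and] at h ⊢
    exact h
  · simp [blockDiag, hij, one_apply]

lemma IsTopLeftSingular.of_isometry_mul {ι : Type*} [Fintype ι] [DecidableEq ι]
    {P : Matrix ι ι ℝ} (hP : Pᵀ * P = 1) {D : Matrix ι (Fin m) ℝ} {U : Matrix ι (Fin d) ℝ}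
    (h : IsTopLeftSingular (P * D) U) : IsTopLeftSingular D (Pᵀ * U) := by
  have hP' : P * Pᵀ = 1 := mul_eq_one_comm.1 hP
  obtain ⟨V, s, hU, hV, hs, hDV, hDU, hmax⟩ := h
  refine ⟨V, s, ?_, hV, hs, ?_, ?_, fun x hx k => ?_⟩
  · rw [transpose_mul, transpose_transpose, Matrix.mul_assoc, ← Matrix.mul_assoc P, hP',
      Matrix.one_mul, hU]
  · rw [Matrix.mul_assoc, ← hDV, Matrix.mul_assoc, ← Matrix.mul_assoc Pᵀ, hP, Matrix.one_mul]
  · rw [← hDU, transpose_mul, Matrix.mul_assoc]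
  · have h1 := hmax (P *ᵥ x) (by
      rw [transpose_mul, transpose_transpose, ← mulVec_mulVec] at hx
      exact hx) k
    have h2 : (P * D)ᵀ *ᵥ (P *ᵥ x) = Dᵀ *ᵥ x := by
      rw [transpose_mul, mulVec_mulVec, Matrix.mul_assoc, hP, Matrix.mul_one]
    have h3 : (P *ᵥ x) ⬝ᵥ (P *ᵥ x) = x ⬝ᵥ x := by
      rw [dotProduct_mulVec, vecMul_mulVec, hP]; simp
    rwa [h2, h3] at h1

/-- The observations after undoing the rotations. -/
lemma isSharpMax_of_isSpectralGPM {O : Fin n → Matrix (Fin d) (Fin d) ℝ}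
    (hO : ∀ i, O i ∈ orthogonalGroup (Fin d) ℝ) {Y : Fin n → Matrix (Fin d) (Fin m) ℝ}
    {S : ℕ → Fin n → Matrix (Fin d) (Fin d) ℝ} (hS : IsSpectralGPM (fun i => O i * Y i) S) :
    (∃ U : Matrix (Fin n × Fin d) (Fin d) ℝ, IsTopLeftSingular (stack Y) U ∧
      ∀ i, IsSharpMax 0 (block U i) ((O i)ᵀ * S 0 i)) ∧
    ∀ t i, IsSharpMax 0 (Y i * ∑ j, (Y j)ᵀ * ((O j)ᵀ * S t j)) ((O i)ᵀ * S (t + 1) i) := by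
  obtain ⟨⟨U, hU, hS0⟩, hSt⟩ := hS
  refine ⟨⟨(blockDiag O)ᵀ * U, ?_, fun i => ?_⟩, fun t i => ?_⟩
  · rw [← blockDiag_mul_stack] at hU
    exact hU.of_isometry_mul (blockDiag_transpose_mul hO)
  · have e : block ((blockDiag O)ᵀ * U) i = (O i)ᵀ * block U i := by
      rw [blockDiag_transpose, ← stack_block U, blockDiag_mul_stack, block_stack, stack_block]
    rw [e]
    exact (hS0 i).isSharpMax.orthogonal_mul (orthogonal_transpose (hO i))
  · have h := (hSt t i).isSharpMax.orthogonal_mul (orthogonal_transpose (hO i))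
    rw [Matrix.mul_assoc, stack_transpose_mul, stack_mul, block_stack, Matrix.mul_assoc,
      ← Matrix.mul_assoc (O i)ᵀ, orthogonal_transpose_mul (hO i), Matrix.one_mul] at h
    simpa only [transpose_mul, Matrix.mul_assoc] using h

lemma IsLimitPoint.orthogonal_mul {O : Fin n → Matrix (Fin d) (Fin d) ℝ}
    (hO : ∀ i, O i ∈ orthogonalGroup (Fin d) ℝ) {S : ℕ → Fin n → Matrix (Fin d) (Fin d) ℝ}
    {L : Fin n → Matrix (Fin d) (Fin d) ℝ} (h : IsLimitPoint S L) :
    IsLimitPoint (fun t i => O i * S t i) fun i => O i * L i := by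
  refine ⟨fun i => mul_mem (hO i) (h.1 i), ?_⟩
  have e : ∀ t, dF (stack fun i => O i * S t i) (stack fun i => O i * L i)
      = dF (stack (S t)) (stack L) := by
    intro t
    refine congrArg iInf (funext fun Q => ?_)
    rw [stack_sub_mul_apply, stack_sub_mul_apply,
      ← frobNorm_stack_orthogonal_mul hO fun i => S t i - L i * Q.1]
    simp only [Matrix.mul_assoc, Matrix.mul_sub]
  simp only [e]
  exact h.2

end Rotation

/-! ### The deterministic conclusion. -/

namespace Regime

variable {n d m : ℕ} {A : Matrix (Fin d) (Fin m) ℝ} {Z : Fin n → Matrix (Fin d) (Fin m) ℝ}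
  {a s w q : ℝ} {f : Matrix (Fin d) (Fin d) ℝ → Matrix (Fin d) (Fin d) ℝ}

lemma frobNorm_average_noise_le (h : Regime A Z a s w q)
    {B : Fin n → Matrix (Fin d) (Fin d) ℝ} (hB : ∀ i, B i ∈ orthogonalGroup (Fin d) ℝ) :
    frobNorm ((1 / (n : ℝ)) • ∑ i, (B i)ᵀ * Z i) ≤ q := by
  have hn := h.n_pos
  have e : (∑ i, (B i)ᵀ * Z i)ᵀ = ∑ i, (Z i)ᵀ * B i := by
    rw [transpose_sum]; simp [transpose_mul]
  have h1 := h.noise.transpose_mul_le B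
  rw [← e, frobNorm_transpose, frobNorm_stack_orthogonal hB] at h1
  rw [frobNorm_smul, abs_of_pos (by positivity), one_div, inv_mul_le_iff₀ hn]
  calc _ ≤ w * Real.sqrt d * Real.sqrt n := by linarith
    _ ≤ q * Real.sqrt n * Real.sqrt n := mul_le_mul_of_nonneg_right h.w_le h.sqrt_n_pos.le
    _ = n * q := by rw [mul_assoc, Real.mul_self_sqrt hn.le, mul_comm]

lemma frobNorm_average_signal_le (h : Regime A Z a s w q) {η : ℝ}
    {X : Fin n → Matrix (Fin d) (Fin d) ℝ} (hX : ∀ i, frobNorm (X i) ≤ η) :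
    frobNorm ((1 / (n : ℝ)) • ∑ i, X i * A) ≤ a * η := by
  have hn := h.n_pos
  rw [frobNorm_smul, abs_of_pos (by positivity), one_div, inv_mul_le_iff₀ hn]
  refine (frobNorm_sum_le _ _).trans ((Finset.sum_le_sum fun i _ =>
    (frobNorm_mul_le' (X i) A).trans (mul_le_mul h.op_le (hX i) (frobNorm_nonneg _)
      h.a_pos.le)).trans ?_)
  simp

/-- The deterministic part of the convergence theorem. -/
theorem gpm_converges (h : Regime A Z a s w q) (hf : IsTruncatedPolar n A a s f)
    (hd : Decoupled A Z f a w q) {O : Fin n → Matrix (Fin d) (Fin d) ℝ}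
    (hO : ∀ i, O i ∈ orthogonalGroup (Fin d) ℝ)
    {S : ℕ → Fin n → Matrix (Fin d) (Fin d) ℝ}
    (hS : IsSpectralGPM (fun i => O i * (A + Z i)) S) :
    (∃ L, IsLimitPoint S L) ∧ ∀ L, IsLimitPoint S L →
      (∃ Q ∈ orthogonalGroup (Fin d) ℝ, ∀ i, frobNorm (L i - O i * Q) ≤ 7 * (a * q / s ^ 2)) ∧
      (∃ Q ∈ orthogonalGroup (Fin d) ℝ,
        frobNorm ((1 / (n : ℝ)) • ∑ i, (L i)ᵀ * (O i * (A + Z i)) - Q * A)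
          ≤ 8 * (a ^ 2 * q / s ^ 2)) ∧
      ((∀ i, O i = 1) → ∃ Q ∈ orthogonalGroup (Fin d) ℝ,
        frobNorm ((1 / (n : ℝ)) • ∑ i, L i * (O i * (A + Z i)) - Q * A)
          ≤ 8 * (a ^ 2 * q / s ^ 2)) := by
  have ha := h.a_pos
  have hs := h.s_pos
  have hn := h.n_pos
  have hq := h.q_nonneg
  obtain ⟨B, hB⟩ := h.exists_good_fixedPoint hf hd
  have hBo := fun i => (hB i).1.1
  have haq : a * q / s ^ 2 ≤ s ^ 2 / (2000 * a ^ 2) := by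
    rw [div_le_div_iff₀ (by positivity) (by positivity)]
    calc a * q * (2000 * a ^ 2) ≤ a * (s ^ 4 / (2000 * a ^ 3)) * (2000 * a ^ 2) := by
          have := h.q_le; gcongr
      _ = s ^ 2 * s ^ 2 := by field_simp
  have hεe : s ^ 2 / (2000 * a ^ 2) = s ^ 2 / (64 * a ^ 2) * (64 / 2000) := by field_simp
  have hε0 : 0 < s ^ 2 / (64 * a ^ 2) := by positivity
  have hB1 : ∀ i, frobNorm (B i - 1) ≤ s ^ 2 / (64 * a ^ 2) := fun i =>
    (hB i).2.trans (by nlinarith)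
  obtain ⟨⟨U, hU, hT0⟩, hT⟩ := isSharpMax_of_isSpectralGPM hO hS
  -- The start is within `8 q √n / s` of a constant tuple, which is within `7 √n a q / s²` of the
  -- orbit of `B`. Together this is at most `15 · 64 / 2000` of the radius of the basin.
  have hinit : ∃ Q ∈ orthogonalGroup (Fin d) ℝ,
      frobNorm (stack (fun i => (O i)ᵀ * S 0 i) - stack B * Q)
        ≤ s ^ 2 / (64 * a ^ 2) * Real.sqrt n := by
    obtain ⟨Q, hQ, hQle⟩ := h.spectral_init hU hT0
    refine ⟨Q, hQ, ?_⟩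
    have e1 := frobNorm_sub_le_add (stack fun i => (O i)ᵀ * S 0 i) (stack fun _ => Q) (stack B * Q)
    have e2 : frobNorm ((stack fun _ => Q) - stack B * Q) ≤ Real.sqrt n * (7 * (a * q / s ^ 2)) := by
      rw [stack_sub_mul_apply]
      refine frobNorm_stack_le_const (by positivity) fun i => ?_
      have : Q - B i * Q = -((B i - 1) * Q) := by rw [Matrix.sub_mul, Matrix.one_mul]; abel
      rw [this, frobNorm_neg, frobNorm_mul_orthogonal hQ]
      exact (hB i).2
    have e3 : q * Real.sqrt n / s ≤ Real.sqrt n * (a * q / s ^ 2) := by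
      have : q / s ≤ a * q / s ^ 2 := by
        rw [div_le_div_iff₀ hs (by positivity)]
        have := mul_le_mul_of_nonneg_left h.s_le (mul_nonneg hq hs.le)
        nlinarith
      calc _ = Real.sqrt n * (q / s) := by ring
        _ ≤ _ := by gcongr
    have e4 : Real.sqrt n * (a * q / s ^ 2) ≤ Real.sqrt n * (s ^ 2 / (2000 * a ^ 2)) := by gcongr
    rw [hεe] at e4
    have e5 := mul_pos h.sqrt_n_pos hε0
    nlinarith
  have hlimT := h.isLimitPoint_of_gpm (T := fun t i => (O i)ᵀ * S t i) (fun i => (hB i).1) hB1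
    (fun i => (hT0 i).1) hT hinit
  have hlim : IsLimitPoint S fun i => O i * B i := by
    have := hlimT.orthogonal_mul hO
    simpa only [← Matrix.mul_assoc, fun i => orthogonal_mul_transpose (hO i), Matrix.one_mul]
      using this
  refine ⟨⟨_, hlim⟩, fun L hL => ?_⟩
  obtain ⟨Q, hQ, hLQ⟩ := hlim.exists_eq_mul h.one_le_n hL
  -- The averaged estimate has a signal part from the blockwise bound and a noise part `q`, which is
  -- at most `a² q / s²`.
  have hbound : a * (7 * (a * q / s ^ 2)) + q ≤ 8 * (a ^ 2 * q / s ^ 2) := by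
    have e1 : q ≤ a ^ 2 * q / s ^ 2 := by
      rw [le_div_iff₀ (by positivity)]
      have : s ^ 2 ≤ a ^ 2 := pow_le_pow_left₀ hs.le h.s_le 2
      nlinarith
    have e2 : a * (7 * (a * q / s ^ 2)) = 7 * (a ^ 2 * q / s ^ 2) := by ring
    linarith
  have havg : ∀ M : Matrix (Fin d) (Fin m) ℝ, (1 / (n : ℝ)) • ∑ _i : Fin n, M = M := by
    intro M
    rw [Finset.sum_const, Finset.card_univ, Fintype.card_fin, ← Nat.cast_smul_eq_nsmul ℝ,
      smul_smul, one_div, inv_mul_cancel₀ hn.ne', one_smul]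
  refine ⟨⟨Q, hQ, fun i => ?_⟩, ⟨Qᵀ, orthogonal_transpose hQ, ?_⟩, fun hO1 => ⟨Q, hQ, ?_⟩⟩
  · have : L i - O i * Q = O i * ((B i - 1) * Q) := by
      rw [hLQ, Matrix.sub_mul, Matrix.mul_sub, Matrix.one_mul, Matrix.mul_assoc]
    rw [this, frobNorm_orthogonal_mul (hO i), frobNorm_mul_orthogonal hQ]
    exact (hB i).2
  · have e : (1 / (n : ℝ)) • ∑ i, (L i)ᵀ * (O i * (A + Z i)) - Qᵀ * A
        = (1 / (n : ℝ)) • ∑ i, (Qᵀ * (B i - 1)ᵀ) * A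
          + (1 / (n : ℝ)) • ∑ i, (B i * Q)ᵀ * Z i := by
      have e1 : ∀ i, (L i)ᵀ * (O i * (A + Z i))
          = Qᵀ * (B i - 1)ᵀ * A + (B i * Q)ᵀ * Z i + Qᵀ * A := by
        intro i
        have : (L i)ᵀ * O i = Qᵀ * (B i)ᵀ := by
          rw [hLQ, transpose_mul, transpose_mul, Matrix.mul_assoc, Matrix.mul_assoc,
            orthogonal_transpose_mul (hO i), Matrix.mul_one]
        rw [← Matrix.mul_assoc, this, transpose_mul, transpose_sub, transpose_one]
        simp only [Matrix.mul_add, Matrix.mul_sub, Matrix.sub_mul, Matrix.mul_one]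
        abel
      simp only [e1, Finset.sum_add_distrib, smul_add, havg]
      abel
    rw [e]
    refine (frobNorm_add_le _ _).trans ((add_le_add (h.frobNorm_average_signal_le fun i => ?_)
      (h.frobNorm_average_noise_le fun i => mul_mem (hBo i) hQ)).trans hbound)
    rw [frobNorm_orthogonal_mul (orthogonal_transpose hQ), frobNorm_transpose]
    exact (hB i).2
  · have e : (1 / (n : ℝ)) • ∑ i, L i * (O i * (A + Z i)) - Q * A
        = (1 / (n : ℝ)) • ∑ i, ((B i - 1) * Q) * A
          + (1 / (n : ℝ)) • ∑ i, ((B i * Q)ᵀ)ᵀ * Z i := by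
      have e1 : ∀ i, L i * (O i * (A + Z i))
          = (B i - 1) * Q * A + (B i * Q)ᵀᵀ * Z i + Q * A := by
        intro i
        rw [hLQ, hO1, Matrix.one_mul, Matrix.one_mul, transpose_transpose]
        simp only [Matrix.mul_add, Matrix.sub_mul, Matrix.one_mul]
        abel
      simp only [e1, Finset.sum_add_distrib, smul_add, havg]
      abel
    rw [e]
    refine (frobNorm_add_le _ _).trans ((add_le_add (h.frobNorm_average_signal_le fun i => ?_)
      (h.frobNorm_average_noise_le fun i =>
        orthogonal_transpose (mul_mem (hBo i) hQ))).trans hbound)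
    rw [frobNorm_mul_orthogonal hQ]
    exact (hB i).2

end Regime

/-- The matrix whose entries are the coordinates of a vector. -/
def reindexMatrix {J ρ κ : Type*} (e : ρ × κ ≃ J) (w : J → ℝ) : Matrix ρ κ ℝ :=
  of fun a b => w (e (a, b))

lemma continuous_reindexMatrix {J ρ κ : Type*} (e : ρ × κ ≃ J) : Continuous (reindexMatrix e) := by
  refine continuous_pi fun a => continuous_pi fun b => ?_
  exact continuous_apply _

lemma continuous_frobNorm {ρ κ : Type*} [Fintype ρ] [Fintype κ] :
    Continuous (frobNorm : Matrix ρ κ ℝ → ℝ) := by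
  unfold frobNorm; fun_prop

/-! ### Exponential moments of Gaussian vectors and matrices. -/

section Gaussian

/-- The standard Gaussian measure on `J → ℝ`. -/
abbrev gaussianPi (J : Type*) [Fintype J] : Measure (J → ℝ) :=
  Measure.pi fun _ => gaussianReal 0 1

variable {J K : Type*} [Fintype J] [Fintype K]

lemma lintegral_prod_gaussianPi {g : J → ℝ → ℝ} (hg : ∀ j x, 0 ≤ g j x)
    (hi : ∀ j, Integrable (g j) (gaussianReal 0 1)) :
    ∫⁻ w, ENNReal.ofReal (∏ j, g j (w j)) ∂gaussianPi J
      = ENNReal.ofReal (∏ j, ∫ x, g j x ∂gaussianReal 0 1) := by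
  rw [← ofReal_integral_eq_lintegral_ofReal (Integrable.fintype_prod_dep hi)
    (Eventually.of_forall fun w => Finset.prod_nonneg fun j _ => hg j (w j)),
    integral_fintype_prod_eq_prod]

lemma lintegral_exp_sum_gaussianPi (c : J → ℝ) :
    ∫⁻ w, ENNReal.ofReal (Real.exp (∑ j, c j * w j)) ∂gaussianPi J
      = ENNReal.ofReal (Real.exp ((∑ j, c j ^ 2) / 2)) := by
  have h := lintegral_prod_gaussianPi (J := J) (g := fun j x => Real.exp (c j * x))
    (fun _ _ => (Real.exp_pos _).le) (fun j => integrable_exp_mul_gaussianReal (c j))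
  have h2 : ∀ j, ∫ x, Real.exp (c j * x) ∂gaussianReal 0 1 = Real.exp (c j ^ 2 / 2) := by
    intro j
    have := mgf_gaussianReal (p := gaussianReal 0 1) (X := id) (μ := 0) (v := 1)
      (by simp) (c j)
    simpa [mgf] using this
  simp only [← Real.exp_sum, h2] at h
  rw [h, Finset.sum_div]

/-- The weight `exp (x² / 4)` turns the standard density into `√2` times the density of variance
`2`. -/
lemma hasIntegral_exp_sq_gaussianReal :
    Integrable (fun x : ℝ => Real.exp (x ^ 2 / 4)) (gaussianReal 0 1) ∧
      ∫ x, Real.exp (x ^ 2 / 4) ∂gaussianReal 0 1 = Real.sqrt 2 := by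
  have hpdf : ∀ x : ℝ, gaussianPDFReal 0 1 x * Real.exp (x ^ 2 / 4)
      = Real.sqrt 2 * gaussianPDFReal 0 2 x := by
    intro x
    simp only [gaussianPDFReal, NNReal.coe_one, NNReal.coe_ofNat, sub_zero, mul_one]
    have h1 : Real.sqrt (2 * Real.pi * 2) = Real.sqrt (2 * Real.pi) * Real.sqrt 2 :=
      Real.sqrt_mul (by positivity) _
    have h2 : Real.exp (-x ^ 2 / 2) * Real.exp (x ^ 2 / 4) = Real.exp (-x ^ 2 / (2 * 2)) := by
      rw [← Real.exp_add]; congr 1; ring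
    rw [h1, mul_assoc, h2]
    have := Real.sqrt_pos.2 Real.pi_pos
    field_simp
  have hi : Integrable (fun x : ℝ => gaussianPDFReal 0 1 x * Real.exp (x ^ 2 / 4)) := by
    simp only [hpdf]
    exact (integrable_gaussianPDFReal 0 2).const_mul _
  constructor
  · rw [gaussianReal_of_var_ne_zero 0 one_ne_zero]
    rw [integrable_withDensity_iff_integrable_smul' (measurable_gaussianPDF 0 1)
      (Eventually.of_forall fun x => gaussianPDF_lt_top)]
    simpa only [toReal_gaussianPDF, smul_eq_mul] using hi
  · rw [integral_gaussianReal_eq_integral_smul one_ne_zero]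
    simp only [smul_eq_mul, hpdf]
    rw [integral_const_mul, integral_gaussianPDFReal_eq_one 0 two_ne_zero, mul_one]

/-- The exponential moment of the squared norm of a contraction of a Gaussian vector. -/
lemma lintegral_exp_sq_mulVec_le (T : Matrix K J ℝ)
    (hT : ∀ h : K → ℝ, (Tᵀ *ᵥ h) ⬝ᵥ (Tᵀ *ᵥ h) ≤ h ⬝ᵥ h) :
    ∫⁻ w, ENNReal.ofReal (Real.exp ((T *ᵥ w) ⬝ᵥ (T *ᵥ w) / 4)) ∂gaussianPi J
      ≤ ENNReal.ofReal (Real.sqrt 2 ^ Fintype.card K) := by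
  -- Linearize the square by an auxiliary Gaussian: `exp (|y|² / 4) = E_h exp (⟨y, h⟩ / √2)`. After
  -- exchanging the integrals, the contraction moves onto `h`, and the moment factors over
  -- coordinates.
  set r : ℝ := (Real.sqrt 2)⁻¹ with hr
  have hrr : r ^ 2 = 1 / 2 := by rw [hr, inv_pow, Real.sq_sqrt (by norm_num)]; norm_num
  have hsq : ∀ x : ℝ, (r * x) ^ 2 = 1 / 2 * (x * x) := fun x => by rw [mul_pow, hrr]; ring
  have h1 : ∀ y : K → ℝ, ENNReal.ofReal (Real.exp (y ⬝ᵥ y / 4))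
      = ∫⁻ h, ENNReal.ofReal (Real.exp (r * (y ⬝ᵥ h))) ∂gaussianPi K := by
    intro y
    have := lintegral_exp_sum_gaussianPi (J := K) fun k => r * y k
    have e1 : ∀ h : K → ℝ, ∑ k, r * y k * h k = r * (y ⬝ᵥ h) := fun h => by
      simp only [dotProduct, Finset.mul_sum, mul_assoc]
    have e2 : (∑ k, (r * y k) ^ 2) / 2 = y ⬝ᵥ y / 4 := by
      simp only [hsq, ← Finset.mul_sum, dotProduct]; ring
    rw [e2] at this
    simp only [e1] at this
    exact this.symm
  have h2 : ∀ h : K → ℝ, ∫⁻ w, ENNReal.ofReal (Real.exp (r * ((T *ᵥ w) ⬝ᵥ h))) ∂gaussianPi J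
      ≤ ENNReal.ofReal (∏ k, Real.exp (h k ^ 2 / 4)) := by
    intro h
    have := lintegral_exp_sum_gaussianPi (J := J) fun j => r * (Tᵀ *ᵥ h) j
    have e1 : ∀ w : J → ℝ, ∑ j, r * (Tᵀ *ᵥ h) j * w j = r * ((T *ᵥ w) ⬝ᵥ h) := fun w => by
      have : (T *ᵥ w) ⬝ᵥ h = (Tᵀ *ᵥ h) ⬝ᵥ w := by
        rw [dotProduct_comm, dotProduct_mulVec, mulVec_transpose]
      rw [this]
      simp only [dotProduct, Finset.mul_sum, mul_assoc]
    have e2 : (∑ j, (r * (Tᵀ *ᵥ h) j) ^ 2) / 2 = (Tᵀ *ᵥ h) ⬝ᵥ (Tᵀ *ᵥ h) / 4 := by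
      simp only [hsq, ← Finset.mul_sum, dotProduct]; ring
    simp only [e1, e2] at this
    rw [this, ← Real.exp_sum]
    refine ENNReal.ofReal_le_ofReal (Real.exp_le_exp.2 ?_)
    rw [← Finset.sum_div]
    have := hT h
    have e3 : h ⬝ᵥ h = ∑ k, h k ^ 2 := by simp [dotProduct, sq]
    linarith
  simp only [h1]
  rw [lintegral_lintegral_swap]
  · refine (lintegral_mono h2).trans ?_
    rw [lintegral_prod_gaussianPi (g := fun _ x => Real.exp (x ^ 2 / 4))
      (fun _ _ => (Real.exp_pos _).le) fun _ => hasIntegral_exp_sq_gaussianReal.1]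
    simp [hasIntegral_exp_sq_gaussianReal.2]
  · refine Measurable.aemeasurable (Continuous.measurable ?_)
    unfold Function.uncurry
    dsimp only
    exact ENNReal.continuous_ofReal.comp (Real.continuous_exp.comp (by
      simp only [dotProduct, mulVec]; fun_prop))

variable {ρ κ : Type*} [Fintype ρ] [DecidableEq ρ] [Fintype κ]

lemma lintegral_exp_sq_reindexMatrix_le (e : ρ × κ ≃ J) {u : κ → ℝ} (hu : u ⬝ᵥ u ≤ 1) :
    ∫⁻ w, ENNReal.ofReal (Real.exp
      ((reindexMatrix e w *ᵥ u) ⬝ᵥ (reindexMatrix e w *ᵥ u) / 4)) ∂gaussianPi J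
      ≤ ENNReal.ofReal (Real.sqrt 2 ^ Fintype.card ρ) := by
  set T : Matrix ρ J ℝ := of fun a j => if (e.symm j).1 = a then u (e.symm j).2 else 0 with hT
  have h1 : ∀ w, reindexMatrix e w *ᵥ u = T *ᵥ w := by
    intro w
    ext a
    simp only [mulVec, dotProduct, reindexMatrix, hT, of_apply]
    rw [← e.sum_comp, Fintype.sum_prod_type, Finset.sum_eq_single a]
    · simp [mul_comm]
    · intro a' _ ha'; simp [ha']
    · simp
  simp only [h1]
  refine lintegral_exp_sq_mulVec_le T fun h => ?_
  have h2 : ∀ j, (Tᵀ *ᵥ h) j = h (e.symm j).1 * u (e.symm j).2 := by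
    intro j
    simp only [mulVec, dotProduct, transpose_apply, hT, of_apply, ite_mul, zero_mul]
    rw [Finset.sum_ite_eq]; simp [mul_comm]
  have h3 : (Tᵀ *ᵥ h) ⬝ᵥ (Tᵀ *ᵥ h) = (h ⬝ᵥ h) * (u ⬝ᵥ u) := by
    simp only [dotProduct, h2]
    rw [← e.sum_comp, Fintype.sum_prod_type, Finset.sum_mul_sum]
    refine Finset.sum_congr rfl fun a _ => Finset.sum_congr rfl fun b _ => ?_
    simp only [Equiv.symm_apply_apply]; ring
  rw [h3]
  exact mul_le_of_le_one_right (dotProduct_self_nonneg' h) hu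

/-- Tail bound for the Frobenius norm of a Gaussian matrix times a fixed matrix. -/
lemma gaussianPi_mul_tail {l : Type*} [Fintype l] (e : ρ × κ ≃ J) (B : Matrix κ l ℝ) {t : ℝ}
    (ht : 0 ≤ t) :
    gaussianPi J {w | t * frobNorm B < frobNorm (reindexMatrix e w * B)}
      ≤ ENNReal.ofReal (Real.sqrt 2 ^ Fintype.card ρ * Real.exp (-(t ^ 2 / 4))) := by
  rcases (frobNorm_nonneg B).eq_or_lt with h0 | h0
  · have : {w : J → ℝ | t * frobNorm B < frobNorm (reindexMatrix e w * B)} = ∅ := by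
      ext w
      simp [frobNorm_eq_zero h0.symm]
    rw [this]; simp
  set β := fun c => Real.sqrt ((fun b => B b c) ⬝ᵥ fun b => B b c) with hβ
  have hβ2 : ∀ c, β c ^ 2 = (fun b => B b c) ⬝ᵥ fun b => B b c := fun c =>
    Real.sq_sqrt (dotProduct_self_nonneg' _)
  set u : l → κ → ℝ := fun c => (β c)⁻¹ • fun b => B b c with hu
  have huu : ∀ c, u c ⬝ᵥ u c ≤ 1 := by
    intro c
    rw [hu, smul_dotProduct, dotProduct_smul, ← hβ2, smul_eq_mul, smul_eq_mul]
    by_cases hc : β c = 0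
    · simp [hc]
    · field_simp; exact le_rfl
  have hBu : ∀ c, (fun b => B b c) = β c • u c := by
    intro c
    by_cases hc : β c = 0
    · have := hβ2 c
      rw [hc] at this
      have h2 := dotProduct_self_eq_zero.1 (this.symm.trans (by norm_num))
      rw [h2, hc, zero_smul]
    · rw [hu, smul_smul, mul_inv_cancel₀ hc, one_smul]
  have hsum : ∑ c, β c ^ 2 = frobNorm B ^ 2 := by
    rw [frobNorm_sq_eq_sum_col]; simp only [hβ2]
  -- The squared norm is a convex combination, with these weights, over the normalized columns of
  -- `B`. Jensen's inequality for `exp` gives a bound that does not depend on the number of columns.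
  set p : l → ℝ := fun c => β c ^ 2 / frobNorm B ^ 2 with hp
  have hp0 : ∀ c, 0 ≤ p c := fun c => by positivity
  have hp1 : ∑ c, p c = 1 := by rw [hp, ← Finset.sum_div, hsum, div_self (by positivity)]
  set q : (J → ℝ) → l → ℝ := fun w c =>
    (reindexMatrix e w *ᵥ u c) ⬝ᵥ (reindexMatrix e w *ᵥ u c) / 4 with hq
  have hW : ∀ w, frobNorm (reindexMatrix e w * B) ^ 2 / (4 * frobNorm B ^ 2)
      = ∑ c, p c * q w c := by
    intro w
    rw [frobNorm_sq_eq_sum_col, Finset.sum_div]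
    refine Finset.sum_congr rfl fun c _ => ?_
    have : (fun a => (reindexMatrix e w * B) a c) = β c • (reindexMatrix e w *ᵥ u c) := by
      rw [← mulVec_smul, ← hBu]; rfl
    rw [this, smul_dotProduct, dotProduct_smul, smul_eq_mul, smul_eq_mul, hp, hq]
    field_simp
  have hpt : ∀ w, ENNReal.ofReal (Real.exp
      (frobNorm (reindexMatrix e w * B) ^ 2 / (4 * frobNorm B ^ 2)))
      ≤ ∑ c, ENNReal.ofReal (p c) * ENNReal.ofReal (Real.exp (q w c)) := by
    intro w
    have h := convexOn_exp.map_sum_le (t := Finset.univ) (w := p) (p := q w)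
      (fun c _ => hp0 c) hp1 (fun _ _ => Set.mem_univ _)
    simp only [smul_eq_mul] at h
    rw [hW]
    refine (ENNReal.ofReal_le_ofReal h).trans_eq ?_
    rw [ENNReal.ofReal_sum_of_nonneg fun c _ => mul_nonneg (hp0 c) (Real.exp_pos _).le]
    exact Finset.sum_congr rfl fun c _ => ENNReal.ofReal_mul (hp0 c)
  have hqm : ∀ c, Measurable fun w => ENNReal.ofReal (Real.exp (q w c)) := by
    intro c
    refine (ENNReal.continuous_ofReal.comp (Real.continuous_exp.comp ?_)).measurable
    simp only [hq, dotProduct, mulVec, reindexMatrix, of_apply]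
    fun_prop
  have hint : ∫⁻ w, ENNReal.ofReal (Real.exp
      (frobNorm (reindexMatrix e w * B) ^ 2 / (4 * frobNorm B ^ 2))) ∂gaussianPi J
      ≤ ENNReal.ofReal (Real.sqrt 2 ^ Fintype.card ρ) := by
    refine (lintegral_mono hpt).trans ?_
    rw [lintegral_finsetSum _ fun c _ => (hqm c).const_mul _]
    simp only [lintegral_const_mul _ (hqm _)]
    refine (Finset.sum_le_sum fun c _ => mul_le_mul_right
      (lintegral_exp_sq_reindexMatrix_le e (huu c)) _).trans ?_
    rw [← Finset.sum_mul, ← ENNReal.ofReal_sum_of_nonneg fun c _ => hp0 c, hp1]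
    simp
  have hsub : {w : J → ℝ | t * frobNorm B < frobNorm (reindexMatrix e w * B)} ⊆
      {w | ENNReal.ofReal (Real.exp (t ^ 2 / 4)) ≤ ENNReal.ofReal (Real.exp
        (frobNorm (reindexMatrix e w * B) ^ 2 / (4 * frobNorm B ^ 2)))} := by
    intro w hw
    refine ENNReal.ofReal_le_ofReal (Real.exp_le_exp.2 ?_)
    have hw' : t * frobNorm B < frobNorm (reindexMatrix e w * B) := hw
    have h1 := pow_le_pow_left₀ (by positivity) hw'.le 2
    rw [mul_pow] at h1
    rw [div_le_div_iff₀ (by norm_num) (by positivity)]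
    linarith
  have hmeas : Measurable fun w : J → ℝ => ENNReal.ofReal (Real.exp
      (frobNorm (reindexMatrix e w * B) ^ 2 / (4 * frobNorm B ^ 2))) := by
    refine (ENNReal.continuous_ofReal.comp (Real.continuous_exp.comp ?_)).measurable
    refine ((continuous_frobNorm.comp ?_).pow 2).div_const _
    exact (continuous_reindexMatrix e).matrix_mul continuous_const
  refine (measure_mono hsub).trans ((meas_ge_le_lintegral_div hmeas.aemeasurable
    (by simp [Real.exp_pos]) ENNReal.ofReal_ne_top).trans ?_)
  rw [Real.exp_neg, ← div_eq_mul_inv, ENNReal.ofReal_div_of_pos (Real.exp_pos _)]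
  exact ENNReal.div_le_div_right hint _

end Gaussian

/-! ### Operator norm and conditional tail bounds. -/

section Tails

variable {J ρ κ l : Type*} [Fintype J] [Fintype ρ] [DecidableEq ρ] [Fintype κ] [Fintype l]

/-- Tail bound for the operator norm of a Gaussian matrix. -/
lemma gaussianPi_opNorm_tail [DecidableEq κ] (e : ρ × κ ≃ J) {t : ℝ} (ht : 0 ≤ t) :
    gaussianPi J {w | t < opNorm (reindexMatrix e w)}
      ≤ ENNReal.ofReal (Real.sqrt 2 ^ Fintype.card ρ * (8 ^ Fintype.card κ *
          Real.exp (-(t ^ 2 / 64)))) := by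
  set V : ENNReal := volume (Metric.ball (0 : EuclideanSpace ℝ κ) 1) with hV
  have hV0 : V ≠ 0 := (Metric.measure_ball_pos volume _ one_pos).ne'
  have hVt : V ≠ ⊤ := measure_ball_lt_top.ne
  set F : (J → ℝ) → EuclideanSpace ℝ κ → ENNReal := fun w x => ENNReal.ofReal (Real.exp
    ((reindexMatrix e w *ᵥ x.ofLp) ⬝ᵥ (reindexMatrix e w *ᵥ x.ofLp) / 4)) with hF
  -- Averaging the exponential moment over the unit ball replaces a net. A large operator norm makes
  -- the integrand large on a ball of radius `1 / 8`, whose share of the volume gives the factor `8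
  -- ^ card κ`.
  set Φ : (J → ℝ) → ENNReal := fun w => ∫⁻ x in Metric.ball 0 1, F w x with hΦ
  have hFm : Measurable (Function.uncurry F) := by
    refine Continuous.measurable ?_
    unfold Function.uncurry
    refine ENNReal.continuous_ofReal.comp (Real.continuous_exp.comp ?_)
    simp only [dotProduct, mulVec, reindexMatrix, of_apply]
    fun_prop
  have hint : ∫⁻ w, Φ w ∂gaussianPi J ≤ ENNReal.ofReal (Real.sqrt 2 ^ Fintype.card ρ) * V := by
    rw [hΦ, lintegral_lintegral_swap hFm.aemeasurable]
    calc _ ≤ ∫⁻ _x in Metric.ball (0 : EuclideanSpace ℝ κ) 1,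
            ENNReal.ofReal (Real.sqrt 2 ^ Fintype.card ρ) := by
          refine setLIntegral_mono' measurableSet_ball fun x hx => ?_
          refine lintegral_exp_sq_reindexMatrix_le e ?_
          rw [mem_ball_zero_iff] at hx
          rw [dotProduct_self_eq_norm]
          exact pow_le_one₀ (norm_nonneg _) hx.le
      _ = _ := by rw [setLIntegral_const]
  set θ : ENNReal := ENNReal.ofReal (Real.exp (t ^ 2 / 64) * (1 / 8) ^ Fintype.card κ) with hθ
  have hlow : ∀ w, t < opNorm (reindexMatrix e w) → θ * V ≤ Φ w := by
    intro w hw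
    set T := LinearMap.toContinuousLinearMap (Matrix.toEuclideanLin (reindexMatrix e w)) with hT
    have hLe : opNorm (reindexMatrix e w) = ‖T‖ := rfl
    rw [hLe] at hw
    have hL : 0 < ‖T‖ := ht.trans_lt hw
    obtain ⟨x, hx, hTx⟩ := T.exists_lt_apply_of_lt_opNorm (show 3 / 4 * ‖T‖ < ‖T‖ by linarith)
    -- Halving the near-maximizer leaves room for the small ball inside the unit ball. On it `‖T u‖`
    -- is at least `(3 / 8 - 1 / 8) ‖T‖`, so the exponent is at least `t² / 64`.
    set c : EuclideanSpace ℝ κ := (1 / 2 : ℝ) • x with hc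
    have hcn : ‖c‖ < 1 / 2 := by
      rw [hc, norm_smul]; norm_num; linarith
    have hTc : 3 / 8 * ‖T‖ < ‖T c‖ := by
      rw [hc, map_smul, norm_smul]; norm_num; linarith
    have hsub : Metric.ball c (1 / 8) ⊆ Metric.ball 0 1 :=
      Metric.ball_subset_ball' (by rw [dist_zero_right]; linarith)
    have hFu : ∀ u ∈ Metric.ball c (1 / 8), ENNReal.ofReal (Real.exp (t ^ 2 / 64)) ≤ F w u := by
      intro u hu
      rw [mem_ball_iff_norm] at hu
      have h1 : ‖T c‖ ≤ ‖T u‖ + ‖T‖ * ‖u - c‖ := by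
        have e1 := norm_sub_norm_le (T c) (T u)
        have e2 := T.le_opNorm (u - c)
        rw [map_sub, norm_sub_rev] at e2
        linarith
      have h2 : ‖T‖ / 4 ≤ ‖T u‖ := by nlinarith
      refine ENNReal.ofReal_le_ofReal (Real.exp_le_exp.2 ?_)
      have h3 : (reindexMatrix e w *ᵥ u.ofLp) ⬝ᵥ (reindexMatrix e w *ᵥ u.ofLp) = ‖T u‖ ^ 2 := by
        rw [dotProduct_self_eq_norm]; rfl
      rw [h3]
      nlinarith
    calc θ * V = ∫⁻ _x in Metric.ball c (1 / 8), ENNReal.ofReal (Real.exp (t ^ 2 / 64)) := by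
          rw [setLIntegral_const, Measure.addHaar_ball_of_pos volume c (by norm_num), hθ,
            ENNReal.ofReal_mul (Real.exp_pos _).le, finrank_euclideanSpace, mul_assoc]
      _ ≤ ∫⁻ x in Metric.ball c (1 / 8), F w x := setLIntegral_mono' measurableSet_ball hFu
      _ ≤ Φ w := lintegral_mono_set hsub
  have hΦm : Measurable Φ := hFm.lintegral_prod_right'
  have h1 := (mul_meas_ge_le_lintegral hΦm (θ * V) (μ := gaussianPi J)).trans hint
  rw [mul_right_comm] at h1
  have h2 := (ENNReal.mul_le_mul_iff_left hV0 hVt).1 h1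
  have hθ0 : 0 < Real.exp (t ^ 2 / 64) * (1 / 8) ^ Fintype.card κ := by positivity
  have h3 : gaussianPi J {w | θ * V ≤ Φ w}
      ≤ ENNReal.ofReal (Real.sqrt 2 ^ Fintype.card ρ) / θ := by
    rw [ENNReal.le_div_iff_mul_le (Or.inl (by simpa [hθ] using hθ0))
      (Or.inl ENNReal.ofReal_ne_top), mul_comm]
    exact h2
  refine (measure_mono fun w hw => hlow w hw).trans (h3.trans_eq ?_)
  rw [hθ, ← ENNReal.ofReal_div_of_pos hθ0, Real.exp_neg, div_pow, one_pow]
  congr 1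
  field_simp

/-- Tail bound for a Gaussian matrix times a matrix that depends only on the other
coordinates. -/
lemma gaussianPi_mul_tail_of_indep {p : J → Prop} [DecidablePred p] (e : ρ × κ ≃ {j // p j})
    {B : (J → ℝ) → Matrix κ l ℝ} (hB : Continuous B)
    (hindep : ∀ w w', (∀ j, ¬ p j → w j = w' j) → B w = B w') {t : ℝ} (ht : 0 ≤ t) :
    gaussianPi J {w | t * frobNorm (B w) <
        frobNorm ((of fun a b => w (e (a, b)) : Matrix ρ κ ℝ) * B w)}
      ≤ ENNReal.ofReal (Real.sqrt 2 ^ Fintype.card ρ * Real.exp (-(t ^ 2 / 4))) := by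
  set S : Set (J → ℝ) := {w | t * frobNorm (B w) <
        frobNorm ((of fun a b => w (e (a, b)) : Matrix ρ κ ℝ) * B w)} with hS
  have hSm : MeasurableSet S := by
    refine (isOpen_lt (continuous_const.mul (continuous_frobNorm.comp hB))
      (continuous_frobNorm.comp (Continuous.matrix_mul ?_ hB))).measurableSet
    exact continuous_pi fun a => continuous_pi fun b => continuous_apply _
  -- Fubini: with the other coordinates frozen, `B` is a fixed matrix. Its value may be computed
  -- with zeros in the block's own coordinates.
  set Ψ := MeasurableEquiv.piEquivPiSubtypeProd (fun _ : J => ℝ) p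
  have hmp := (measurePreserving_piEquivPiSubtypeProd (fun _ : J => gaussianReal 0 1) p).symm
  have hval : ∀ x y (j : J) (hj : p j), Ψ.symm (x, y) j = x ⟨j, hj⟩ := by
    intro x y j hj
    simp [Ψ, MeasurableEquiv.piEquivPiSubtypeProd, Equiv.piEquivPiSubtypeProd, hj]
  have hval' : ∀ x y (j : J) (hj : ¬ p j), Ψ.symm (x, y) j = y ⟨j, hj⟩ := by
    intro x y j hj
    simp [Ψ, MeasurableEquiv.piEquivPiSubtypeProd, Equiv.piEquivPiSubtypeProd, hj]
  rw [← hmp.measure_preimage hSm.nullMeasurableSet, Measure.prod_apply_symm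
    (Ψ.symm.measurable hSm)]
  refine (lintegral_mono fun y => ?_).trans_eq (b := ∫⁻ _y, ENNReal.ofReal
    (Real.sqrt 2 ^ Fintype.card ρ * Real.exp (-(t ^ 2 / 4)))
      ∂gaussianPi {j // ¬ p j}) (by simp)
  refine le_trans (measure_mono fun x hx => ?_)
    (gaussianPi_mul_tail e (B (Ψ.symm (0, y))) ht)
  have hBx : B (Ψ.symm (x, y)) = B (Ψ.symm (0, y)) := hindep _ _ fun j hj => by
    rw [hval' _ _ _ hj, hval' _ _ _ hj]
  have hNx : (of fun a b => Ψ.symm (x, y) (e (a, b)) : Matrix ρ κ ℝ) = reindexMatrix e x := by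
    ext a b
    simp only [of_apply, reindexMatrix]
    rw [hval _ _ _ (e (a, b)).2]
  have hx' : t * frobNorm (B (Ψ.symm (x, y))) <
      frobNorm ((of fun a b => Ψ.symm (x, y) (e (a, b)) : Matrix ρ κ ℝ) * B (Ψ.symm (x, y))) := hx
  rw [hBx, hNx] at hx'
  exact hx'

end Tails

/-! ### Continuity of the leave-one-out iterates in the noise. -/

section Continuity

variable {n d m : ℕ}

lemma continuous_of_frobNorm_sub_le {f : Matrix (Fin d) (Fin d) ℝ → Matrix (Fin d) (Fin d) ℝ}
    {K : ℝ} (hf : ∀ X Y, frobNorm (f X - f Y) ≤ K * frobNorm (X - Y)) : Continuous f := by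
  refine continuous_pi fun i => continuous_pi fun j => continuous_iff_continuousAt.2 fun X => ?_
  rw [ContinuousAt, tendsto_iff_dist_tendsto_zero]
  have h : Continuous fun Y : Matrix (Fin d) (Fin d) ℝ => K * frobNorm (Y - X) :=
    continuous_const.mul (continuous_frobNorm.comp (continuous_id.sub continuous_const))
  have h0 := h.tendsto X
  simp only [sub_self, frobNorm_zero, mul_zero] at h0
  refine squeeze_zero (fun _ => dist_nonneg) (fun Y => ?_) h0
  rw [Real.dist_eq]
  exact (abs_apply_le_frobNorm (f Y - f X) i j).trans (hf Y X)

lemma continuous_symAggregate {α : Type*} [TopologicalSpace α] (A : Matrix (Fin d) (Fin m) ℝ)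
    {Z : α → Fin n → Matrix (Fin d) (Fin m) ℝ} {S : α → Fin n → Matrix (Fin d) (Fin d) ℝ}
    (hZ : Continuous Z) (hS : Continuous S) : Continuous fun x => symAggregate A (Z x) (S x) := by
  have hZi : ∀ i, Continuous fun x => Z x i := fun i => (continuous_apply i).comp hZ
  have hSi : ∀ i, Continuous fun x => S x i := fun i => (continuous_apply i).comp hS
  have hsum : Continuous fun x => ∑ j, S x j := continuous_finsetSum _ fun i _ => hSi i
  have hsym : Continuous fun x => symPart (∑ j, S x j) :=
    (hsum.add hsum.matrix_transpose).const_smul (1 / 2 : ℝ)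
  refine (continuous_const.matrix_mul hsym).add ?_
  exact continuous_finsetSum _ fun i _ => (hZi i).matrix_transpose.matrix_mul (hSi i)

lemma continuous_symStep_iterate {α : Type*} [TopologicalSpace α]
    {f : Matrix (Fin d) (Fin d) ℝ → Matrix (Fin d) (Fin d) ℝ} (hf : Continuous f)
    (A : Matrix (Fin d) (Fin m) ℝ) {Z : α → Fin n → Matrix (Fin d) (Fin m) ℝ} (hZ : Continuous Z)
    (k : ℕ) : Continuous fun x => (symStep f A (Z x))^[k] 1 := by
  induction k with
  | zero => exact continuous_const
  | succ k ih =>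
    simp only [Function.iterate_succ_apply']
    refine continuous_pi fun i => hf.comp ((continuous_const.add
      ((continuous_apply i).comp hZ)).matrix_mul (continuous_symAggregate A hZ ih))

end Continuity

/-! ### The high-probability event. -/

section Events

variable {n d m : ℕ}

/-- The noise blocks encoded by a vector of coordinates. -/
def noiseBlock (w : Fin n × Fin d × Fin m → ℝ) (i : Fin n) : Matrix (Fin d) (Fin m) ℝ :=
  of fun a b => w (i, a, b)

lemma continuous_noiseBlock :
    Continuous (noiseBlock : (Fin n × Fin d × Fin m → ℝ) → Fin n → Matrix (Fin d) (Fin m) ℝ) :=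
  continuous_pi fun _ => continuous_pi fun _ => continuous_pi fun _ => continuous_apply _

/-- The noise after undoing the rotations. -/
def rotatedNoise (O : Fin n → Matrix (Fin d) (Fin d) ℝ) (σ : ℝ)
    (W : Fin n → Matrix (Fin d) (Fin m) ℝ) (i : Fin n) : Matrix (Fin d) (Fin m) ℝ :=
  (O i)ᵀ * (σ • W i)

/-- The noise aggregate of the iterate that does not use the `i`-th observation. -/
def leaveOneOut (f : Matrix (Fin d) (Fin d) ℝ → Matrix (Fin d) (Fin d) ℝ)
    (A : Matrix (Fin d) (Fin m) ℝ) (Z : Fin n → Matrix (Fin d) (Fin m) ℝ) (i : Fin n) :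
    Matrix (Fin m) (Fin d) ℝ :=
  ∑ j, (Function.update Z i 0 j)ᵀ * (symStep f A (Function.update Z i 0))^[n] 1 j

/-- The indices of the coordinates of the `i`-th noise block. -/
def blockEquiv (n d m : ℕ) (i : Fin n) :
    Fin d × Fin m ≃ {q : Fin n × Fin d × Fin m // q.1 = i} where
  toFun p := ⟨(i, p), rfl⟩
  invFun q := q.1.2
  left_inv _ := rfl
  right_inv := by rintro ⟨⟨_, _⟩, rfl⟩; rfl

/-- Tail bound for a noise block times a matrix that depends only on the other blocks. -/
lemma noiseBlock_mul_tail {l : Type*} [Fintype l] (i : Fin n)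
    {B : (Fin n × Fin d × Fin m → ℝ) → Matrix (Fin m) l ℝ} (hB : Continuous B)
    (hindep : ∀ w w', (∀ j, j ≠ i → noiseBlock w j = noiseBlock w' j) → B w = B w')
    {t : ℝ} (ht : 0 ≤ t) :
    gaussianPi (Fin n × Fin d × Fin m)
        {w | t * frobNorm (B w) < frobNorm (noiseBlock w i * B w)}
      ≤ ENNReal.ofReal (Real.sqrt 2 ^ d * Real.exp (-(t ^ 2 / 4))) := by
  have h := gaussianPi_mul_tail_of_indep (p := fun q : Fin n × Fin d × Fin m => q.1 = i)
    (blockEquiv n d m i) hB (fun w w' hw => hindep w w' fun j hj => by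
      ext a b; exact hw (j, a, b) hj) ht
  rwa [Fintype.card_fin] at h

lemma sqrt_two_pow_le (k : ℕ) : Real.sqrt 2 ^ k ≤ Real.exp k := by
  have h2 : Real.sqrt 2 ≤ Real.exp 1 := by
    rw [Real.sqrt_le_left (Real.exp_pos _).le]
    nlinarith [Real.add_one_le_exp 1]
  calc _ ≤ Real.exp 1 ^ k := by gcongr
    _ = Real.exp k := by rw [← Real.exp_nat_mul, mul_one]

/-- Squaring the threshold gives at least `d + 2 γ log n` in the exponent; `d` pays for `√2 ^ d` and
the rest for `n ^ (-γ)`. -/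
lemma row_tail_le {γ : ℝ} (hn : 1 ≤ n) (hγ : 0 ≤ γ) :
    Real.sqrt 2 ^ d * Real.exp (-((2 * (Real.sqrt d + Real.sqrt (2 * γ * Real.log n))) ^ 2 / 4))
      ≤ (n : ℝ) ^ (-γ) := by
  have hn0 : (0 : ℝ) < n := by exact_mod_cast hn
  have hl : 0 ≤ Real.log n := Real.log_natCast_nonneg n
  have h1 := Real.sq_sqrt (Nat.cast_nonneg (α := ℝ) d)
  have h2 := Real.sq_sqrt (show 0 ≤ 2 * γ * Real.log n by positivity)
  have h3 := mul_nonneg (Real.sqrt_nonneg (d : ℝ)) (Real.sqrt_nonneg (2 * γ * Real.log n))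
  have h4 : 0 ≤ γ * Real.log n := by positivity
  rw [Real.rpow_def_of_pos hn0]
  refine (mul_le_mul_of_nonneg_right (sqrt_two_pow_le d) (Real.exp_pos _).le).trans ?_
  rw [← Real.exp_add]
  refine Real.exp_le_exp.2 ?_
  nlinarith

/-- Here `16² / 64 = 4`, so the exponent contains `4 (n d + m + 2 γ n log n)`. This beats `n d` from
`√2 ^ (n d)`, `4 m` from `8 ^ m`, and `γ log n`. -/
lemma op_tail_le {γ : ℝ} (hn : 1 ≤ n) (hγ : 0 ≤ γ) :
    Real.sqrt 2 ^ (n * d) * (8 ^ m * Real.exp (-((16 * (Real.sqrt (n * d) + Real.sqrt m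
      + Real.sqrt (2 * γ * n * Real.log n))) ^ 2 / 64))) ≤ (n : ℝ) ^ (-γ) := by
  have hn1 : (1 : ℝ) ≤ n := by exact_mod_cast hn
  have hn0 : (0 : ℝ) < n := by linarith
  have hl : 0 ≤ Real.log n := Real.log_natCast_nonneg n
  have h1 := Real.sq_sqrt (show (0 : ℝ) ≤ n * d by positivity)
  have h2 := Real.sq_sqrt (Nat.cast_nonneg (α := ℝ) m)
  have h3 := Real.sq_sqrt (show 0 ≤ 2 * γ * n * Real.log n by positivity)
  have hx := Real.sqrt_nonneg ((n : ℝ) * d)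
  have hy := Real.sqrt_nonneg (m : ℝ)
  have hz := Real.sqrt_nonneg (2 * γ * n * Real.log n)
  have h8 : (8 : ℝ) ^ m ≤ Real.exp (4 * m) := by
    have : (8 : ℝ) ≤ Real.exp 4 := by
      have e1 := Real.add_one_le_exp (1 : ℝ)
      have e2 : Real.exp 4 = Real.exp 1 ^ 4 := by rw [← Real.exp_nat_mul]; norm_num
      rw [e2]
      have : (2 : ℝ) ^ 4 ≤ Real.exp 1 ^ 4 := by gcongr; linarith
      linarith
    calc _ ≤ Real.exp 4 ^ m := by gcongr
      _ = _ := by rw [← Real.exp_nat_mul]; ring_nf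
  have h2' := sqrt_two_pow_le (n * d)
  push_cast at h2'
  have h4 : 0 ≤ γ * Real.log n := by positivity
  have h5 : γ * Real.log n ≤ γ * n * Real.log n := by nlinarith
  rw [Real.rpow_def_of_pos hn0]
  calc _ ≤ Real.exp (n * d) * (Real.exp (4 * m) * Real.exp (-((16 * (Real.sqrt (n * d) +
        Real.sqrt m + Real.sqrt (2 * γ * n * Real.log n))) ^ 2 / 64))) := by gcongr
    _ ≤ _ := by
      rw [← Real.exp_add, ← Real.exp_add]
      refine Real.exp_le_exp.2 ?_
      generalize Real.sqrt (n * d) = x at *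
      generalize Real.sqrt m = y at *
      generalize Real.sqrt (2 * γ * n * Real.log n) = z at *
      have := mul_nonneg hx hy
      have := mul_nonneg hx hz
      have := mul_nonneg hy hz
      nlinarith

/-- The noise satisfies the norm bound and acts on the signal and on the leave-one-out aggregates
as a generic Gaussian matrix. -/
structure TypicalNoise (A : Matrix (Fin d) (Fin m) ℝ) (O : Fin n → Matrix (Fin d) (Fin d) ℝ)
    (f : Matrix (Fin d) (Fin d) ℝ → Matrix (Fin d) (Fin d) ℝ) (σ γ : ℝ)
    (W : Fin n → Matrix (Fin d) (Fin m) ℝ) : Prop where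
  op_le : opNorm (stack W) ≤
    16 * (Real.sqrt (n * d) + Real.sqrt m + Real.sqrt (2 * γ * n * Real.log n))
  signal : ∀ i, frobNorm (W i * Aᵀ) ≤
    2 * (Real.sqrt d + Real.sqrt (2 * γ * Real.log n)) * frobNorm Aᵀ
  leaveOneOut : ∀ i, frobNorm (W i * leaveOneOut f A (rotatedNoise O σ W) i) ≤
    2 * (Real.sqrt d + Real.sqrt (2 * γ * Real.log n)) *
      frobNorm (leaveOneOut f A (rotatedNoise O σ W) i)

lemma gaussianPi_not_typicalNoise (hn : 1 ≤ n) {γ : ℝ} (hγ : 0 ≤ γ)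
    (A : Matrix (Fin d) (Fin m) ℝ) (O : Fin n → Matrix (Fin d) (Fin d) ℝ) (σ : ℝ)
    {f : Matrix (Fin d) (Fin d) ℝ → Matrix (Fin d) (Fin d) ℝ} (hf : Continuous f) :
    gaussianPi (Fin n × Fin d × Fin m) {w | ¬ TypicalNoise A O f σ γ (noiseBlock w)}
      ≤ ENNReal.ofReal (3 * (n : ℝ) ^ (-γ + 2)) := by
  have hn1 : (1 : ℝ) ≤ n := by exact_mod_cast hn
  have hn0 : (0 : ℝ) < n := by linarith
  set ℓ := 16 * (Real.sqrt (n * d) + Real.sqrt m + Real.sqrt (2 * γ * n * Real.log n)) with hℓ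
  set t := 2 * (Real.sqrt d + Real.sqrt (2 * γ * Real.log n)) with ht
  have hℓ0 : 0 ≤ ℓ := by positivity
  have ht0 : 0 ≤ t := by positivity
  set L : (Fin n × Fin d × Fin m → ℝ) → Fin n → Matrix (Fin m) (Fin d) ℝ :=
    fun w i => leaveOneOut f A (rotatedNoise O σ (noiseBlock w)) i with hL
  have hZ : Continuous fun w : Fin n × Fin d × Fin m → ℝ => rotatedNoise O σ (noiseBlock w) :=
    continuous_pi fun i => continuous_const.matrix_mul
      (((continuous_apply i).comp continuous_noiseBlock).const_smul σ)
  have hLc : ∀ i, Continuous fun w => L w i := by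
    intro i
    have hu := hZ.update i (continuous_const (y := (0 : Matrix (Fin d) (Fin m) ℝ)))
    have hit := continuous_symStep_iterate hf A hu n
    exact continuous_finsetSum _ fun j _ => ((continuous_apply j).comp hu).matrix_transpose.matrix_mul
      ((continuous_apply j).comp hit)
  -- Zeroing block `i` removes every dependence on it; this is the independence that leave-one-out
  -- provides.
  have hLi : ∀ i w w', (∀ j, j ≠ i → noiseBlock w j = noiseBlock w' j) → L w i = L w' i := by
    intro i w w' h
    have : Function.update (rotatedNoise O σ (noiseBlock w)) i 0
        = Function.update (rotatedNoise O σ (noiseBlock w')) i 0 := by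
      ext1 j
      by_cases hj : j = i
      · subst hj; simp
      · rw [Function.update_of_ne hj, Function.update_of_ne hj, rotatedNoise, rotatedNoise, h j hj]
    simp only [hL, leaveOneOut, this]
  have hstack : ∀ w : Fin n × Fin d × Fin m → ℝ,
      stack (noiseBlock w) = reindexMatrix (Equiv.prodAssoc _ _ _) w := fun w => rfl
  have h1 : gaussianPi (Fin n × Fin d × Fin m) {w | ℓ < opNorm (stack (noiseBlock w))}
      ≤ ENNReal.ofReal ((n : ℝ) ^ (-γ)) := by
    simp only [hstack]
    refine (gaussianPi_opNorm_tail _ hℓ0).trans (ENNReal.ofReal_le_ofReal ?_)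
    simp only [Fintype.card_prod, Fintype.card_fin]
    exact op_tail_le hn hγ
  have h2 : ∀ i, gaussianPi (Fin n × Fin d × Fin m)
      {w | t * frobNorm Aᵀ < frobNorm (noiseBlock w i * Aᵀ)} ≤ ENNReal.ofReal ((n : ℝ) ^ (-γ)) :=
    fun i => (noiseBlock_mul_tail i continuous_const (fun _ _ _ => rfl) ht0).trans
      (ENNReal.ofReal_le_ofReal (row_tail_le hn hγ))
  have h3 : ∀ i, gaussianPi (Fin n × Fin d × Fin m)
      {w | t * frobNorm (L w i) < frobNorm (noiseBlock w i * L w i)}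
        ≤ ENNReal.ofReal ((n : ℝ) ^ (-γ)) :=
    fun i => (noiseBlock_mul_tail i (hLc i) (hLi i) ht0).trans
      (ENNReal.ofReal_le_ofReal (row_tail_le hn hγ))
  have hsub : {w | ¬ TypicalNoise A O f σ γ (noiseBlock w)} ⊆
      {w | ℓ < opNorm (stack (noiseBlock w))} ∪
      ((⋃ i, {w | t * frobNorm Aᵀ < frobNorm (noiseBlock w i * Aᵀ)}) ∪
      ⋃ i, {w | t * frobNorm (L w i) < frobNorm (noiseBlock w i * L w i)}) := by
    intro w hw
    by_contra hc
    simp only [Set.mem_union, Set.mem_iUnion, Set.mem_ofPred_eq, not_or, not_exists, not_lt] at hc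
    exact hw ⟨hc.1, hc.2.1, hc.2.2⟩
  have hp : 0 ≤ (n : ℝ) ^ (-γ) := by positivity
  have hiU : ∀ T : Fin n → Set (Fin n × Fin d × Fin m → ℝ),
      (∀ i, gaussianPi _ (T i) ≤ ENNReal.ofReal ((n : ℝ) ^ (-γ))) →
      gaussianPi _ (⋃ i, T i) ≤ ENNReal.ofReal (n * (n : ℝ) ^ (-γ)) := by
    intro T hT
    refine (measure_iUnion_fintype_le _ _).trans ((Finset.sum_le_sum fun i _ => hT i).trans_eq ?_)
    rw [Finset.sum_const, Finset.card_univ, Fintype.card_fin, nsmul_eq_mul,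
      ENNReal.ofReal_mul hn0.le, ENNReal.ofReal_natCast]
  refine (measure_mono hsub).trans ((measure_union_le _ _).trans ((add_le_add h1
    ((measure_union_le _ _).trans (add_le_add (hiU _ h2) (hiU _ h3)))).trans ?_))
  rw [← ENNReal.ofReal_add (by positivity) (by positivity),
    ← ENNReal.ofReal_add (by positivity) (by positivity)]
  refine ENNReal.ofReal_le_ofReal ?_
  -- One global event and two union bounds over the blocks give `(1 + 2 n) n ^ (-γ)`, and `1 + 2 n ≤
  -- 3 n²`.
  rw [Real.rpow_add hn0, Real.rpow_two]
  nlinarith [mul_le_mul_of_nonneg_left hn1 hp, mul_nonneg hp (sub_nonneg.2 hn1)]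

/-- The noise is typical on an event of high probability. -/
lemma IsGaussianNoise.exists_typicalNoise {Ω : Type*} [MeasurableSpace Ω] {P : Measure Ω}
    [IsProbabilityMeasure P] {W : Fin n → Ω → Matrix (Fin d) (Fin m) ℝ} (hW : IsGaussianNoise P W)
    (hn : 1 ≤ n) {γ : ℝ} (hγ : 0 ≤ γ)
    (A : Matrix (Fin d) (Fin m) ℝ) (O : Fin n → Matrix (Fin d) (Fin d) ℝ) (σ : ℝ)
    {f : Matrix (Fin d) (Fin d) ℝ → Matrix (Fin d) (Fin d) ℝ} (hf : Continuous f) :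
    ∃ E : Set Ω, MeasurableSet E ∧ 1 - 3 * (n : ℝ) ^ (-γ + 2) ≤ P.real E ∧
      ∀ ω ∈ E, TypicalNoise A O f σ γ fun i => W i ω := by
  have hlaw := hW.2.hasLaw_pi (fun q : Fin n × Fin d × Fin m => hW.1 q.1 q.2.1 q.2.2)
  set X : Ω → Fin n × Fin d × Fin m → ℝ := fun ω q => W q.1 ω q.2.1 q.2.2 with hX
  set B := X ⁻¹' {w | ¬ TypicalNoise A O f σ γ (noiseBlock w)} with hB
  have hPB : P B ≤ ENNReal.ofReal (3 * (n : ℝ) ^ (-γ + 2)) := by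
    refine (Measure.le_map_apply hlaw.aemeasurable _).trans ?_
    rw [hlaw.map_eq]
    exact gaussianPi_not_typicalNoise hn hγ A O σ hf
  -- A measurable hull of the bad set has the same measure, so measurability of the bad set need not
  -- be checked.
  refine ⟨(toMeasurable P B)ᶜ, (measurableSet_toMeasurable _ _).compl, ?_, fun ω hω => ?_⟩
  · rw [probReal_compl_eq_one_sub (measurableSet_toMeasurable _ _), measureReal_def,
      measure_toMeasurable]
    exact sub_le_sub_left (ENNReal.toReal_le_of_le_ofReal (by positivity) hPB) _
  · by_contra hc
    exact hω (subset_toMeasurable P B hc)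

end Events

/-! ### From typical noise to the deterministic hypotheses. -/

section Main

variable {n d m : ℕ}

lemma sigmaMin_le_opNorm (hd : 1 ≤ d) (A : Matrix (Fin d) (Fin m) ℝ) : sigmaMin A ≤ opNorm A := by
  have h1 := sigmaMin_sq_mul_le hd A (Pi.single ⟨0, hd⟩ 1)
  have h2 := mulVec_sq_le Aᵀ (Pi.single ⟨0, hd⟩ 1)
  rw [opNorm_transpose] at h2
  have h3 : (Pi.single ⟨0, hd⟩ 1 : Fin d → ℝ) ⬝ᵥ Pi.single ⟨0, hd⟩ 1 = 1 := by simp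
  rw [h3, mul_one] at h1 h2
  exact le_of_sq_le_sq (h1.trans h2) (opNorm_nonneg A)

lemma noiseFactor_pos (hn : 1 ≤ n) (hd : 1 ≤ d) (m : ℕ) (γ : ℝ) : 0 < noiseFactor n d m γ := by
  have hn0 : (0 : ℝ) < n := by exact_mod_cast hn
  have hd0 : (0 : ℝ) < d := by exact_mod_cast hd
  have := Real.sqrt_pos.2 (mul_pos hn0 hd0)
  unfold noiseFactor
  positivity

lemma noiseBound_rotatedNoise {O : Fin n → Matrix (Fin d) (Fin d) ℝ}
    (hO : ∀ i, O i ∈ orthogonalGroup (Fin d) ℝ) {σ : ℝ} (hσ : 0 ≤ σ)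
    {W : Fin n → Matrix (Fin d) (Fin m) ℝ} {ℓ : ℝ} (hW : opNorm (stack W) ≤ ℓ) :
    NoiseBound (rotatedNoise O σ W) (σ * ℓ) where
  mul_le M := by
    have e : stack (rotatedNoise O σ W) * M = stack fun i => (O i)ᵀ * (σ • (W i * M)) := by
      rw [stack_mul]
      simp only [rotatedNoise, Matrix.mul_assoc, Matrix.smul_mul]
    have e2 : (stack fun i => σ • (W i * M)) = σ • (stack W * M) := by
      rw [stack_mul]; rfl
    have h3 : frobNorm (stack fun i => (O i)ᵀ * (σ • (W i * M)))
        = frobNorm (stack fun i => σ • (W i * M)) := by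
      rw [← sq_eq_sq₀ (frobNorm_nonneg _) (frobNorm_nonneg _), frobNorm_stack_sq,
        frobNorm_stack_sq]
      exact Finset.sum_congr rfl fun i _ => by
        rw [frobNorm_isometry_mul (by rw [transpose_transpose, orthogonal_mul_transpose (hO i)])]
    rw [e, h3, e2, frobNorm_smul, abs_of_nonneg hσ, mul_assoc]
    exact mul_le_mul_of_nonneg_left ((frobNorm_mul_le _ _).trans
      (mul_le_mul_of_nonneg_right hW (frobNorm_nonneg _))) hσ
  transpose_mul_le S := by
    have e : ∑ i, (rotatedNoise O σ W i)ᵀ * S i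
        = σ • ((stack W)ᵀ * stack fun i => O i * S i) := by
      rw [stack_transpose_mul, Finset.smul_sum]
      refine Finset.sum_congr rfl fun i _ => ?_
      rw [rotatedNoise, transpose_mul, transpose_transpose, transpose_smul, Matrix.smul_mul,
        Matrix.smul_mul, Matrix.mul_assoc]
    rw [e, frobNorm_smul, abs_of_nonneg hσ, mul_assoc, ← frobNorm_stack_orthogonal_mul hO S]
    refine mul_le_mul_of_nonneg_left ((frobNorm_mul_le _ _).trans
      (mul_le_mul_of_nonneg_right ?_ (frobNorm_nonneg _))) hσ
    rwa [opNorm_transpose]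

lemma frobNorm_rotatedNoise_mul {O : Fin n → Matrix (Fin d) (Fin d) ℝ}
    (hO : ∀ i, O i ∈ orthogonalGroup (Fin d) ℝ) {σ : ℝ} (hσ : 0 ≤ σ)
    (W : Fin n → Matrix (Fin d) (Fin m) ℝ) (i : Fin n) (B : Matrix (Fin m) (Fin d) ℝ) :
    frobNorm (rotatedNoise O σ W i * B) = σ * frobNorm (W i * B) := by
  rw [rotatedNoise, Matrix.mul_assoc, frobNorm_orthogonal_mul (orthogonal_transpose (hO i)),
    Matrix.smul_mul, frobNorm_smul, abs_of_nonneg hσ]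

lemma mul_rotatedNoise {O : Fin n → Matrix (Fin d) (Fin d) ℝ}
    (hO : ∀ i, O i ∈ orthogonalGroup (Fin d) ℝ) (σ : ℝ) (A : Matrix (Fin d) (Fin m) ℝ)
    (W : Fin n → Matrix (Fin d) (Fin m) ℝ) (i : Fin n) :
    O i * (A + rotatedNoise O σ W i) = O i * A + σ • W i := by
  rw [rotatedNoise, Matrix.mul_add, ← Matrix.mul_assoc, orthogonal_mul_transpose (hO i),
    Matrix.one_mul]

namespace TypicalNoise

variable {A : Matrix (Fin d) (Fin m) ℝ} {O : Fin n → Matrix (Fin d) (Fin d) ℝ}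
  {f : Matrix (Fin d) (Fin d) ℝ → Matrix (Fin d) (Fin d) ℝ} {σ γ : ℝ}
  {W : Fin n → Matrix (Fin d) (Fin m) ℝ}

lemma regime (h : TypicalNoise A O f σ γ W) (hO : ∀ i, O i ∈ orthogonalGroup (Fin d) ℝ)
    (hn : 1 ≤ n) (hd : 1 ≤ d) (hσ : 0 ≤ σ) (hA : 0 < sigmaMin A)
    (hq : 16 * (σ * noiseFactor n d m γ / Real.sqrt n)
      ≤ sigmaMin A ^ 4 / (2000 * opNorm A ^ 3)) :
    Regime A (rotatedNoise O σ W) (opNorm A) (sigmaMin A)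
      (σ * (16 * (Real.sqrt (n * d) + Real.sqrt m + Real.sqrt (2 * γ * n * Real.log n))))
      (16 * (σ * noiseFactor n d m γ / Real.sqrt n)) where
  one_le_n := hn
  one_le_d := hd
  s_pos := hA
  s_le := sigmaMin_le_opNorm hd A
  op_le := le_rfl
  le_op := sigmaMin_sq_mul_le hd A
  noise := noiseBound_rotatedNoise hO hσ h.op_le
  w_nonneg := by positivity
  w_le := by
    have : 0 < Real.sqrt n := Real.sqrt_pos.2 (by exact_mod_cast hn)
    rw [noiseFactor]
    field_simp
    exact le_rfl
  q_le := hq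

/-- Dividing by `√n` turns `√(n d)` and `√(2 γ n log n)` into the single-block quantities, so the
blockwise tail level is dominated by the same `q` that governs the operator norm. -/
lemma two_mul_row_le (hn : 1 ≤ n) (hσ : 0 ≤ σ) :
    σ * (2 * (Real.sqrt d + Real.sqrt (2 * γ * Real.log n))) * Real.sqrt d
      ≤ 16 * (σ * noiseFactor n d m γ / Real.sqrt n) := by
  have hn0 : (0 : ℝ) < n := by exact_mod_cast hn
  have h0 : 0 < Real.sqrt n := Real.sqrt_pos.2 hn0
  have h1 : Real.sqrt (n * d) = Real.sqrt n * Real.sqrt d := Real.sqrt_mul hn0.le _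
  have h2 : Real.sqrt (2 * γ * n * Real.log n)
      = Real.sqrt n * Real.sqrt (2 * γ * Real.log n) := by
    rw [← Real.sqrt_mul hn0.le]; congr 1; ring
  have h3 : 16 * (σ * noiseFactor n d m γ / Real.sqrt n) = 16 * (σ * (Real.sqrt d *
      (Real.sqrt d + Real.sqrt m / Real.sqrt n + Real.sqrt (2 * γ * Real.log n)))) := by
    rw [noiseFactor, h1, h2]; field_simp
  rw [h3]
  have h4 : 0 ≤ Real.sqrt m / Real.sqrt n := by positivity
  have h5 := mul_nonneg hσ (Real.sqrt_nonneg d)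
  have h6 := Real.sqrt_nonneg (d : ℝ)
  have h7 := Real.sqrt_nonneg (2 * γ * Real.log n)
  nlinarith [mul_nonneg h5 h4, mul_nonneg h5 h6, mul_nonneg h5 h7]

lemma decoupled (h : TypicalNoise A O f σ γ W) (hO : ∀ i, O i ∈ orthogonalGroup (Fin d) ℝ)
    (hσ : 0 ≤ σ) {s w : ℝ}
    (hR : Regime A (rotatedNoise O σ W) (opNorm A) s w
      (16 * (σ * noiseFactor n d m γ / Real.sqrt n)))
    (hf : Regime.IsTruncatedPolar n A (opNorm A) s f) :
    Regime.Decoupled A (rotatedNoise O σ W) f (opNorm A) w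
      (16 * (σ * noiseFactor n d m γ / Real.sqrt n)) where
  signal i := by
    rw [frobNorm_rotatedNoise_mul hO hσ]
    have h1 := frobNorm_le_opNorm Aᵀ
    rw [opNorm_transpose, Fintype.card_fin] at h1
    have h2 := two_mul_row_le (d := d) (m := m) (γ := γ) hR.one_le_n hσ
    calc _ ≤ σ * (2 * (Real.sqrt d + Real.sqrt (2 * γ * Real.log n)) *
            (Real.sqrt d * opNorm A)) := by
          refine mul_le_mul_of_nonneg_left ((h.signal i).trans ?_) hσ
          gcongr
      _ = opNorm A * (σ * (2 * (Real.sqrt d + Real.sqrt (2 * γ * Real.log n))) *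
            Real.sqrt d) := by ring
      _ ≤ _ := mul_le_mul_of_nonneg_left h2 (opNorm_nonneg A)
  leaveOneOut i := by
    rw [frobNorm_rotatedNoise_mul hO hσ]
    have h1 := (hR.update_zero i).noise.transpose_mul_le
      ((symStep f A (Function.update (rotatedNoise O σ W) i 0))^[n] 1)
    rw [frobNorm_stack_orthogonal fun j => (Regime.nearOne_iterate hf n j).1] at h1
    have h2 := two_mul_row_le (d := d) (m := m) (γ := γ) hR.one_le_n hσ
    have hw := hR.w_nonneg
    calc _ ≤ σ * (2 * (Real.sqrt d + Real.sqrt (2 * γ * Real.log n)) *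
            (w * (Real.sqrt n * Real.sqrt d))) := by
          refine mul_le_mul_of_nonneg_left ((h.leaveOneOut i).trans ?_) hσ
          exact mul_le_mul_of_nonneg_left h1 (by positivity)
      _ = (σ * (2 * (Real.sqrt d + Real.sqrt (2 * γ * Real.log n))) * Real.sqrt d)
            * (w * Real.sqrt n) := by ring
      _ ≤ 16 * (σ * noiseFactor n d m γ / Real.sqrt n) * (w * Real.sqrt n) :=
          mul_le_mul_of_nonneg_right h2 (by positivity)
      _ = _ := by ring

end TypicalNoise

lemma noise_level_le (hn : 1 ≤ n) (hd : 1 ≤ d) {A : Matrix (Fin d) (Fin m) ℝ}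
    (hA : 0 < sigmaMin A) {σ γ : ℝ}
    (hσ : σ ≤ 1 / 32000 * (sigmaMin A / condNumber A ^ 4 *
      (Real.sqrt n / noiseFactor n d m γ))) :
    16 * (σ * noiseFactor n d m γ / Real.sqrt n)
      ≤ sigmaMin A ^ 4 / (2000 * opNorm A ^ 3) := by
  have hN := noiseFactor_pos hn hd m γ
  have h0 : 0 < Real.sqrt n := Real.sqrt_pos.2 (by exact_mod_cast hn)
  have hsa := sigmaMin_le_opNorm hd A
  have ha := hA.trans_le hsa
  calc _ ≤ 16 * (1 / 32000 * (sigmaMin A / condNumber A ^ 4 *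
        (Real.sqrt n / noiseFactor n d m γ)) * noiseFactor n d m γ / Real.sqrt n) := by gcongr
    -- The constant is `16 / 32000 = 1 / 2000`; the fourth power of the condition number leaves a
    -- spare factor `sigmaMin A / opNorm A`, at most `1`.
    _ = sigmaMin A ^ 4 / (2000 * opNorm A ^ 3) * (sigmaMin A / opNorm A) := by
      rw [condNumber]; field_simp; norm_num
    _ ≤ sigmaMin A ^ 4 / (2000 * opNorm A ^ 3) * 1 := by
      have := (div_le_one ha).2 hsa
      gcongr
    _ = _ := mul_one _

end Main

end Procrustes

end

theorem theorem3p3 :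
    ∃ c C K : ℝ, 0 < c ∧ 0 < C ∧ 0 < K ∧
      ∀ (n d m : ℕ), 1 ≤ n → 1 ≤ d → d ≤ m →
      ∀ (A : Matrix (Fin d) (Fin m) ℝ), 0 < Procrustes.sigmaMin A →
      ∀ (O : Fin n → Matrix (Fin d) (Fin d) ℝ),
        (∀ i, O i ∈ Matrix.orthogonalGroup (Fin d) ℝ) →
      ∀ (σ γ : ℝ), 0 ≤ σ → 2 ≤ γ →
        σ ≤ c * (Procrustes.sigmaMin A / Procrustes.condNumber A ^ 4 *
          (Real.sqrt n / Procrustes.noiseFactor n d m γ)) →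
      ∀ (Ω : Type*) [MeasurableSpace Ω] (P : MeasureTheory.Measure Ω)
        [MeasureTheory.IsProbabilityMeasure P]
        (W : Fin n → Ω → Matrix (Fin d) (Fin m) ℝ), Procrustes.IsGaussianNoise P W →
      ∃ E : Set Ω, MeasurableSet E ∧ 1 - K * (n : ℝ) ^ (-γ + 2) ≤ P.real E ∧
        ∀ ω ∈ E, ∀ S : ℕ → Fin n → Matrix (Fin d) (Fin d) ℝ,
          Procrustes.IsSpectralGPM (fun i => O i * A + σ • W i ω) S →
          (∃ L : Fin n → Matrix (Fin d) (Fin d) ℝ, Procrustes.IsLimitPoint S L) ∧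
          ∀ L : Fin n → Matrix (Fin d) (Fin d) ℝ, Procrustes.IsLimitPoint S L →
            (∃ Q ∈ Matrix.orthogonalGroup (Fin d) ℝ, ∀ i,
              Procrustes.frobNorm (L i - O i * Q) ≤
                C * (Procrustes.condNumber A ^ 2 / Procrustes.opNorm A *
                  (σ * Procrustes.noiseFactor n d m γ / Real.sqrt n))) ∧
            (∃ Q ∈ Matrix.orthogonalGroup (Fin d) ℝ,
              Procrustes.frobNorm
                  ((1 / (n : ℝ)) • ∑ i, (L i)ᵀ * (O i * A + σ • W i ω) - Q * A) ≤
                C * (Procrustes.condNumber A ^ 2 * σ *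
                  Procrustes.noiseFactor n d m γ / Real.sqrt n)) ∧
            ((∀ i, O i = 1) →
              ∃ Q ∈ Matrix.orthogonalGroup (Fin d) ℝ,
                Procrustes.frobNorm
                    ((1 / (n : ℝ)) • ∑ i, L i * (O i * A + σ • W i ω) - Q * A) ≤
                  C * (Procrustes.condNumber A ^ 2 * σ *
                    Procrustes.noiseFactor n d m γ / Real.sqrt n)) := by

  -- With `q` equal to `16` times the normalized noise level, the deterministic constants `7` and
  -- `8` become `112` and `128`; `3` counts the bad events.
  refine ⟨1 / 32000, 128, 3, by norm_num, by norm_num, by norm_num, ?_⟩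
  intro n d m hn hd _ A hA O hO σ γ hσ hγ hσc Ω _ P _ W hW
  have ha := hA.trans_le (Procrustes.sigmaMin_le_opNorm hd A)
  have hN := Procrustes.noiseFactor_pos hn hd m γ
  obtain ⟨f, hf⟩ := Procrustes.Regime.exists_isTruncatedPolar hn hA
    (Procrustes.sigmaMin_le_opNorm hd A) (Procrustes.sigmaMin_sq_mul_le hd A)
  obtain ⟨E, hEm, hEp, hE⟩ := hW.exists_typicalNoise hn (show 0 ≤ γ by linarith) A O σ
    (Procrustes.continuous_of_frobNorm_sub_le hf.lipschitz)
  refine ⟨E, hEm, hEp, fun ω hω S hS => ?_⟩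
  have hT := hE ω hω
  have hR := hT.regime hO hn hd hσ hA (Procrustes.noise_level_le hn hd hA hσc)
  simp only [← Procrustes.mul_rotatedNoise hO σ A fun i => W i ω] at hS ⊢
  obtain ⟨hlim, hall⟩ := hR.gpm_converges hf (hT.decoupled hO hσ hR hf) hO hS
  have hκ : Procrustes.condNumber A = Procrustes.opNorm A / Procrustes.sigmaMin A := rfl
  have hb1 : 7 * (Procrustes.opNorm A * (16 * (σ * Procrustes.noiseFactor n d m γ / Real.sqrt n))
      / Procrustes.sigmaMin A ^ 2) ≤ 128 * (Procrustes.condNumber A ^ 2 / Procrustes.opNorm A *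
        (σ * Procrustes.noiseFactor n d m γ / Real.sqrt n)) := by
    have e : Procrustes.condNumber A ^ 2 / Procrustes.opNorm A
        = Procrustes.opNorm A / Procrustes.sigmaMin A ^ 2 := by rw [hκ]; field_simp
    rw [e]
    calc _ = 112 * (Procrustes.opNorm A / Procrustes.sigmaMin A ^ 2 *
          (σ * Procrustes.noiseFactor n d m γ / Real.sqrt n)) := by ring
      _ ≤ _ := mul_le_mul_of_nonneg_right (by norm_num) (by positivity)
  have hb2 : 8 * (Procrustes.opNorm A ^ 2 *
      (16 * (σ * Procrustes.noiseFactor n d m γ / Real.sqrt n)) / Procrustes.sigmaMin A ^ 2)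
      = 128 * (Procrustes.condNumber A ^ 2 * σ * Procrustes.noiseFactor n d m γ / Real.sqrt n) := by
    rw [hκ, div_pow]; ring
  refine ⟨hlim, fun L hL => ?_⟩
  obtain ⟨⟨Q, hQ, hLQ⟩, h2, h3⟩ := hall L hL
  rw [hb2] at h2 h3
  exact ⟨⟨Q, hQ, fun i => (hLQ i).trans hb1⟩, h2, h3⟩
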